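/- Theorem 8. All manifolds are smooth, finite dimensional, Hausdorff and without boundary. Let $\pi:\eta\to B$ be a smooth fiber bundle (or, more generally, any smooth submersion) with vertical bundle $K_e=\ker T_e\pi=T_e(\eta_{\pi(e)})$, where $\eta_b=\pi^{-1}(b)$. Let an Ehresmann connection on it be given by projections $V_e$ of $T_e\eta$ onto $K_e$, smooth in $e$, with horizontal bundle $H_e=\ker V_e$. Regard $H$ and $K$ also as submanifolds of $T\eta$, and let $\omega:T(T\eta)\to T(T\eta)$ be the canonical involution, $(x,y;u,v)\mapsto(x,u;y,v)$ in charts. Let $I=[a,b]$, $a<b$, let $\beta_0:I\to\eta$ be a smooth horizontal path, i.e. $\dot\beta_0(t)\in H_{\beta_0(t)}$ for all $t\in I$, and let $\gamma=\pi\circ\beta_0$. The canonical linear connection on $\beta_0^*K\to I$ is the one with horizontal subspaces $(Tq)^{-1}\bigl(T_kK\cap\omega(TH)\bigr)$, where $q:\beta_0^*K\to K$ is the canonical map; denote its covariant derivative by $\nabla^{\beta_0^*K}$. (1) For all $s,t\in I$ the parallel transport of the canonical linear connection is a well-defined linear map $\tau_s^t:K_{\beta_0(s)}\to K_{\beta_0(t)}$;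 the Ehresmann parallel transport along $\gamma$ (following horizontal lifts of $\gamma$ from time $s$ to time $t$) is a well-defined bijection $\gamma_s^t$ from a neighbourhood of $\beta_0(s)$ in $\eta_{\gamma(s)}$ onto a neighbourhood of $\beta_0(t)$ in $\eta_{\gamma(t)}$, it is differentiable at $\beta_0(s)$, and $$\tau_s^t=T_{\beta_0(s)}\gamma_s^t .$$ (2) Let $\eta=E$ be a smooth vector bundle over $B$, let the connection be linear (that is, $V$ is linear also with respect to the tangent vector bundle structure $T\pi:TE\to TB$), and put $\Psi(e,u)=\frac{d}{dr}(e+ru)|_{r=0}\in K_e$ for $e,u$ in the same fiber of $E$. The covariant derivative $\nabla$ on $E$ is defined by $\Psi(\alpha_x,\nabla_v\alpha)=V_{\alpha_x}(T_x\alpha\cdot v)$ for a smooth section $\alpha$ and $v\in T_xB$. Then for every smooth section $\alpha$ of $E$, $t\mapsto\Psi(\beta_0(t),\alpha_{\gamma(t)})$ is a smooth section of $\beta_0^*K$ and, for all $t\in I$, $$\Psi\bigl(\beta_0(t),\nabla_{\dot\gamma(t)}\alpha\bigr)=\nabla^{\beta_0^*K}_{\partial/\partial t}\,\Psi\bigl(\beta_0(t),\alpha_{\gamma(t)}\bigr).$$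 -/

import Mathlib

open Set Bundle
open scoped Manifold ContDiff Topology

noncomputable section

namespace Ehresmann

section General

variable {EM HM M : Type*} [NormedAddCommGroup EM] [NormedSpace ℝ EM] [TopologicalSpace HM]
  (I : ModelWithCorners ℝ EM HM) [TopologicalSpace M] [ChartedSpace HM M]

/-- The velocity `(c t, ċ t)`, a point of the tangent bundle, at the time `t` of a curve `c` that is
considered on the set `J` of times (so that it is one-sided at the end points of an interval). -/
def velocity (c : ℝ → M) (J : Set ℝ) (t : ℝ) : TangentBundle I M :=
  ⟨c t, mfderivWithin 𝓘(ℝ, ℝ) I c J t (1 : ℝ)⟩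

/-- The set `TS ⊆ TM` of the tangent vectors to a subset `S` of `M`: the velocities at time `0` of the
smooth curves that run in `S`. If `S` is a submanifold this is its tangent bundle. -/
def tangentSet (S : Set M) : Set (TangentBundle I M) :=
  {W | ∃ c : ℝ → M, ContMDiffAt 𝓘(ℝ, ℝ) I ∞ c 0 ∧ (∀ᶠ r in 𝓝 (0 : ℝ), c r ∈ S) ∧
    velocity I c univ 0 = W}

variable [IsManifold I 1 M]

/-- The canonical involution `ω : T(TM) → T(TM)`, which is `(x, y; u, v) ↦ (x, u; y, v)` in any chart
of `M`. In Mathlib the tangent space at `x` is the model space, through the preferred chart at `x`,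
and the preferred chart of `TM` at `(x, y)` is the one induced by the preferred chart of `M` at `x`.
So both sides are written here in the preferred chart of `M` at `x`. -/
def flip (W : TangentBundle I.tangent (TangentBundle I M)) :
    TangentBundle I.tangent (TangentBundle I M) :=
  let y : EM := W.proj.snd
  let uv : EM × EM := W.snd
  ⟨⟨W.proj.proj, uv.1⟩, ((y, uv.2) : EM × EM)⟩

end General

section VerticalLift

variable {EB HB B : Type*} [NormedAddCommGroup EB] [NormedSpace ℝ EB] [TopologicalSpace HB]
  (IB : ModelWithCorners ℝ EB HB) [TopologicalSpace B] [ChartedSpace HB B]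
  (F : Type*) [NormedAddCommGroup F] [NormedSpace ℝ F]
  (E : B → Type*) [TopologicalSpace (TotalSpace F E)] [∀ b, AddCommGroup (E b)]
  [∀ b, Module ℝ (E b)] [∀ b, TopologicalSpace (E b)] [FiberBundle F E]

/-- For a vector bundle `E` over `B`, a point `e` of `E` and `u` in the fibre through `e`, the vector
`Ψ(e, u) = d/dr (e + r u)|_{r = 0}`, which is tangent at `e` to the fibre through `e`. -/
def vertLift (e : TotalSpace F E) (u : E e.proj) : TangentSpace (IB.prod 𝓘(ℝ, F)) e :=
  mfderiv 𝓘(ℝ, ℝ) (IB.prod 𝓘(ℝ, F))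
    (fun r : ℝ => (⟨e.proj, e.snd + r • u⟩ : TotalSpace F E)) 0 (1 : ℝ)

end VerticalLift

section Connection

variable {EB HB B : Type*} [NormedAddCommGroup EB] [NormedSpace ℝ EB] [TopologicalSpace HB]
  (IB : ModelWithCorners ℝ EB HB) [TopologicalSpace B] [ChartedSpace HB B]
  {EM HM M : Type*} [NormedAddCommGroup EM] [NormedSpace ℝ EM] [TopologicalSpace HM]
  (I : ModelWithCorners ℝ EM HM) [TopologicalSpace M] [ChartedSpace HM M]

/-- The vertical subspace `K_e = ker T_e p` of `T_e M`. -/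
def vert (p : M → B) (e : M) : Submodule ℝ (TangentSpace I e) :=
  (mfderiv I IB p e : TangentSpace I e →L[ℝ] TangentSpace IB (p e)).ker

variable [IsManifold I 1 M]

/-- An Ehresmann connection on `p : M → B`: a projection `V_e` of every tangent space `T_e M` onto the
vertical subspace `ker T_e p`, which depends smoothly on `e`. -/
structure Connection (p : M → B) where
  /-- the vertical projection -/
  V : ∀ e : M, TangentSpace I e →L[ℝ] TangentSpace I e
  idem : ∀ (e : M) (v : TangentSpace I e), V e (V e v) = V e v
  range_eq : ∀ e : M, (V e).range = vert IB I p e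
  smooth : ContMDiff I.tangent I.tangent ∞
    (fun X : TangentBundle I M => (⟨X.proj, V X.proj X.snd⟩ : TangentBundle I M))

variable {IB I} {p : M → B}

namespace Connection

/-- The horizontal subspace `H_e` of `T_e M`, supplementary to `K_e`. -/
def hor (C : Connection IB I p) (e : M) : Submodule ℝ (TangentSpace I e) :=
  (C.V e).ker

/-- The total space of the horizontal bundle `H`. -/
def horSet (C : Connection IB I p) : Set (TangentBundle I M) :=
  {X | X.snd ∈ C.hor X.proj}

/-- The total space of the vertical bundle `K`. -/
def vertSet (_C : Connection IB I p) : Set (TangentBundle I M) :=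
  {X | X.snd ∈ vert IB I p X.proj}

/-- `β` is a smooth horizontal path on the set `J` of times. -/
def IsHorizontalOn (C : Connection IB I p) (J : Set ℝ) (β : ℝ → M) : Prop :=
  ContMDiffOn 𝓘(ℝ, ℝ) I ∞ β J ∧ ∀ t ∈ J, velocity I β J t ∈ C.horSet

/-- The (nonlinear) parallel transport of the connection along the path `γ` of the base, from time `s`
to time `t`, takes the point `e` of the fibre over `γ s` to the point `f` of the fibre over `γ t`:
there is a horizontal lift of `γ`, between the times `s` and `t`, from `e` to `f`. -/
def Transports (C : Connection IB I p) (γ : ℝ → B) (s t : ℝ) (e f : M) : Prop :=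
  ∃ δ : ℝ → M, C.IsHorizontalOn (uIcc s t) δ ∧ (∀ r ∈ uIcc s t, p (δ r) = γ r) ∧
    δ s = e ∧ δ t = f

/-- The set `TK ∩ ω(TH) ⊆ T(TM)`. For a horizontal path `β`, the inverse image of
`T_k K ∩ ω(TH)` under the tangent map of the canonical map `q : β*K → K` is the horizontal subspace at
`k` of the canonical linear connection on the vector bundle `β*K`. -/
def canonicalHor (C : Connection IB I p) :
    Set (TangentBundle I.tangent (TangentBundle I M)) :=
  tangentSet I.tangent C.vertSet ∩ flip I '' tangentSet I.tangent C.horSet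

/-- `σ` is a smooth section of `β*K` over the set `J` of times. -/
def IsSectionOn (C : Connection IB I p) (β : ℝ → M) (J : Set ℝ)
    (σ : ∀ t : ℝ, TangentSpace I (β t)) : Prop :=
  ContMDiffOn 𝓘(ℝ, ℝ) I.tangent ∞ (fun t : ℝ => (⟨β t, σ t⟩ : TangentBundle I M)) J ∧
    ∀ t ∈ J, (⟨β t, σ t⟩ : TangentBundle I M) ∈ C.vertSet

/-- `σ` is a parallel section, over `J`, for the canonical linear connection on `β*K`: its velocity is
horizontal. -/
def IsParallelOn (C : Connection IB I p) (β : ℝ → M) (J : Set ℝ)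
    (σ : ∀ t : ℝ, TangentSpace I (β t)) : Prop :=
  C.IsSectionOn β J σ ∧
    ∀ t ∈ J, velocity I.tangent (fun r : ℝ => (⟨β r, σ r⟩ : TangentBundle I M)) J t ∈ C.canonicalHor

/-- The linear parallel transport, from time `s` to time `t`, of the canonical linear connection on
`β*K` takes `w ∈ K_{β s}` to `z ∈ K_{β t}`. -/
def LinTransports (C : Connection IB I p) (β : ℝ → M) (s t : ℝ)
    (w : vert IB I p (β s)) (z : vert IB I p (β t)) : Prop :=
  ∃ σ : ∀ r : ℝ, TangentSpace I (β r), C.IsParallelOn β (uIcc s t) σ ∧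
    σ s = (w : TangentSpace I (β s)) ∧ σ t = (z : TangentSpace I (β t))

/-- `z ∈ K_{β t}` is the covariant derivative `∇_{∂/∂t} σ` at the time `t ∈ J` of the section `σ` of
`β*K`, for the canonical linear connection: the vertical part of the velocity of `σ` is `Ψ(σ t, z)`,
that is, their difference is horizontal. -/
def IsCovDerivAt (C : Connection IB I p) (β : ℝ → M) (J : Set ℝ)
    (σ : ∀ t : ℝ, TangentSpace I (β t)) (t : ℝ) (z : TangentSpace I (β t)) : Prop :=
  z ∈ vert IB I p (β t) ∧
    let X : TangentBundle I M := ⟨β t, σ t⟩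
    let v : TangentSpace I.tangent X :=
      (velocity I.tangent (fun r : ℝ => (⟨β r, σ r⟩ : TangentBundle I M)) J t).snd
    let ψ : TangentSpace I.tangent X := vertLift I EM (TangentSpace I : M → Type _) X z
    (⟨X, v - ψ⟩ : TangentBundle I.tangent (TangentBundle I M)) ∈ C.canonicalHor

end Connection

/-- The map `g` between fibres of `p`, defined near `e` in the fibre through `e`, is differentiable at
`e` along that fibre, it takes `e` to `f`, and its tangent map at `e` is `τ : K_e → K_f`. Here `K_e` is
the tangent space at `e` of the fibre through `e`. -/
def HasFibreTangentMap (g : M → M) (e f : M)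
    (τ : vert IB I p e →ₗ[ℝ] vert IB I p f) : Prop :=
  ∃ L : TangentSpace I e →L[ℝ] TangentSpace I (g e),
    HasMFDerivWithinAt I I g (p ⁻¹' {p e}) e L ∧
    ∀ w : vert IB I p e, (⟨g e, L w⟩ : TangentBundle I M) = ⟨f, (τ w : TangentSpace I f)⟩

end Connection

section Linear

variable {EB HB B : Type*} [NormedAddCommGroup EB] [NormedSpace ℝ EB] [TopologicalSpace HB]
  {IB : ModelWithCorners ℝ EB HB} [TopologicalSpace B] [ChartedSpace HB B]
  {F : Type*} [NormedAddCommGroup F] [NormedSpace ℝ F]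
  {E : B → Type*} [TopologicalSpace (TotalSpace F E)] [∀ b, AddCommGroup (E b)]
  [∀ b, Module ℝ (E b)] [∀ b, TopologicalSpace (E b)] [FiberBundle F E] [VectorBundle ℝ F E]
  [IsManifold IB 1 B] [ContMDiffVectorBundle 1 F E IB]

/-- The sum `E ×_B E → E` in the fibres of a vector bundle. -/
def fibreAdd (x : TotalSpace (F × F) (E ×ᵇ E)) : TotalSpace F E :=
  ⟨x.proj, x.snd.1 + x.snd.2⟩

/-- The first projection `E ×_B E → E`. -/
def fibreFst (x : TotalSpace (F × F) (E ×ᵇ E)) : TotalSpace F E := ⟨x.proj, x.snd.1⟩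

/-- The second projection `E ×_B E → E`. -/
def fibreSnd (x : TotalSpace (F × F) (E ×ᵇ E)) : TotalSpace F E := ⟨x.proj, x.snd.2⟩

/-- The multiplication by the scalar `r` in the fibres of a vector bundle. -/
def fibreSMul (r : ℝ) (e : TotalSpace F E) : TotalSpace F E := ⟨e.proj, r • e.snd⟩

/-- The connection on the vector bundle `E` is linear: `V` is linear also for the tangent vector bundle
structure `Tp : TE → TB`, whose sum and multiplication by scalars are the tangent maps of those of
`E`. The tangent space of `E ×_B E` is the fibre product of those of `E` through the tangent maps of
the two projections: so `Ts W` is the sum of `T pr₁ W` and `T pr₂ W`, and every pair of vectors of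
`TE` with the same image in `TB` is obtained in this way from exactly one `W`. -/
def Connection.IsLinear
    (C : Connection IB (IB.prod 𝓘(ℝ, F)) (TotalSpace.proj : TotalSpace F E → B)) : Prop :=
  (∀ (x : TotalSpace (F × F) (E ×ᵇ E)) (W W' : TangentSpace (IB.prod 𝓘(ℝ, F × F)) x),
    mfderiv (IB.prod 𝓘(ℝ, F × F)) (IB.prod 𝓘(ℝ, F)) fibreFst x W' =
      C.V (fibreFst x) (mfderiv (IB.prod 𝓘(ℝ, F × F)) (IB.prod 𝓘(ℝ, F)) fibreFst x W) →
    mfderiv (IB.prod 𝓘(ℝ, F × F)) (IB.prod 𝓘(ℝ, F)) fibreSnd x W' =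
      C.V (fibreSnd x) (mfderiv (IB.prod 𝓘(ℝ, F × F)) (IB.prod 𝓘(ℝ, F)) fibreSnd x W) →
    mfderiv (IB.prod 𝓘(ℝ, F × F)) (IB.prod 𝓘(ℝ, F)) fibreAdd x W' =
      C.V (fibreAdd x) (mfderiv (IB.prod 𝓘(ℝ, F × F)) (IB.prod 𝓘(ℝ, F)) fibreAdd x W)) ∧
  ∀ (r : ℝ) (e : TotalSpace F E) (Z : TangentSpace (IB.prod 𝓘(ℝ, F)) e),
    C.V (fibreSMul r e) (mfderiv (IB.prod 𝓘(ℝ, F)) (IB.prod 𝓘(ℝ, F)) (fibreSMul r) e Z) =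
      mfderiv (IB.prod 𝓘(ℝ, F)) (IB.prod 𝓘(ℝ, F)) (fibreSMul r) e (C.V e Z)

/-- `n ∈ E_b` is the covariant derivative `∇_v α` at `b` of the section `α` of `E`, for `v ∈ T_b B`:
the vertical part of `Tα · v` is `Ψ(α b, n)`. -/
def Connection.IsNabla
    (C : Connection IB (IB.prod 𝓘(ℝ, F)) (TotalSpace.proj : TotalSpace F E → B))
    (α : ∀ b : B, E b) (b : B) (v : TangentSpace IB b) (n : E b) : Prop :=
  vertLift IB F E ⟨b, α b⟩ n =
    C.V ⟨b, α b⟩ (mfderiv IB (IB.prod 𝓘(ℝ, F)) (fun b' : B => (⟨b', α b'⟩ : TotalSpace F E)) b v)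

end Linear

end Ehresmann

end

open Set Bundle
open scoped Manifold ContDiff Topology

noncomputable section

/-! In a chart an Ehresmann connection is a field V of projections: K consists of the pairs (z, y)
with V y = y, and H of those with V y = 0. A vector (z, y; u, v) is tangent to K iff V y = y and
DV(u) y + V v = v. It lies in ω(TH) iff V u = 0 and DV(y) u + V v = 0. By the derivative of V² = V,
the two together say V y = y, V u = 0 and v = DV(u) y − DV(y) u
(`tangent_vertical_and_flip_horizontal_iff`, `Connection.mem_canonicalHor_iff`). So the parallel
sections along β are the vertical solutions of the linear equation y' = DV(β') y − DV(y) β'.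

The horizontal lifts of γ solve z' = X_t(z), where X_t(z) is the horizontal lift of γ'(t) to z. The
tangent map of the flow along β solves the linearized equation y' = DX_t(β) y (`exists_local_flow`).
For vertical y, differentiating V X_t = 0 and Dp X_t = γ', and using the symmetry of D²p, gives DX_t
y = DV(X_t) y − DV(y) X_t (`fderiv_horizontal_lift_apply`). As X_t(β) = β', this is the equation of
parallel sections, so the two transports correspond near every time. A Lebesgue number of [a, b] and
the chain rule carry this over to all of [a, b] (`Connection.HasTransport.trans`,
`Connection.hasTransport`).

Both transports are treated as relations given by sets of admissible velocities that lie locally in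
a smooth vector field (`IsODE`), on M for lifts and on TM for parallel sections. Uniqueness,
smoothness and gluing are proved once for such sets; existence comes from the local flow. The
bijection between neighbourhoods is then formal: the relation can be reversed and is single-valued
in both directions.

For (2), in a bundle chart V at (x, e) is (u, f) ↦ (0, f + Γ_x(u, e)), and Γ is linear in e because
the connection is linear. Thus DV(w)(0, f) = 0 and DV(0, α)(u, f) = V_α(u, 0). The lifted section
(β, (0, α)) has velocity (β', (0, α')), with β' horizontal, whereas horizontality over β' requires
the second entry to be −V_α(γ', 0). The difference is V_α(γ', α'), the vertical part of Tα · γ'. -/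

namespace Ehresmann

/-! ### Differential equations in a normed space: uniqueness, local flow, linearization. -/

section ODEs

variable {E : Type*} [NormedAddCommGroup E] [NormedSpace ℝ E]

/-- Grönwall's inequality in both directions of time. -/
theorem norm_le_gronwallBound_abs {z z' : ℝ → E} {c d t₀ K ε : ℝ} (ht₀ : t₀ ∈ Icc c d)
    (hz : ∀ r ∈ Icc c d, HasDerivWithinAt z (z' r) (Icc c d) r)
    (hb : ∀ r ∈ Icc c d, ‖z' r‖ ≤ K * ‖z r‖ + ε) :
    ∀ r ∈ Icc c d, ‖z r‖ ≤ gronwallBound ‖z t₀‖ K ε |r - t₀| := by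
  have hc : ContinuousOn z (Icc c d) := fun r hr => (hz r hr).continuousWithinAt
  intro r hr
  rcases le_total t₀ r with h | h
  · rw [abs_of_nonneg (sub_nonneg.2 h)]
    refine norm_le_gronwallBound_of_norm_deriv_right_le (f := z) (f' := z') (a := t₀) (b := d)
      (hc.mono (Icc_subset_Icc_left ht₀.1)) (fun x hx => ?_) le_rfl
      (fun x hx => hb x ⟨ht₀.1.trans hx.1, hx.2.le⟩) r ⟨h, hr.2⟩
    exact (hz x ⟨ht₀.1.trans hx.1, hx.2.le⟩).mono_of_mem_nhdsWithin
      (Filter.mem_of_superset (Icc_mem_nhdsGE hx.2)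
        (Icc_subset_Icc_left (ht₀.1.trans hx.1)))
  · rw [abs_of_nonpos (sub_nonpos.2 h), neg_sub]
    -- Times before t₀ are treated by reversing time, on [−t₀, −c].
    have hm : ∀ x ∈ Icc (-t₀) (-c), -x ∈ Icc c d := fun x hx =>
      ⟨by linarith [hx.2], by linarith [hx.1, ht₀.2]⟩
    have key := norm_le_gronwallBound_of_norm_deriv_right_le (f := fun u => z (-u))
      (f' := fun u => -z' (-u)) (a := -t₀) (b := -c) (δ := ‖z t₀‖) (K := K) (ε := ε)
      (hc.comp continuous_neg.continuousOn hm) (fun x hx => ?_) (by simp)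
      (fun x hx => by simpa using hb (-x) (hm x (Ico_subset_Icc_self hx))) (-r)
      ⟨by linarith, by linarith [hr.1]⟩
    · have e : -r - -t₀ = t₀ - r := by ring
      rw [e] at key
      simpa using key
    · have h1 := (hz (-x) (hm x (Ico_subset_Icc_self hx)))
      have h2 : HasDerivWithinAt (fun u : ℝ => -u) (-1) (Icc (-t₀) (-c)) x :=
        (hasDerivAt_neg x).hasDerivWithinAt
      have h3 := h1.scomp x h2 hm
      have h4 : HasDerivWithinAt (fun u => z (-u)) (-z' (-x)) (Icc (-t₀) (-c)) x := by
        simpa [Function.comp_def] using h3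
      refine h4.mono_of_mem_nhdsWithin (Filter.mem_of_superset (Icc_mem_nhdsGE hx.2)
        (Icc_subset_Icc_left hx.1))

/-- Linearity in ε turns an error rate of order o(‖y − x s‖) into an error of the same order in the
flow. -/
theorem gronwallBound_zero_eq_mul (K ε x : ℝ) :
    gronwallBound 0 K ε x = ε * gronwallBound 0 K 1 x := by
  unfold gronwallBound
  split_ifs <;> ring

/-- Two solutions of a Lipschitz differential equation that agree at one time agree. -/
theorem eqOn_of_hasDerivWithinAt {F : ℝ → E → E} {U : Set E} {c d t₀ : ℝ} {K : NNReal}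
    (ht₀ : t₀ ∈ Icc c d) (hF : ∀ r ∈ Icc c d, LipschitzOnWith K (F r) U) {x y : ℝ → E}
    (hx : ∀ r ∈ Icc c d, HasDerivWithinAt x (F r (x r)) (Icc c d) r)
    (hy : ∀ r ∈ Icc c d, HasDerivWithinAt y (F r (y r)) (Icc c d) r)
    (hxU : MapsTo x (Icc c d) U) (hyU : MapsTo y (Icc c d) U) (h₀ : x t₀ = y t₀) :
    EqOn x y (Icc c d) := by
  intro r hr
  have := norm_le_gronwallBound_abs (z := fun r => x r - y r) (ε := 0) (K := K) ht₀
    (fun r hr => (hx r hr).sub (hy r hr))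
    (fun r hr => by
      simpa using (hF r hr).norm_sub_le (hxU hr) (hyU hr)) r hr
  simp only [h₀, sub_self, norm_zero, gronwallBound_ε0_δ0] at this
  exact sub_eq_zero.1 (norm_le_zero_iff.1 this)

/-- The Picard-Lindelöf theorem, with the additional information that the solution stays in the
ball on which the vector field is controlled. -/
theorem exists_solution_mem_closedBall [CompleteSpace E] {F : ℝ → E → E} {c d : ℝ} {s : Icc c d}
    {x₀ x : E} {ρ r L K : NNReal} (hF : IsPicardLindelof F s x₀ ρ r L K)
    (hx : x ∈ Metric.closedBall x₀ r) :
    ∃ y : ℝ → E, y s = x ∧ ∀ t ∈ Icc c d, y t ∈ Metric.closedBall x₀ ρ ∧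
      HasDerivWithinAt y (F t (y t)) (Icc c d) t := by
  -- The fixed point of the Picard map is sought among curves that stay in the ball of radius ρ, so
  -- confinement comes with the solution.
  obtain ⟨α, hα⟩ := ODE.FunSpace.exists_isFixedPt_next hF hx
  refine ⟨α.compProj, by rw [ODE.FunSpace.compProj_val, ← hα, ODE.FunSpace.next_apply₀],
    fun t ht => ⟨α.compProj_mem_closedBall hF.mul_max_le, ?_⟩⟩
  apply ODE.hasDerivWithinAt_picard_Icc s.2 hF.continuousOn_uncurry
    α.continuous_compProj.continuousOn (fun _ ht' ↦ α.compProj_mem_closedBall hF.mul_max_le)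
    x ht |>.congr_of_mem _ ht
  intro t' ht'
  nth_rw 1 [← hα]
  rw [ODE.FunSpace.compProj_of_mem ht', ODE.FunSpace.next_apply]

/-- The partial derivative of a time dependent vector field of class `C¹` on `[c, d] × U`. -/
theorem hasFDerivAt_of_contDiffOn_uncurry {F : ℝ → E → E} {U : Set E} {c d : ℝ}
    (hU : IsOpen U) (hF : ContDiffOn ℝ ∞ (Function.uncurry F) (Icc c d ×ˢ U)) {r : ℝ} {x : E}
    (hr : r ∈ Icc c d) (hx : x ∈ U) :
    HasFDerivAt (F r) ((fderivWithin ℝ (Function.uncurry F) (Icc c d ×ˢ U) (r, x)).comp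
      (ContinuousLinearMap.inr ℝ ℝ E)) x := by
  have h1 := ((hF.differentiableOn (by simp)) (r, x) ⟨hr, hx⟩).hasFDerivWithinAt
  have h2 : HasFDerivWithinAt (fun y : E => (r, y)) (ContinuousLinearMap.inr ℝ ℝ E) U x :=
    (hasFDerivAt_prodMk_right r x).hasFDerivWithinAt
  have h3 := h1.comp x h2 (fun y hy => ⟨hr, hy⟩)
  exact h3.hasFDerivAt (hU.mem_nhds hx)

/-- The spatial derivative is the joint derivative restricted to {0} × E. The joint one is taken
within [c, d] × U, and c < d makes it unique there. -/
theorem continuousOn_fderiv_of_contDiffOn_uncurry {F : ℝ → E → E} {U : Set E} {c d : ℝ}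
    (hcd : c < d) (hU : IsOpen U)
    (hF : ContDiffOn ℝ ∞ (Function.uncurry F) (Icc c d ×ˢ U)) :
    ContinuousOn (fun q : ℝ × E => fderiv ℝ (F q.1) q.2) (Icc c d ×ˢ U) := by
  have h1 := hF.continuousOn_fderivWithin ((uniqueDiffOn_Icc hcd).prod hU.uniqueDiffOn)
    (by simp)
  have h2 : ContinuousOn (fun q : ℝ × E =>
      (fderivWithin ℝ (Function.uncurry F) (Icc c d ×ˢ U) q).comp
        (ContinuousLinearMap.inr ℝ ℝ E)) (Icc c d ×ˢ U) :=
    h1.clm_comp continuousOn_const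
  exact h2.congr fun q hq => (hasFDerivAt_of_contDiffOn_uncurry hU hF hq.1 hq.2).fderiv

/-- The local flow of a smooth time dependent vector field near a given solution `x̂`, and its
derivative along `x̂`, which solves the linearized equation. -/
theorem exists_local_flow [FiniteDimensional ℝ E] {F : ℝ → E → E} {U : Set E} {c d t₀ : ℝ}
    (hcd : c < d) (ht₀ : t₀ ∈ Icc c d) (hU : IsOpen U)
    (hF : ContDiffOn ℝ ∞ (Function.uncurry F) (Icc c d ×ˢ U)) {x : ℝ → E}
    (hx : ∀ r ∈ Icc c d, HasDerivWithinAt x (F r (x r)) (Icc c d) r)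
    (hxU : MapsTo x (Icc c d) U) :
    ∃ ε > 0, ∀ c' d', c ≤ c' → d' ≤ d → t₀ ∈ Icc c' d' → d' - c' ≤ ε → ∀ s ∈ Icc c' d',
      ∃ (φ : E → ℝ → E) (Y : ℝ → E →L[ℝ] E),
        (∀ᶠ y in 𝓝 (x s), φ y s = y ∧ ∀ r ∈ Icc c' d', φ y r ∈ U ∧
          HasDerivWithinAt (φ y) (F r (φ y r)) (Icc c' d') r) ∧
        EqOn (φ (x s)) x (Icc c' d') ∧
        Y s = ContinuousLinearMap.id ℝ E ∧
        (∀ r ∈ Icc c' d', HasDerivWithinAt Y ((fderiv ℝ (F r) (x r)).comp (Y r)) (Icc c' d') r) ∧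
        ∀ r ∈ Icc c' d', HasFDerivAt (fun y => φ y r) (Y r) (x s) := by
  have : CompleteSpace E := FiniteDimensional.complete ℝ E
  have : ProperSpace E := FiniteDimensional.proper_real E
  obtain ⟨ρ₀, hρ₀, hball⟩ := Metric.nhds_basis_closedBall.mem_iff.1 (hU.mem_nhds (hxU ht₀))
  lift ρ₀ to NNReal using hρ₀.le
  set ρ : NNReal := ρ₀
  have hρ : 0 < (ρ : ℝ) := hρ₀
  set Q : Set (ℝ × E) := Icc c d ×ˢ Metric.closedBall (x t₀) ρ with hQ
  have hQc : IsCompact Q := isCompact_Icc.prod (isCompact_closedBall _ _)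
  have hQU : Q ⊆ Icc c d ×ˢ U := prod_mono_right hball
  have hDc : ContinuousOn (fun q : ℝ × E => fderiv ℝ (F q.1) q.2) Q :=
    (continuousOn_fderiv_of_contDiffOn_uncurry hcd hU hF).mono hQU
  have hFc : ContinuousOn (Function.uncurry F) Q := hF.continuousOn.mono hQU
  have hFd : ∀ r ∈ Icc c d, ∀ y ∈ U, HasFDerivAt (F r) (fderiv ℝ (F r) y) y := fun r hr y hy =>
    (hasFDerivAt_of_contDiffOn_uncurry hU hF hr hy).differentiableAt.hasFDerivAt
  obtain ⟨K₀, hK₀⟩ := hQc.exists_bound_of_continuousOn hDc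
  obtain ⟨L₀, hL₀⟩ := hQc.exists_bound_of_continuousOn hFc
  set K : NNReal := K₀.toNNReal
  set L : NNReal := L₀.toNNReal
  have hK : ∀ r ∈ Icc c d, ∀ y ∈ Metric.closedBall (x t₀) ρ, ‖fderiv ℝ (F r) y‖ ≤ K :=
    fun r hr y hy => (hK₀ (r, y) ⟨hr, hy⟩).trans (Real.le_coe_toNNReal K₀)
  have hL : ∀ r ∈ Icc c d, ∀ y ∈ Metric.closedBall (x t₀) ρ, ‖F r y‖ ≤ L :=
    fun r hr y hy => (hL₀ (r, y) ⟨hr, hy⟩).trans (Real.le_coe_toNNReal L₀)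
  have hLip : ∀ r ∈ Icc c d, LipschitzOnWith K (F r) (Metric.closedBall (x t₀) ρ) := fun r hr =>
    Convex.lipschitzOnWith_of_nnnorm_hasFDerivWithin_le
      (fun y hy => (hFd r hr y (hball hy)).hasFDerivWithinAt) (fun y hy => hK r hr y hy)
      (convex_closedBall _ _)
  have hxc : ContinuousOn x (Icc c d) := fun r hr => (hx r hr).continuousWithinAt
  obtain ⟨ε₁, hε₁, hxε⟩ := Metric.continuousWithinAt_iff.1 (hxc t₀ ht₀) (ρ / 2) (by positivity)
  -- The three bounds keep x within ρ/2 of x t₀, give L ε ≤ ρ/2 for the Picard theorem with initial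
  -- points in the half ball, and give 2 K ε ≤ 1 for the linearized equation. The added 1 avoids
  -- division by zero.
  set ε : ℝ := min (ε₁ / 2) (min (ρ / (2 * (L + 1))) (1 / (2 * K + 1))) with hε
  have hεpos : 0 < ε := by positivity
  have hεL : L * ε ≤ ρ / 2 := by
    have : ε ≤ ρ / (2 * (L + 1)) := (min_le_right _ _).trans (min_le_left _ _)
    calc L * ε ≤ (L + 1) * (ρ / (2 * (L + 1))) := by gcongr; simp
      _ = ρ / 2 := by field_simp
  have hεK : 2 * K * ε ≤ 1 := by
    have : ε ≤ 1 / (2 * K + 1) := (min_le_right _ _).trans (min_le_right _ _)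
    calc 2 * K * ε ≤ (2 * K + 1) * (1 / (2 * K + 1)) := by gcongr; simp
      _ = 1 := by field_simp
  refine ⟨ε, hεpos, fun c' d' hc hd ht hlen s hs => ?_⟩
  have hsub : Icc c' d' ⊆ Icc c d := Icc_subset_Icc hc hd
  have hxnear : ∀ r ∈ Icc c' d', x r ∈ Metric.ball (x t₀) (ρ / 2) := fun r hr => by
    refine hxε (hsub hr) ?_
    have : ε ≤ ε₁ / 2 := min_le_left _ _
    rw [Real.dist_eq, abs_lt]
    constructor <;> linarith [hr.1, hr.2, ht.1, ht.2]
  have hmax : ∀ r ∈ Icc c' d', max (d' - r) (r - c') ≤ ε := fun r hr =>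
    max_le (by linarith [hr.1]) (by linarith [hr.2])
  have hPL : IsPicardLindelof F (⟨s, hs⟩ : Icc c' d') (x t₀) ρ (ρ / 2) L K :=
    { lipschitzOnWith := fun r hr => hLip r (hsub hr)
      continuousOn := fun y hy =>
          hFc.comp (f := fun r => (r, y)) (by fun_prop) (fun r hr => ⟨hsub hr, hy⟩)
      norm_le := fun r hr y hy => hL r (hsub hr) y hy
      mul_max_le := by
        have := hmax s hs
        calc (L : ℝ) * max (d' - s) (s - c') ≤ L * ε := by gcongr
          _ ≤ ρ - (ρ / 2 : NNReal) := by push_cast; linarith }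
  have hxball : ∀ r ∈ Icc c' d', x r ∈ Metric.closedBall (x t₀) ρ := fun r hr =>
    Metric.closedBall_subset_closedBall (by linarith) (Metric.ball_subset_closedBall (hxnear r hr))
  have hex : ∀ y ∈ Metric.closedBall (x t₀) (ρ / 2 : NNReal), ∃ z : ℝ → E, z s = y ∧
      ∀ t ∈ Icc c' d', z t ∈ Metric.closedBall (x t₀) ρ ∧
      HasDerivWithinAt z (F t (z t)) (Icc c' d') t := fun y hy =>
    exists_solution_mem_closedBall hPL hy
  choose! φ hφs hφ using hex
  -- The linearized equation is solved in the unit ball around the identity; there ‖Z‖ ≤ 2, so the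
  -- field is bounded by 2 K.
  have hPLY : IsPicardLindelof (fun r Z : _ => (fderiv ℝ (F r) (x r)).comp Z)
      (⟨s, hs⟩ : Icc c' d') (ContinuousLinearMap.id ℝ E) 1 0 (2 * K) K :=
    { lipschitzOnWith := fun r hr => LipschitzOnWith.of_dist_le_mul fun Z _ Z' _ => by
        rw [dist_eq_norm, dist_eq_norm, ← ContinuousLinearMap.comp_sub]
        refine (ContinuousLinearMap.opNorm_comp_le _ _).trans ?_
        gcongr
        exact hK r (hsub hr) _ (hxball r hr)
      continuousOn := fun Z _ => by
        have : ContinuousOn (fun r => fderiv ℝ (F r) (x r)) (Icc c' d') :=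
          hDc.comp (f := fun r => (r, x r)) (continuousOn_id.prodMk (hxc.mono hsub))
            fun r hr => ⟨hsub hr, hxball r hr⟩
        exact this.clm_comp continuousOn_const
      norm_le := fun r hr Z hZ => by
        refine (ContinuousLinearMap.opNorm_comp_le _ _).trans ?_
        have h1 := hK r (hsub hr) _ (hxball r hr)
        have h2 : ‖Z‖ ≤ 2 := by
          have h3 : ‖Z - ContinuousLinearMap.id ℝ E‖ ≤ 1 := by simpa [dist_eq_norm] using hZ
          have h4 : ‖Z‖ ≤ ‖Z - ContinuousLinearMap.id ℝ E‖ + ‖ContinuousLinearMap.id ℝ E‖ := by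
            simpa using norm_add_le (Z - ContinuousLinearMap.id ℝ E) (ContinuousLinearMap.id ℝ E)
          linarith [ContinuousLinearMap.norm_id_le (𝕜 := ℝ) (E := E)]
        push_cast
        rw [mul_comm (2 : ℝ)]
        gcongr
      mul_max_le := by
        have := hmax s hs
        push_cast
        calc (2 * K : ℝ) * max (d' - s) (s - c') ≤ 2 * K * ε := by gcongr
          _ ≤ 1 - 0 := by linarith }
  obtain ⟨Y, hYs, hY⟩ := hPLY.exists_eq_forall_mem_Icc_hasDerivWithinAt₀
  have hρ2 : ((ρ / 2 : NNReal) : ℝ) = ρ / 2 := by push_cast; rfl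
  have hxs : x s ∈ Metric.closedBall (x t₀) (ρ / 2 : NNReal) := by
    rw [hρ2]; exact Metric.ball_subset_closedBall (hxnear s hs)
  have heq : EqOn (φ (x s)) x (Icc c' d') :=
    eqOn_of_hasDerivWithinAt hs (fun r hr => hLip r (hsub hr)) (fun r hr => (hφ _ hxs r hr).2)
      (fun r hr => (hx r (hsub hr)).mono hsub) (fun r hr => (hφ _ hxs r hr).1) hxball (hφs _ hxs)
  have hnear : ∀ᶠ y in 𝓝 (x s), y ∈ Metric.closedBall (x t₀) (ρ / 2 : NNReal) := by
    rw [hρ2]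
    exact Filter.mem_of_superset (Metric.isOpen_ball.mem_nhds (hxnear s hs))
      Metric.ball_subset_closedBall
  refine ⟨φ, Y, ?_, heq, hYs, hY, fun r hr => ?_⟩
  · filter_upwards [hnear] with y hy
    exact ⟨hφs y hy, fun r hr => ⟨hball (hφ y hy r hr).1, (hφ y hy r hr).2⟩⟩
  set C₁ : ℝ := Real.exp (K * ε) with hC₁
  have hgrow : ∀ y ∈ Metric.closedBall (x t₀) (ρ / 2 : NNReal), ∀ r ∈ Icc c' d',
      ‖φ y r - x r‖ ≤ C₁ * ‖y - x s‖ := fun y hy r hr => by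
    have h := norm_le_gronwallBound_abs (z := fun r => φ y r - x r) (ε := 0) (K := K) hs
      (fun r hr => (hφ y hy r hr).2.sub ((hx r (hsub hr)).mono hsub))
      (fun r hr => by
        simpa using (hLip r (hsub hr)).norm_sub_le (hφ y hy r hr).1 (hxball r hr)) r hr
    rw [gronwallBound_ε0, hφs y hy, mul_comm] at h
    refine h.trans ?_
    have habs : |r - s| ≤ ε := by
      rw [abs_le]
      constructor <;> linarith [hr.1, hr.2, hs.1, hs.2]
    rw [hC₁]
    gcongr
  rw [hasFDerivAt_iff_isLittleO, Asymptotics.isLittleO_iff]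
  intro η hη
  set C₂ : ℝ := gronwallBound 0 K 1 |r - s| with hC₂
  have hC₂0 : 0 ≤ C₂ := by
    have := gronwallBound_mono (δ := 0) (ε := 1) (K := K) le_rfl zero_le_one K.2
      (abs_nonneg (r - s))
    rwa [gronwallBound_x0] at this
  have hC₁0 : 0 < C₁ := Real.exp_pos _
  -- C₁ bounds the spreading of solutions and C₂ the accumulation of a unit error rate, so an
  -- oscillation η' of the derivative costs at most η' C₁ C₂ ≤ η.
  set η' : ℝ := η / (C₁ * C₂ + 1) with hη'
  have hη'pos : 0 < η' := by positivity
  obtain ⟨δ, hδ, hunif⟩ := Metric.uniformContinuousOn_iff.1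
    (hQc.uniformContinuousOn_of_continuous hDc) η' hη'pos
  have hsmall : ∀ᶠ y in 𝓝 (x s), C₁ * ‖y - x s‖ < δ := by
    have : Filter.Tendsto (fun y => C₁ * ‖y - x s‖) (𝓝 (x s)) (𝓝 (C₁ * ‖x s - x s‖)) := by
      apply Continuous.tendsto; fun_prop
    refine this.eventually (gt_mem_nhds ?_)
    simpa using hδ
  filter_upwards [hnear, hsmall] with y hy hyδ
  -- The remainder starts at 0 and solves the linearized equation up to a Taylor error of F, which
  -- is at most η' ‖φ y − x‖ ≤ η' C₁ ‖y − x s‖.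
  have hz := norm_le_gronwallBound_abs (z := fun r => φ y r - x r - Y r (y - x s))
    (z' := fun r => F r (φ y r) - F r (x r) - fderiv ℝ (F r) (x r) (Y r (y - x s)))
    (K := K) (ε := η' * (C₁ * ‖y - x s‖)) hs
    (fun r hr => ((hφ y hy r hr).2.sub ((hx r (hsub hr)).mono hsub)).sub (by
      simpa using (hY r hr).clm_apply (hasDerivWithinAt_const r (Icc c' d') (y - x s))))
    (fun r hr => ?_) r hr
  · simp only [hφs y hy, hYs, ContinuousLinearMap.id_apply, sub_self, norm_zero] at hz
    rw [gronwallBound_zero_eq_mul] at hz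
    rw [heq hr]
    refine hz.trans ?_
    have : η' * (C₁ * C₂) ≤ η := by
      calc η' * (C₁ * C₂) ≤ η' * (C₁ * C₂ + 1) := by gcongr; linarith
        _ = η := by rw [hη']; field_simp
    calc η' * (C₁ * ‖y - x s‖) * C₂ = η' * (C₁ * C₂) * ‖y - x s‖ := by ring
      _ ≤ η * ‖y - x s‖ := by gcongr
  · have hg := hgrow y hy r hr
    have hmv := Convex.norm_image_sub_le_of_norm_hasFDerivWithin_le' (𝕜 := ℝ) (f := F r)
      (f' := fun ξ => fderiv ℝ (F r) ξ) (φ := fderiv ℝ (F r) (x r)) (C := η')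
      (s := Metric.closedBall (x t₀) ρ ∩ Metric.ball (x r) δ) (x := x r) (y := φ y r)
      (fun ξ hξ => (hFd r (hsub hr) ξ (hball hξ.1)).hasFDerivWithinAt)
      (fun ξ hξ => by
        rw [← dist_eq_norm]
        refine (hunif (r, ξ) ⟨hsub hr, hξ.1⟩ (r, x r) ⟨hsub hr, hxball r hr⟩ ?_).le
        rw [dist_prod_same_left]
        exact hξ.2)
      ((convex_closedBall _ _).inter (convex_ball _ _))
      ⟨hxball r hr, Metric.mem_ball_self hδ⟩
      ⟨(hφ y hy r hr).1, by rw [Metric.mem_ball, dist_eq_norm]; exact hg.trans_lt hyδ⟩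
    have e : F r (φ y r) - F r (x r) - fderiv ℝ (F r) (x r) (Y r (y - x s)) =
        (F r (φ y r) - F r (x r) - fderiv ℝ (F r) (x r) (φ y r - x r)) +
        fderiv ℝ (F r) (x r) (φ y r - x r - Y r (y - x s)) := by
      rw [map_sub _ (φ y r - x r)]; abel
    rw [e, add_comm]
    refine (norm_add_le _ _).trans (add_le_add ?_ ?_)
    · refine (ContinuousLinearMap.le_opNorm _ _).trans ?_
      gcongr
      exact hK r (hsub hr) _ (hxball r hr)
    · refine hmv.trans ?_
      gcongr

end ODEs

/-! ### Fields of projections in a vector space: the linear equation and horizontal lifts. -/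

section ProjectionFields

variable {E : Type*} [NormedAddCommGroup E] [NormedSpace ℝ E]
  {E' : Type*} [NormedAddCommGroup E'] [NormedSpace ℝ E']

theorem two_le_infty : (2 : WithTop ℕ∞) ≤ ∞ := WithTop.coe_le_coe.2 le_top

/-- This is the derivative of V² = V. It implies that V kills DV(u) y if V y = y, and fixes DV(y) u
if V u = 0. -/
theorem fderiv_projection_field {V : E → E →L[ℝ] E} {z : E} (hV : DifferentiableAt ℝ V z)
    (hi : ∀ᶠ z' in 𝓝 z, ∀ w, V z' (V z' w) = V z' w) (u y : E) :
    fderiv ℝ V z u (V z y) + V z (fderiv ℝ V z u y) = fderiv ℝ V z u y := by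
  have h1 : HasFDerivAt (fun z' => (V z').comp (V z')) _ z :=
    hV.hasFDerivAt.clm_comp hV.hasFDerivAt
  have h2 : (fun z' => (V z').comp (V z')) =ᶠ[𝓝 z] V := by
    filter_upwards [hi] with z' hz'
    ext w
    exact hz' w
  have h3 := (h1.congr_of_eventuallyEq h2.symm).unique hV.hasFDerivAt
  have h4 := congrArg (fun L => L u y) h3
  simpa [add_comm] using h4

/-- The linearized condition for parallel vector fields: the conditions of being tangent to the
vertical bundle and to the flipped horizontal bundle determine the second order part. -/
theorem tangent_vertical_and_flip_horizontal_iff {V : E → E →L[ℝ] E} {z : E}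
    (hV : DifferentiableAt ℝ V z) (hi : ∀ᶠ z' in 𝓝 z, ∀ w, V z' (V z' w) = V z' w) (y u v : E) :
    ((V z y = y ∧ fderiv ℝ V z u y + V z v = v) ∧ V z u = 0 ∧ fderiv ℝ V z y u + V z v = 0) ↔
      V z y = y ∧ V z u = 0 ∧ v = fderiv ℝ V z u y - fderiv ℝ V z y u := by
  have hD := fderiv_projection_field hV hi
  constructor
  · rintro ⟨⟨h1, h2⟩, h3, h4⟩
    refine ⟨h1, h3, ?_⟩
    -- The flipped condition gives V v = −DV(y) u; inserted in the tangency to K it determines v.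
    rw [eq_neg_of_add_eq_zero_right h4] at h2
    rw [← h2, sub_eq_add_neg]
  · rintro ⟨h1, h3, rfl⟩
    have e1 := hD u y
    have e2 := hD y u
    rw [h1, add_eq_left] at e1
    rw [h3, map_zero, zero_add] at e2
    refine ⟨⟨h1, ?_⟩, h3, ?_⟩ <;> rw [map_sub, e1, e2] <;> abel

/-- The derivative, in a vertical direction, of a vector field that is the horizontal lift of a
constant. -/
theorem fderiv_horizontal_lift_apply {V : E → E →L[ℝ] E} {z : E} {p : E → E'} {X : E → E} {g : E'}
    (hV : DifferentiableAt ℝ V z) (hi : ∀ᶠ z' in 𝓝 z, ∀ w, V z' (V z' w) = V z' w)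
    (hp : ContDiffAt ℝ 2 p z) (hker : ∀ᶠ z' in 𝓝 z, ∀ w, fderiv ℝ p z' w = 0 ↔ V z' w = w)
    (hX : DifferentiableAt ℝ X z) (hX0 : ∀ᶠ z' in 𝓝 z, V z' (X z') = 0)
    (hXg : ∀ᶠ z' in 𝓝 z, fderiv ℝ p z' (X z') = g) {η : E} (hη : V z η = η) :
    fderiv ℝ X z η = fderiv ℝ V z (X z) η - fderiv ℝ V z η (X z) := by
  have hD := fderiv_projection_field hV hi
  have hp1 : DifferentiableAt ℝ (fderiv ℝ p) z :=
    (hp.fderiv_right (m := 1) (by norm_num)).differentiableAt one_ne_zero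
  have hsymm : IsSymmSndFDerivAt ℝ p z :=
    ContDiffAt.isSymmSndFDerivAt (n := 2) hp (by simp)
  have a1 : fderiv ℝ V z η (X z) + V z (fderiv ℝ X z η) = 0 := by
    have h := hV.hasFDerivAt.clm_apply hX.hasFDerivAt
    have h0 : HasFDerivAt (fun z' => V z' (X z')) (0 : E →L[ℝ] E) z :=
      (hasFDerivAt_const (0 : E) z).congr_of_eventuallyEq hX0
    have := congrArg (fun L => L η) (h.unique h0)
    simpa [add_comm] using this
  have a2 : fderiv ℝ (fderiv ℝ p) z η (X z) + fderiv ℝ p z (fderiv ℝ X z η) = 0 := by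
    have h := hp1.hasFDerivAt.clm_apply hX.hasFDerivAt
    have h0 : HasFDerivAt (fun z' => fderiv ℝ p z' (X z')) (0 : E →L[ℝ] E') z :=
      (hasFDerivAt_const g z).congr_of_eventuallyEq hXg
    have := congrArg (fun L => L η) (h.unique h0)
    simpa [add_comm] using this
  have a3 : fderiv ℝ (fderiv ℝ p) z (X z) η + fderiv ℝ p z (fderiv ℝ V z (X z) η) = 0 := by
    have h := hp1.hasFDerivAt.clm_apply (hV.hasFDerivAt.clm_apply (hasFDerivAt_const η z))
    have h0 : HasFDerivAt (fun z' => fderiv ℝ p z' (V z' η)) (0 : E →L[ℝ] E') z := by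
      refine (hasFDerivAt_const (0 : E') z).congr_of_eventuallyEq ?_
      filter_upwards [hi, hker] with z' h1 h2
      exact (h2 _).2 (h1 η)
    have := congrArg (fun L => L (X z)) (h.unique h0)
    simpa [hη, add_comm] using this
  -- By the symmetry of D²p the last two identities show that Dp kills this difference, so it is
  -- vertical. Applying V to it leaves only V (DX η) = −DV(η) X, because V kills DV(X) η.
  have a4 : V z (fderiv ℝ X z η - fderiv ℝ V z (X z) η) =
      fderiv ℝ X z η - fderiv ℝ V z (X z) η := by
    rw [← hker.self_of_nhds, map_sub, eq_neg_of_add_eq_zero_right a2,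
      eq_neg_of_add_eq_zero_right a3, hsymm.eq (X z) η, sub_self]
  have a5 := hD (X z) η
  rw [hη, add_eq_left] at a5
  rw [map_sub, a5, sub_zero, eq_neg_of_add_eq_zero_right a1] at a4
  rw [sub_eq_add_neg, a4, add_sub_cancel]

/-- Smooth horizontal lifts of the vectors of the base near a point where the projection is a
submersion. -/
theorem exists_horizontal_lift_field [FiniteDimensional ℝ E] [FiniteDimensional ℝ E']
    {V : E → E →L[ℝ] E} {p : E → E'} {U : Set E}
    (hU : IsOpen U) (hV : ContDiffOn ℝ ∞ V U) (hi : ∀ z ∈ U, ∀ w, V z (V z w) = V z w)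
    (hp : ContDiffOn ℝ ∞ p U) (hker : ∀ z ∈ U, ∀ w, fderiv ℝ p z w = 0 ↔ V z w = w)
    {z₀ : E} (hz₀ : z₀ ∈ U) (hsurj : Function.Surjective (fderiv ℝ p z₀)) :
    ∃ U' ⊆ U, IsOpen U' ∧ z₀ ∈ U' ∧ ∃ G : E → E' →L[ℝ] E, ContDiffOn ℝ ∞ G U' ∧
      ∀ z ∈ U', ∀ g v, (V z v = 0 ∧ fderiv ℝ p z v = g) ↔ v = G z g := by
  have : CompleteSpace E' := FiniteDimensional.complete ℝ E'
  -- A right inverse R of Dp at z₀ is kept fixed: Dp(z) R stays invertible near z₀, and the lift of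
  -- g is the horizontal part of R (Dp(z) R)⁻¹ g.
  obtain ⟨R₀, hR₀⟩ := (fderiv ℝ p z₀).toLinearMap.exists_rightInverse_of_surjective
    (LinearMap.range_eq_top.2 hsurj)
  set R : E' →L[ℝ] E := R₀.toContinuousLinearMap
  have hR : (fderiv ℝ p z₀).comp R = 1 := by
    ext w
    exact LinearMap.congr_fun hR₀ w
  have hDp : ContDiffOn ℝ ∞ (fderiv ℝ p) U := hp.fderiv_of_isOpen hU (by simp)
  have hA : ContDiffOn ℝ ∞ (fun z => (fderiv ℝ p z).comp R) U := hDp.clm_comp contDiffOn_const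
  set U' := U ∩ (fun z => (fderiv ℝ p z).comp R) ⁻¹' {A | IsUnit A} with hU'
  have hU'o : IsOpen U' := hA.continuousOn.isOpen_inter_preimage hU Units.isOpen
  have hinv : ContDiffOn ℝ ∞ (fun z => Ring.inverse ((fderiv ℝ p z).comp R)) U' := by
    intro z hz
    obtain ⟨A, hA'⟩ := hz.2
    have h1 : ContDiffAt ℝ ∞ Ring.inverse ((fderiv ℝ p z).comp R) := by
      have := contDiffAt_ringInverse ℝ (n := ∞) A
      rwa [hA'] at this
    exact h1.comp_contDiffWithinAt z ((hA z hz.1).mono inter_subset_left)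
  refine ⟨U', inter_subset_left, hU'o, ⟨hz₀, by simp [hR]⟩,
    fun z => (ContinuousLinearMap.id ℝ E - V z).comp
      (R.comp (Ring.inverse ((fderiv ℝ p z).comp R))),
    (contDiffOn_const.sub (hV.mono inter_subset_left)).clm_comp
      (contDiffOn_const.clm_comp hinv), ?_⟩
  intro z hz g v
  have hun : ((fderiv ℝ p z).comp R).comp (Ring.inverse ((fderiv ℝ p z).comp R)) = 1 :=
    Ring.mul_inverse_cancel _ hz.2
  set w := R (Ring.inverse ((fderiv ℝ p z).comp R) g) with hw
  have hpw : fderiv ℝ p z w = g := congrArg (fun L => L g) hun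
  have hpV : ∀ v, fderiv ℝ p z (V z v) = 0 := fun v => (hker z hz.1 _).2 (hi z hz.1 v)
  have key : V z (w - V z w) = 0 ∧ fderiv ℝ p z (w - V z w) = g := by
    rw [map_sub, map_sub, hi z hz.1, sub_self, hpV, hpw, sub_zero]
    exact ⟨rfl, rfl⟩
  change _ ↔ v = w - V z w
  constructor
  · rintro ⟨h1, h2⟩
    -- Two horizontal lifts of g differ by a vector that is both vertical and horizontal, hence
    -- zero.
    have h3 : V z (v - (w - V z w)) = v - (w - V z w) := by
      rw [← hker z hz.1, map_sub, h2, key.2, sub_self]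
    rw [map_sub, h1, key.1, sub_self] at h3
    exact sub_eq_zero.1 h3.symm
  · rintro rfl
    exact key

/-- In coordinates: parallel transport near a horizontal path exists and is differentiable along
the path, and its derivative solves the equation of the canonical linear connection. -/
theorem exists_local_transport [FiniteDimensional ℝ E] [FiniteDimensional ℝ E']
    {V : E → E →L[ℝ] E} {p : E → E'} {U : Set E}
    (hU : IsOpen U) (hV : ContDiffOn ℝ ∞ V U) (hi : ∀ z ∈ U, ∀ w, V z (V z w) = V z w)
    (hp : ContDiffOn ℝ ∞ p U) (hker : ∀ z ∈ U, ∀ w, fderiv ℝ p z w = 0 ↔ V z w = w)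
    {c d t₀ : ℝ} (hcd : c < d) (ht₀ : t₀ ∈ Icc c d) {x : ℝ → E} (hx : ContDiffOn ℝ ∞ x (Icc c d))
    (hxV : ∀ r ∈ Icc c d, V (x r) (derivWithin x (Icc c d) r) = 0) (hxU : MapsTo x (Icc c d) U)
    (hsurj : Function.Surjective (fderiv ℝ p (x t₀))) :
    ∃ ε > 0, ∀ c' d', c ≤ c' → d' ≤ d → t₀ ∈ Icc c' d' → d' - c' ≤ ε → ∀ s ∈ Icc c' d',
      ∃ (φ : E → ℝ → E) (Y : ℝ → E →L[ℝ] E),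
        (∀ᶠ y in 𝓝 (x s), φ y s = y ∧ ∀ r ∈ Icc c' d', φ y r ∈ U ∧
          (∃ v, HasDerivWithinAt (φ y) v (Icc c' d') r ∧ V (φ y r) v = 0) ∧
          (p y = p (x s) → p (φ y r) = p (x r))) ∧
        EqOn (φ (x s)) x (Icc c' d') ∧
        Y s = ContinuousLinearMap.id ℝ E ∧
        (∀ r ∈ Icc c' d', HasFDerivAt (fun y => φ y r) (Y r) (x s)) ∧
        ∀ η, V (x s) η = η → ∀ r ∈ Icc c' d', V (x r) (Y r η) = Y r η ∧
          HasDerivWithinAt (fun r => Y r η)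
            (fderiv ℝ V (x r) (derivWithin x (Icc c d) r) (Y r η) -
              fderiv ℝ V (x r) (Y r η) (derivWithin x (Icc c d) r)) (Icc c' d') r := by
  obtain ⟨U', hU'U, hU'o, hxt, G, hG, hGiff⟩ :=
    exists_horizontal_lift_field hU hV hi hp hker (hxU ht₀) hsurj
  have hder : ∀ r ∈ Icc c d, HasDerivWithinAt x (derivWithin x (Icc c d) r) (Icc c d) r :=
    fun r hr => ((hx.differentiableOn (by simp)) r hr).hasDerivWithinAt
  have hx' : ContDiffOn ℝ ∞ (derivWithin x (Icc c d)) (Icc c d) :=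
    hx.derivWithin (uniqueDiffOn_Icc hcd) (by simp)
  have hDp : ContDiffOn ℝ ∞ (fderiv ℝ p) U := hp.fderiv_of_isOpen hU (by simp)
  set g : ℝ → E' := fun r => fderiv ℝ p (x r) (derivWithin x (Icc c d) r) with hg
  have hgc : ContDiffOn ℝ ∞ g (Icc c d) := (hDp.comp hx hxU).clm_apply hx'
  -- Lifts are available only on U', so time is restricted to a window around t₀ in which x stays in
  -- U'.
  obtain ⟨δ, hδ, hδU⟩ := Metric.mem_nhdsWithin_iff.1
    ((hx.continuousOn t₀ ht₀).preimage_mem_nhdsWithin (hU'o.mem_nhds hxt))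
  set c₁ := max c (t₀ - δ / 2)
  set d₁ := min d (t₀ + δ / 2)
  have hc₁ : c ≤ c₁ := le_max_left _ _
  have hd₁ : d₁ ≤ d := min_le_left _ _
  have hcd₁ : c₁ < d₁ := by
    simp only [c₁, d₁, max_lt_iff, lt_min_iff]
    refine ⟨⟨hcd, ?_⟩, ?_, ?_⟩ <;> linarith [ht₀.1, ht₀.2]
  have ht₁ : t₀ ∈ Icc c₁ d₁ :=
    ⟨max_le ht₀.1 (by linarith), le_min ht₀.2 (by linarith)⟩
  have hs₁ : Icc c₁ d₁ ⊆ Icc c d := Icc_subset_Icc hc₁ hd₁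
  have hxU' : MapsTo x (Icc c₁ d₁) U' := fun r hr => hδU ⟨by
    rw [Metric.mem_ball, Real.dist_eq, abs_lt]
    have h1 := (le_max_right _ _).trans hr.1
    have h2 := hr.2.trans (min_le_right _ _)
    constructor <;> linarith, hs₁ hr⟩
  set F : ℝ → E → E := fun r z => G z (g r) with hFdef
  have hF : ContDiffOn ℝ ∞ (Function.uncurry F) (Icc c₁ d₁ ×ˢ U') :=
    (hG.comp contDiff_snd.contDiffOn fun q hq => hq.2).clm_apply
      (hgc.comp contDiff_fst.contDiffOn fun q hq => hs₁ hq.1)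
  have hxF : ∀ r ∈ Icc c₁ d₁, derivWithin x (Icc c d) r = F r (x r) := fun r hr =>
    (hGiff (x r) (hxU' hr) _ _).1 ⟨hxV r (hs₁ hr), rfl⟩
  obtain ⟨ε, hε, hflow⟩ := exists_local_flow hcd₁ ht₁ hU'o hF (x := x)
    (fun r hr => by rw [← hxF r hr]; exact (hder r (hs₁ hr)).mono hs₁) hxU'
  refine ⟨min ε (δ / 2), by positivity, fun c' d' hc hd ht hlen s hs => ?_⟩
  have hc' : c₁ ≤ c' := max_le hc (by linarith [ht.2, min_le_right ε (δ / 2)])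
  have hd' : d' ≤ d₁ := le_min hd (by linarith [ht.1, min_le_right ε (δ / 2)])
  have hs' : Icc c' d' ⊆ Icc c₁ d₁ := Icc_subset_Icc hc' hd'
  obtain ⟨φ, Y, hφ, hφx, hYs, hY, hφY⟩ :=
    hflow c' d' hc' hd' ht (hlen.trans (min_le_left _ _)) s hs
  have hpd : ∀ z ∈ U, HasFDerivAt p (fderiv ℝ p z) z := fun z hz =>
    ((hp.differentiableOn (by simp)).differentiableAt (hU.mem_nhds hz)).hasFDerivAt
  refine ⟨φ, Y, ?_, hφx, hYs, hφY, ?_⟩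
  · filter_upwards [hφ] with y hy
    refine ⟨hy.1, fun r hr => ⟨hU'U (hy.2 r hr).1, ⟨_, (hy.2 r hr).2,
      ((hGiff _ (hy.2 r hr).1 _ _).2 rfl).1⟩, fun hpy => ?_⟩⟩
    -- Both projected curves have derivative g, so their difference keeps its initial value.
    have hconst : ∀ r ∈ Icc c' d', HasDerivWithinAt (fun r => p (φ y r) - p (x r)) 0
        (Icc c' d') r := fun r hr => by
      have h1 := (hpd _ (hU'U (hy.2 r hr).1)).comp_hasDerivWithinAt r (hy.2 r hr).2
      rw [((hGiff _ (hy.2 r hr).1 _ _).2 rfl).2] at h1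
      have h2 := (hpd _ (hxU (hs₁ (hs' hr)))).comp_hasDerivWithinAt r
        ((hder r (hs₁ (hs' hr))).mono (hs'.trans hs₁))
      have h3 := h1.sub h2
      rw [sub_self] at h3
      exact h3
    have h := norm_le_gronwallBound_abs (K := 0) (ε := 0) hs hconst (by simp) r hr
    simp only [hy.1, hpy, sub_self, norm_zero, gronwallBound_ε0_δ0] at h
    exact sub_eq_zero.1 (norm_le_zero_iff.1 h)
  · intro η hη
    have hYη : ∀ r ∈ Icc c' d', HasDerivWithinAt (fun r => Y r η)
        (fderiv ℝ (F r) (x r) (Y r η)) (Icc c' d') r := fun r hr => by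
      simpa using (hY r hr).clm_apply (hasDerivWithinAt_const r (Icc c' d') η)
    have hF1 : ∀ r ∈ Icc c' d', DifferentiableAt ℝ (F r) (x r) := fun r hr =>
      (hasFDerivAt_of_contDiffOn_uncurry hU'o hF (hs' hr) (hxU' (hs' hr))).differentiableAt
    -- The derivative of Dp(x)(Y η) in time is D²p(x')(Y η) + Dp(DF(Y η)). By symmetry of D²p it is
    -- the derivative of the locally constant map z ↦ Dp(z)(F z) in the direction Y η, hence zero:
    -- the linearized flow preserves verticality.
    have hvert : ∀ r ∈ Icc c' d', fderiv ℝ p (x r) (Y r η) = 0 := by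
      have hconst : ∀ r ∈ Icc c' d', HasDerivWithinAt (fun r => fderiv ℝ p (x r) (Y r η)) 0
          (Icc c' d') r := fun r hr => by
        have hxr := hxU' (hs' hr)
        have hD2 : DifferentiableAt ℝ (fderiv ℝ p) (x r) :=
          (hDp.differentiableOn (by simp)).differentiableAt (hU.mem_nhds (hU'U hxr))
        have h1 := hD2.hasFDerivAt.comp_hasDerivWithinAt r
          ((hder r (hs₁ (hs' hr))).mono (hs'.trans hs₁))
        have h2 := h1.clm_apply (hYη r hr)
        have h3 := hD2.hasFDerivAt.clm_apply (hF1 r hr).hasFDerivAt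
        have h4 : HasFDerivAt (fun z => fderiv ℝ p z (F r z)) (0 : E →L[ℝ] E') (x r) := by
          refine (hasFDerivAt_const (g r) (x r)).congr_of_eventuallyEq ?_
          filter_upwards [hU'o.mem_nhds hxr] with z hz
          exact ((hGiff z hz _ _).2 rfl).2
        have h5 := congrArg (fun L => L (Y r η)) (h3.unique h4)
        have hsymm : IsSymmSndFDerivAt ℝ p (x r) :=
          ContDiffAt.isSymmSndFDerivAt (n := ∞) (hp.contDiffAt (hU.mem_nhds (hU'U hxr)))
            (by simpa using two_le_infty)
        convert h2 using 1
        change fderiv ℝ p (x r) (fderiv ℝ (F r) (x r) (Y r η)) +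
          fderiv ℝ (fderiv ℝ p) (x r) (Y r η) (F r (x r)) = 0 at h5
        simp only [Function.comp_apply]
        rw [hsymm.eq, hxF r (hs' hr), add_comm]
        exact h5.symm
      intro r hr
      have h := norm_le_gronwallBound_abs (K := 0) (ε := 0) hs hconst (by simp) r hr
      have h0 : fderiv ℝ p (x s) (Y s η) = 0 := by
        rw [hYs]; exact (hker _ (hxU (hs₁ (hs' hs))) _).2 hη
      simp only [h0, norm_zero, gronwallBound_ε0_δ0] at h
      exact norm_le_zero_iff.1 h
    intro r hr
    have hxr := hxU' (hs' hr)
    have hxr' := hU.mem_nhds (hU'U hxr)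
    have hv := (hker _ (hU'U hxr) _).1 (hvert r hr)
    refine ⟨hv, ?_⟩
    have := hYη r hr
    rwa [fderiv_horizontal_lift_apply (V := V) (p := p) (g := g r)
      ((hV.differentiableOn (by simp)).differentiableAt hxr')
      (Filter.mem_of_superset hxr' hi) ((hp.contDiffAt hxr').of_le two_le_infty)
      (Filter.mem_of_superset hxr' hker) (hF1 r hr)
      (Filter.mem_of_superset (hU'o.mem_nhds hxr) fun z hz => ((hGiff z hz _ _).2 rfl).1)
      (Filter.mem_of_superset (hU'o.mem_nhds hxr) fun z hz => ((hGiff z hz _ _).2 rfl).2) hv,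
      ← hxF r (hs' hr)] at this

end ProjectionFields

/-! ### Curves, velocities and tangent vectors to subsets in charts. -/

section Coordinates

variable {E H M : Type*} [NormedAddCommGroup E] [NormedSpace ℝ E] [TopologicalSpace H]
  {I : ModelWithCorners ℝ E H} [TopologicalSpace M] [ChartedSpace H M]

theorem contMDiffWithinAt_of_extChartAt_comp {n : WithTop ℕ∞} [IsManifold I n M] {c : ℝ → M}
    {J : Set ℝ} {t : ℝ} {x₀ : M}
    (hc : ContinuousWithinAt c J t) (ht : c t ∈ (extChartAt I x₀).source)
    (hd : ContDiffWithinAt ℝ n (fun r => extChartAt I x₀ (c r)) J t) :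
    ContMDiffWithinAt 𝓘(ℝ, ℝ) I n c J t := by
  have ht' : c t ∈ (chartAt H x₀).source := by rwa [extChartAt_source] at ht
  rw [contMDiffWithinAt_iff_target_of_mem_source ht']
  exact ⟨hc, hd.contMDiffWithinAt⟩

theorem contDiffWithinAt_extChartAt_comp {n : WithTop ℕ∞} [IsManifold I n M] {c : ℝ → M}
    {J : Set ℝ} {t : ℝ} {x₀ : M} (hc : ContMDiffWithinAt 𝓘(ℝ, ℝ) I n c J t)
    (ht : c t ∈ (extChartAt I x₀).source) :
    ContDiffWithinAt ℝ n (fun r => extChartAt I x₀ (c r)) J t := by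
  have ht' : c t ∈ (chartAt H x₀).source := by rwa [extChartAt_source] at ht
  rw [contMDiffWithinAt_iff_target_of_mem_source ht'] at hc
  exact hc.2.contDiffWithinAt

end Coordinates

section Coordinates

variable {E H M : Type*} [NormedAddCommGroup E] [NormedSpace ℝ E] [TopologicalSpace H]
  (I : ModelWithCorners ℝ E H) [TopologicalSpace M] [ChartedSpace H M] [IsManifold I 1 M]

/-- The coordinates of a tangent vector in the chart at `x₀`. -/
def coordVec (x₀ : M) (X : TangentBundle I M) : E :=
  tangentCoordChange I X.proj x₀ X.proj X.snd

variable {I}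

theorem hasMFDerivAt_extChartAt_tangentCoordChange {x₀ y : M} (hy : y ∈ (extChartAt I x₀).source) :
    HasMFDerivAt I 𝓘(ℝ, E) (extChartAt I x₀) y
      (tangentCoordChange I y x₀ y : E →L[ℝ] E) := by
  have hy' : y ∈ (chartAt H x₀).source := by rwa [extChartAt_source] at hy
  have h := hasMFDerivAt_extChartAt (I := I) hy'
  rwa [mfderiv_chartAt_eq_tangentCoordChange hy'] at h

theorem hasDerivWithinAt_extChartAt_comp {c : ℝ → M} {J : Set ℝ} {t : ℝ} {x₀ : M}
    (hc : MDifferentiableWithinAt 𝓘(ℝ, ℝ) I c J t) (ht : c t ∈ (extChartAt I x₀).source) :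
    HasDerivWithinAt (fun r => extChartAt I x₀ (c r)) (coordVec I x₀ (velocity I c J t)) J t := by
  let L : ℝ →L[ℝ] E := mfderivWithin 𝓘(ℝ, ℝ) I c J t
  have h : HasFDerivWithinAt (fun r => extChartAt I x₀ (c r))
      ((tangentCoordChange I (c t) x₀ (c t)).comp L) J t :=
    ((hasMFDerivAt_extChartAt_tangentCoordChange ht).comp_hasMFDerivWithinAt t
      hc.hasMFDerivWithinAt).hasFDerivWithinAt
  exact h.hasDerivWithinAt

theorem mdifferentiableWithinAt_of_extChartAt_comp {c : ℝ → M} {J : Set ℝ} {t : ℝ} {x₀ : M}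
    (hc : ContinuousWithinAt c J t) (ht : c t ∈ (extChartAt I x₀).source)
    (hd : DifferentiableWithinAt ℝ (fun r => extChartAt I x₀ (c r)) J t) :
    MDifferentiableWithinAt 𝓘(ℝ, ℝ) I c J t := by
  have ht' : c t ∈ (chartAt H x₀).source := by rwa [extChartAt_source] at ht
  rw [mdifferentiableWithinAt_iff_target_of_mem_source ht']
  exact ⟨hc, hd.mdifferentiableWithinAt⟩

theorem tangentCoordChange_cancel {x₀ y : M} (hy : y ∈ (extChartAt I x₀).source) (v : E) :
    tangentCoordChange I x₀ y y (tangentCoordChange I y x₀ y v) = v := by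
  rw [tangentCoordChange_comp ⟨⟨mem_extChartAt_source y, hy⟩, mem_extChartAt_source y⟩,
    tangentCoordChange_self (mem_extChartAt_source y)]

theorem tangentCoordChange_cancel' {x₀ y : M} (hy : y ∈ (extChartAt I x₀).source) (v : E) :
    tangentCoordChange I y x₀ y (tangentCoordChange I x₀ y y v) = v := by
  rw [tangentCoordChange_comp ⟨⟨hy, mem_extChartAt_source y⟩, hy⟩,
    tangentCoordChange_self hy]

theorem eq_of_coordVec_eq {x₀ : M} {X Y : TangentBundle I M} (h : X.proj = Y.proj)
    (hX : X.proj ∈ (extChartAt I x₀).source) (hc : coordVec I x₀ X = coordVec I x₀ Y) : X = Y := by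
  obtain ⟨x, v⟩ := X
  obtain ⟨y, w⟩ := Y
  obtain rfl : x = y := h
  have h : v = w := (tangentCoordChange_cancel hX v).symm.trans
    ((congrArg (tangentCoordChange I x₀ x x) hc).trans (tangentCoordChange_cancel hX w))
  rw [h]

theorem coordVec_self (X : TangentBundle I M) : coordVec I X.proj X = X.snd :=
  tangentCoordChange_self (mem_extChartAt_source _)

variable [I.Boundaryless]

/-- The tangent vectors to a subset, in coordinates. -/
theorem mem_tangentSet_iff [IsManifold I ∞ M] {S : Set M} {W : TangentBundle I M} {x₀ : M}
    (hW : W.proj ∈ (extChartAt I x₀).source) :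
    W ∈ tangentSet I S ↔ ∃ c : ℝ → E, ContDiffAt ℝ ∞ c 0 ∧
      (∀ᶠ r in 𝓝 (0 : ℝ), (extChartAt I x₀).symm (c r) ∈ S) ∧
      c 0 = extChartAt I x₀ W.proj ∧ HasDerivAt c (coordVec I x₀ W) 0 := by
  constructor
  · rintro ⟨c, hc, hS, rfl⟩
    have h0 : c 0 ∈ (extChartAt I x₀).source := hW
    refine ⟨fun r => extChartAt I x₀ (c r), ?_, ?_, rfl, ?_⟩
    · exact contDiffWithinAt_univ.1 (contDiffWithinAt_extChartAt_comp hc.contMDiffWithinAt h0)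
    · have := hc.continuousAt.preimage_mem_nhds ((isOpen_extChartAt_source x₀).mem_nhds h0)
      filter_upwards [hS, this] with r hr hr'
      rwa [(extChartAt I x₀).left_inv hr']
    · exact hasDerivWithinAt_univ.1 (hasDerivWithinAt_extChartAt_comp
        (hc.mdifferentiableAt (by simp)).mdifferentiableWithinAt h0)
  · rintro ⟨c, hc, hS, h0, hd⟩
    have ht : c 0 ∈ (extChartAt I x₀).target := by
      rw [h0]; exact (extChartAt I x₀).map_source hW
    have h0' : (extChartAt I x₀).symm (c 0) = W.proj := by
      rw [h0, (extChartAt I x₀).left_inv hW]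
    have hsm : ContMDiffAt 𝓘(ℝ, ℝ) I ∞ (fun r => (extChartAt I x₀).symm (c r)) 0 :=
      ((contMDiffOn_extChartAt_symm x₀).contMDiffAt
        ((isOpen_extChartAt_target x₀).mem_nhds ht)).comp 0 hc.contMDiffAt
    refine ⟨fun r => (extChartAt I x₀).symm (c r), hsm, hS, ?_⟩
    refine eq_of_coordVec_eq (x₀ := x₀) h0' (by rwa [← h0'] at hW) ?_
    have h1 := hasDerivWithinAt_univ.1 (hasDerivWithinAt_extChartAt_comp (x₀ := x₀)
      (hsm.mdifferentiableAt (by simp)).mdifferentiableWithinAt (by rwa [← h0'] at hW))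
    refine h1.unique (hd.congr_of_eventuallyEq ?_)
    filter_upwards [hc.continuousAt.preimage_mem_nhds
      ((isOpen_extChartAt_target x₀).mem_nhds ht)] with r hr
    exact (extChartAt I x₀).right_inv hr

end Coordinates

/-! ### Charts of the tangent bundle and the canonical involution. -/

section TangentCoordinates

variable {E H M : Type*} [NormedAddCommGroup E] [NormedSpace ℝ E] [TopologicalSpace H]
  {I : ModelWithCorners ℝ E H} [TopologicalSpace M] [ChartedSpace H M] [IsManifold I ∞ M]

theorem extChartAt_tangent_apply (X₀ X : TangentBundle I M) :
    extChartAt I.tangent X₀ X = (extChartAt I X₀.proj X.proj, coordVec I X₀.proj X) := rfl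

theorem extChartAt_tangent_source (X₀ : TangentBundle I M) :
    (extChartAt I.tangent X₀).source = {X | X.proj ∈ (extChartAt I X₀.proj).source} := by
  ext X
  rw [extChartAt_source, TangentBundle.mem_chart_source_iff, mem_ofPred, extChartAt_source]

theorem extChartAt_tangent_target (X₀ : TangentBundle I M) :
    (extChartAt I.tangent X₀).target = (extChartAt I X₀.proj).target ×ˢ univ := by
  rw [FiberBundle.extChartAt_target, TangentBundle.trivializationAt_baseSet, inter_eq_left.2]
  intro z hz
  rw [mem_preimage, ← extChartAt_source I]
  exact (extChartAt I X₀.proj).map_target hz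

theorem extChartAt_tangent_symm_proj (X₀ : TangentBundle I M) (q : E × E) :
    ((extChartAt I.tangent X₀).symm q).proj = (extChartAt I X₀.proj).symm q.1 := rfl

theorem coordVec_extChartAt_tangent_symm (X₀ : TangentBundle I M) {q : E × E}
    (hq : q.1 ∈ (extChartAt I X₀.proj).target) :
    coordVec I X₀.proj ((extChartAt I.tangent X₀).symm q) = q.2 := by
  have := (extChartAt I.tangent X₀).right_inv (x := q)
    (by rw [extChartAt_tangent_target]; exact ⟨hq, trivial⟩)
  exact congrArg Prod.snd this

end TangentCoordinates

section Flip

variable {E H M : Type*} [NormedAddCommGroup E] [NormedSpace ℝ E] [TopologicalSpace H]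
  {I : ModelWithCorners ℝ E H} [TopologicalSpace M] [ChartedSpace H M] [IsManifold I ∞ M]

theorem flip_flip (W : TangentBundle I.tangent (TangentBundle I M)) : flip I (flip I W) = W := rfl

theorem mem_image_flip_iff {S : Set (TangentBundle I.tangent (TangentBundle I M))}
    {W : TangentBundle I.tangent (TangentBundle I M)} : W ∈ flip I '' S ↔ flip I W ∈ S :=
  ⟨fun ⟨W', h, e⟩ => by rw [← e, flip_flip]; exact h, fun h => ⟨_, h, flip_flip W⟩⟩

variable [I.Boundaryless]

theorem contDiffAt_extCoordChange {x x₀ y : M} (hx : y ∈ (extChartAt I x).source)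
    (hx₀ : y ∈ (extChartAt I x₀).source) :
    ContDiffAt ℝ ∞ (extChartAt I x₀ ∘ (extChartAt I x).symm) (extChartAt I x y) := by
  have h : extChartAt I x y ∈ ((extChartAt I x).symm ≫ extChartAt I x₀).source := by
    rw [PartialEquiv.trans_source'', PartialEquiv.symm_symm, PartialEquiv.symm_target]
    exact mem_image_of_mem _ ⟨hx, hx₀⟩
  have := contDiffWithinAt_ext_coord_change (n := ∞) x₀ x h
  rwa [I.range_eq_univ, contDiffWithinAt_univ] at this

theorem tangentCoordChange_eq_fderiv (x x₀ y : M) : tangentCoordChange I x x₀ y =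
    fderiv ℝ (extChartAt I x₀ ∘ (extChartAt I x).symm) (extChartAt I x y) := by
  rw [tangentCoordChange_def, I.range_eq_univ, fderivWithin_univ]

/-- The change of coordinates of the tangent bundle is the tangent map of the change of
coordinates of the manifold. -/
theorem extCoordChange_tangent_eventuallyEq (X₀ X : TangentBundle I M)
    (hX : X.proj ∈ (extChartAt I X₀.proj).source) :
    (extChartAt I.tangent X₀ ∘ (extChartAt I.tangent X).symm) =ᶠ[𝓝 (extChartAt I.tangent X X)]
      fun q : E × E => ((extChartAt I X₀.proj ∘ (extChartAt I X.proj).symm) q.1,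
        fderiv ℝ (extChartAt I X₀.proj ∘ (extChartAt I X.proj).symm) q.1 q.2) := by
  have h1 : extChartAt I X.proj X.proj ∈ (extChartAt I X.proj).target ∩
      (extChartAt I X.proj).symm ⁻¹' (extChartAt I X₀.proj).source :=
    ⟨mem_extChartAt_target _, by
      rwa [mem_preimage, (extChartAt I X.proj).left_inv (mem_extChartAt_source _)]⟩
  have h2 := ((continuousOn_extChartAt_symm (I := I) X.proj).isOpen_inter_preimage
    (isOpen_extChartAt_target X.proj) (isOpen_extChartAt_source (I := I) X₀.proj)).mem_nhds h1
  have h3 : ∀ᶠ q : E × E in 𝓝 (extChartAt I.tangent X X), q.1 ∈ (extChartAt I X.proj).target ∩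
      (extChartAt I X.proj).symm ⁻¹' (extChartAt I X₀.proj).source :=
    continuousAt_fst.preimage_mem_nhds h2
  filter_upwards [h3] with q hq
  have e := coordVec_extChartAt_tangent_symm X hq.1
  refine Prod.ext rfl ?_
  change coordVec I X₀.proj ((extChartAt I.tangent X).symm q) = _
  have hs : (extChartAt I X.proj).symm q.1 ∈ (extChartAt I X.proj).source :=
    (extChartAt I X.proj).map_target hq.1
  have e2 := tangentCoordChange_eq_fderiv (I := I) X.proj X₀.proj ((extChartAt I X.proj).symm q.1)
  rw [(extChartAt I X.proj).right_inv hq.1] at e2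
  rw [← e2, ← e]
  exact (tangentCoordChange_comp ⟨⟨mem_extChartAt_source _, hs⟩, hq.2⟩).symm

/-- The chain rule to second order: the change of charts of TM is (q, w) ↦ (κ q, Dκ(q) w),
differentiated at (z, y) in the direction (u, v). The only second-order term D²κ(u, y) is symmetric,
which is why the involution does not depend on the chart. -/
theorem coordVec_tangent (X₀ : TangentBundle I M)
    (W : TangentBundle I.tangent (TangentBundle I M)) (y u v : E)
    (hy : W.proj.snd = y) (huv : W.snd = ((u, v) : E × E))
    (hW : W.proj.proj ∈ (extChartAt I X₀.proj).source) :
    coordVec I.tangent X₀ W =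
      (fderiv ℝ (extChartAt I X₀.proj ∘ (extChartAt I W.proj.proj).symm)
        (extChartAt I W.proj.proj W.proj.proj) u,
      fderiv ℝ (fderiv ℝ (extChartAt I X₀.proj ∘ (extChartAt I W.proj.proj).symm))
        (extChartAt I W.proj.proj W.proj.proj) u y +
      fderiv ℝ (extChartAt I X₀.proj ∘ (extChartAt I W.proj.proj).symm)
        (extChartAt I W.proj.proj W.proj.proj) v) := by
  set κ := extChartAt I X₀.proj ∘ (extChartAt I W.proj.proj).symm with hκ
  set z := extChartAt I W.proj.proj W.proj.proj with hz
  have hκs : ContDiffAt ℝ ∞ κ z :=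
    contDiffAt_extCoordChange (mem_extChartAt_source W.proj.proj) hW
  have e1 : extChartAt I.tangent W.proj W.proj = (z, y) := by
    rw [extChartAt_tangent_apply, coordVec_self, hy]
  have h1 : HasFDerivAt κ (fderiv ℝ κ z) z := (hκs.differentiableAt (by simp)).hasFDerivAt
  have h2 : HasFDerivAt (fderiv ℝ κ) (fderiv ℝ (fderiv ℝ κ) z) z :=
    ((hκs.fderiv_right (m := 1) (one_add_one_eq_two.trans_le two_le_infty)).differentiableAt
      one_ne_zero).hasFDerivAt
  have h3 : HasFDerivAt (fun q : E × E => (κ q.1, fderiv ℝ κ q.1 q.2)) _ (z, y) :=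
    (HasFDerivAt.comp (g := κ) (f := Prod.fst) (z, y) h1 hasFDerivAt_fst).prodMk
      ((HasFDerivAt.comp (g := fderiv ℝ κ) (f := Prod.fst) (z, y) h2 hasFDerivAt_fst).clm_apply
        hasFDerivAt_snd)
  have h4 := (extCoordChange_tangent_eventuallyEq X₀ W.proj hW).fderiv_eq (𝕜 := ℝ)
  rw [e1, h3.fderiv] at h4
  have h5 := tangentCoordChange_eq_fderiv (I := I.tangent) W.proj X₀ W.proj
  rw [e1, h4] at h5
  have h6 : coordVec I.tangent X₀ W = tangentCoordChange I.tangent W.proj X₀ W.proj (u, v) :=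
    congrArg (fun w : E × E => tangentCoordChange I.tangent W.proj X₀ W.proj w) huv
  rw [h6, h5]
  simp [add_comm]

/-- The canonical involution has the same expression in all charts. -/
theorem coordVec_flip (X₀ : TangentBundle I M) (W : TangentBundle I.tangent (TangentBundle I M))
    (hW : W.proj.proj ∈ (extChartAt I X₀.proj).source) :
    coordVec I X₀.proj (flip I W).proj = (coordVec I.tangent X₀ W).1 ∧
    coordVec I.tangent X₀ (flip I W) =
      (coordVec I X₀.proj W.proj, (coordVec I.tangent X₀ W).2) := by
  set y : E := W.proj.snd with hy
  set uv : E × E := W.snd with huv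
  have e1 := coordVec_tangent X₀ W y uv.1 uv.2 rfl rfl hW
  have e2 := coordVec_tangent X₀ (flip I W) uv.1 y uv.2 rfl rfl hW
  set κ := extChartAt I X₀.proj ∘ (extChartAt I W.proj.proj).symm with hκ
  set z := extChartAt I W.proj.proj W.proj.proj with hz
  have hκs : ContDiffAt ℝ ∞ κ z :=
    contDiffAt_extCoordChange (mem_extChartAt_source W.proj.proj) hW
  have hsymm : IsSymmSndFDerivAt ℝ κ z :=
    ContDiffAt.isSymmSndFDerivAt hκs (by simpa using two_le_infty)
  have h5 := tangentCoordChange_eq_fderiv (I := I) W.proj.proj X₀.proj W.proj.proj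
  have e3 : coordVec I X₀.proj (flip I W).proj = fderiv ℝ κ z uv.1 :=
    congrArg (fun L : E →L[ℝ] E => L uv.1) h5
  have e4 : coordVec I X₀.proj W.proj = fderiv ℝ κ z y := congrArg (fun L : E →L[ℝ] E => L y) h5
  refine ⟨by rw [e3, e1], ?_⟩
  rw [e2, e1, e4]
  change (fderiv ℝ κ z y, fderiv ℝ (fderiv ℝ κ) z y uv.1 + fderiv ℝ κ z uv.2) = _
  rw [hsymm.eq]

end Flip

/-! ### A uniform Lipschitz constant near a point. -/

section Lipschitz

variable {E : Type*} [NormedAddCommGroup E] [NormedSpace ℝ E]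

theorem exists_lipschitzOnWith_closedBall [FiniteDimensional ℝ E] {F : ℝ → E → E} {U : Set E}
    {c d : ℝ} (hcd : c < d) (hU : IsOpen U)
    (hF : ContDiffOn ℝ ∞ (Function.uncurry F) (Icc c d ×ˢ U)) {x : E} (hx : x ∈ U) :
    ∃ ρ > 0, Metric.closedBall x ρ ⊆ U ∧ ∃ K : NNReal,
      ∀ r ∈ Icc c d, LipschitzOnWith K (F r) (Metric.closedBall x ρ) := by
  have : ProperSpace E := FiniteDimensional.proper_real E
  obtain ⟨ρ, hρ, hball⟩ := Metric.nhds_basis_closedBall.mem_iff.1 (hU.mem_nhds hx)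
  have hQc : IsCompact (Icc c d ×ˢ Metric.closedBall x ρ) :=
    isCompact_Icc.prod (isCompact_closedBall _ _)
  obtain ⟨K, hK⟩ := hQc.exists_bound_of_continuousOn
    ((continuousOn_fderiv_of_contDiffOn_uncurry hcd hU hF).mono (prod_mono_right hball))
  exact ⟨ρ, hρ, hball, K.toNNReal, fun r hr =>
    Convex.lipschitzOnWith_of_nnnorm_hasFDerivWithin_le
      (fun y hy => (hasFDerivAt_of_contDiffOn_uncurry hU hF hr
        (hball hy)).differentiableAt.hasFDerivAt.hasFDerivWithinAt)
      (fun y hy => (hK (r, y) ⟨hr, hy⟩).trans (Real.le_coe_toNNReal K)) (convex_closedBall _ _)⟩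

end Lipschitz

/-! ### Differential equations on a manifold, as sets of admissible velocities. -/

section VelocityFields

variable {E H N : Type*} [NormedAddCommGroup E] [NormedSpace ℝ E] [TopologicalSpace H]
  {I : ModelWithCorners ℝ E H} [TopologicalSpace N] [ChartedSpace H N]

/-- A curve whose velocity belongs at any time of `J` to the given time dependent set of
tangent vectors. -/
def IsSol (D : ℝ → Set (TangentBundle I N)) (J : Set ℝ) (δ : ℝ → N) : Prop :=
  ∀ r ∈ J, MDifferentiableWithinAt 𝓘(ℝ, ℝ) I δ J r ∧ velocity I δ J r ∈ D r

theorem IsSol.continuousOn {D : ℝ → Set (TangentBundle I N)} {J : Set ℝ} {δ : ℝ → N}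
    (h : IsSol D J δ) : ContinuousOn δ J :=
  fun r hr => (h r hr).1.continuousWithinAt

/-- There is a solution between the times `s` and `t` from `n` to `n'`. -/
def FlowRel (D : ℝ → Set (TangentBundle I N)) (s t : ℝ) (n n' : N) : Prop :=
  (s = t ∧ n = n') ∨ (s ≠ t ∧ ∃ δ, IsSol D (uIcc s t) δ ∧ δ s = n ∧ δ t = n')

theorem FlowRel.symm {D : ℝ → Set (TangentBundle I N)} {s t : ℝ} {n n' : N}
    (h : FlowRel D s t n n') : FlowRel D t s n' n := by
  rcases h with ⟨h1, h2⟩ | ⟨h1, δ, h2, h3, h4⟩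
  · exact Or.inl ⟨h1.symm, h2.symm⟩
  · exact Or.inr ⟨h1.symm, δ, by rwa [uIcc_comm], h4, h3⟩

variable [IsManifold I ∞ N] {D : ℝ → Set (TangentBundle I N)}

theorem velocity_eq_of_hasDerivWithinAt {c : ℝ → N} {J : Set ℝ} {t : ℝ} {x₀ : N}
    {W : TangentBundle I N} (hJ : UniqueDiffWithinAt ℝ J t)
    (hc : ContinuousWithinAt c J t) (ht : c t ∈ (extChartAt I x₀).source) (hW : W.proj = c t)
    (hd : HasDerivWithinAt (fun r => extChartAt I x₀ (c r)) (coordVec I x₀ W) J t) :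
    velocity I c J t = W := by
  have hm := mdifferentiableWithinAt_of_extChartAt_comp hc ht hd.differentiableWithinAt
  exact eq_of_coordVec_eq hW.symm ht
    (hJ.eq_deriv _ (hasDerivWithinAt_extChartAt_comp hm ht) hd)

theorem IsSol.hasDerivWithinAt {J : Set ℝ} {δ : ℝ → N} (h : IsSol D J δ) {r : ℝ} (hr : r ∈ J)
    {x₀ : N} (hx₀ : δ r ∈ (extChartAt I x₀).source) :
    HasDerivWithinAt (fun r => extChartAt I x₀ (δ r)) (coordVec I x₀ (velocity I δ J r)) J r :=
  hasDerivWithinAt_extChartAt_comp (h r hr).1 hx₀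

theorem isSol_of_hasDerivWithinAt {J : Set ℝ} {δ : ℝ → N} (hJ : UniqueDiffOn ℝ J)
    (h : ∀ r ∈ J, ContinuousWithinAt δ J r ∧ ∃ W ∈ D r, W.proj = δ r ∧
      ∃ x₀ : N, δ r ∈ (extChartAt I x₀).source ∧
        HasDerivWithinAt (fun r => extChartAt I x₀ (δ r)) (coordVec I x₀ W) J r) :
    IsSol D J δ := by
  intro r hr
  obtain ⟨hc, W, hW, hWp, x₀, hx₀, hd⟩ := h r hr
  refine ⟨mdifferentiableWithinAt_of_extChartAt_comp hc hx₀ hd.differentiableWithinAt, ?_⟩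
  rwa [velocity_eq_of_hasDerivWithinAt (hJ r hr) hc hx₀ hWp hd]

theorem IsSol.mono {J J' : Set ℝ} {δ : ℝ → N} (h : IsSol D J δ) (hJ' : UniqueDiffOn ℝ J')
    (hs : J' ⊆ J) : IsSol D J' δ :=
  isSol_of_hasDerivWithinAt hJ' fun r hr => ⟨(h.continuousOn r (hs hr)).mono hs, _,
    (h r (hs hr)).2, rfl, δ r, mem_extChartAt_source _,
    (h.hasDerivWithinAt (hs hr) (mem_extChartAt_source _)).mono hs⟩

variable (D) in
/-- In the chart at `x₀` and near the time `r₀ ∈ [a, b]`, the velocities in `D` are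
given by the smooth vector field `F` on `U`. -/
structure IsODEAt (a b r₀ : ℝ) (x₀ : N) (U : Set E) (ε : ℝ) (F : ℝ → E → E) : Prop where
  pos : 0 < ε
  isOpen : IsOpen U
  mem : extChartAt I x₀ x₀ ∈ U
  contDiffOn : ContDiffOn ℝ ∞ (Function.uncurry F) ((Icc a b ∩ Icc (r₀ - ε) (r₀ + ε)) ×ˢ U)
  eq : ∀ r ∈ Icc a b ∩ Icc (r₀ - ε) (r₀ + ε), ∀ W ∈ D r, W.proj ∈ (extChartAt I x₀).source →
    extChartAt I x₀ W.proj ∈ U → coordVec I x₀ W = F r (extChartAt I x₀ W.proj)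

variable (D) in
/-- The set `D` of velocities is locally contained in a smooth vector field. -/
def IsODE (a b : ℝ) : Prop :=
  ∀ r₀ ∈ Icc a b, ∀ W ∈ D r₀, ∃ U ε F, IsODEAt D a b r₀ W.proj U ε F

/-- Continuity keeps a solution in the chart and in U' for a short time, where it solves the
coordinate equation. Every smaller window is allowed, so that several solutions can share one. -/
theorem IsODEAt.exists_hasDerivWithinAt {a b s t r₀ ε : ℝ} {x₀ : N} {U U' : Set E}
    {F : ℝ → E → E}
    (h : IsODEAt D a b r₀ x₀ U ε F) (hU' : U' ∈ 𝓝 (extChartAt I x₀ x₀)) (hUU : U' ⊆ U)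
    (hs : Icc s t ⊆ Icc a b) (hr₀ : r₀ ∈ Icc s t)
    {δ : ℝ → N} (hδ : IsSol D (Icc s t) δ) (h₀ : δ r₀ = x₀) :
    ∃ ε' > 0, ∀ ε'' ≤ ε', ∀ r ∈ Icc s t ∩ Icc (r₀ - ε'') (r₀ + ε''),
      δ r ∈ (extChartAt I x₀).source ∧ extChartAt I x₀ (δ r) ∈ U' ∧
      HasDerivWithinAt (fun r => extChartAt I x₀ (δ r)) (F r (extChartAt I x₀ (δ r)))
        (Icc s t ∩ Icc (r₀ - ε'') (r₀ + ε'')) r := by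
  have h1 : (extChartAt I x₀).source ∩ extChartAt I x₀ ⁻¹' U' ∈ 𝓝 (δ r₀) := by
    rw [h₀]
    exact Filter.inter_mem (extChartAt_source_mem_nhds x₀)
      ((continuousAt_extChartAt x₀).preimage_mem_nhds hU')
  obtain ⟨e, he, hsub⟩ := Metric.mem_nhdsWithin_iff.1
    ((hδ.continuousOn r₀ hr₀).preimage_mem_nhdsWithin h1)
  refine ⟨min ε (e / 2), lt_min h.pos (by positivity), fun ε'' hε r hr => ?_⟩
  have hε1 := hε.trans (min_le_left _ _)
  have hε2 := hε.trans (min_le_right _ _)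
  have h2 := hsub ⟨by
    rw [Metric.mem_ball, Real.dist_eq, abs_lt]
    constructor <;> linarith [hr.2.1, hr.2.2], hr.1⟩
  refine ⟨h2.1, h2.2, ?_⟩
  have h3 := h.eq r ⟨hs hr.1, by linarith [hr.2.1], by linarith [hr.2.2]⟩ _ (hδ r hr.1).2
    h2.1 (hUU h2.2)
  have h4 := hδ.hasDerivWithinAt hr.1 h2.1
  rw [h3] at h4
  exact h4.mono inter_subset_left

theorem max_lt_min_of_mem {s t r e : ℝ} (hst : s < t) (hr : r ∈ Icc s t) (he : 0 < e) :
    max s (r - e) < min t (r + e) := by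
  simp only [max_lt_iff, lt_min_iff]
  refine ⟨⟨hst, ?_⟩, ?_, ?_⟩ <;> linarith [hr.1, hr.2]

theorem Icc_inter_Icc_mem_nhdsWithin {s t r e : ℝ} (he : 0 < e) :
    Icc s t ∩ Icc (r - e) (r + e) ∈ 𝓝[Icc s t] r :=
  Filter.inter_mem self_mem_nhdsWithin
    (mem_nhdsWithin_of_mem_nhds (Icc_mem_nhds (by linarith) (by linarith)))

variable {a b s t : ℝ}

/-- Solutions of a smooth differential equation on a manifold are smooth. -/
theorem IsODE.contMDiffOn [FiniteDimensional ℝ E] (h : IsODE D a b) (hs : Icc s t ⊆ Icc a b)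
    {δ : ℝ → N} (hδ : IsSol D (Icc s t) δ) : ContMDiffOn 𝓘(ℝ, ℝ) I ∞ δ (Icc s t) := by
  have : CompleteSpace E := FiniteDimensional.complete ℝ E
  intro r hr
  obtain ⟨U, ε, F, hF⟩ := h r (hs hr) _ (hδ r hr).2
  obtain ⟨e, he, hd⟩ :=
    hF.exists_hasDerivWithinAt (hF.isOpen.mem_nhds hF.mem) subset_rfl hs hr hδ rfl
  set e' := min e ε
  have he' : 0 < e' := lt_min he hF.pos
  have hd' := hd e' (min_le_left _ _)
  have hsm : ContDiffOn ℝ ∞ (Function.uncurry F) ((Icc s t ∩ Icc (r - e') (r + e')) ×ˢ U) :=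
    hF.contDiffOn.mono (prod_mono_left (inter_subset_inter hs (Icc_subset_Icc
      (by linarith [min_le_right e ε]) (by linarith [min_le_right e ε]))))
  rw [Icc_inter_Icc] at hd' hsm
  -- The order lives in `ℕ∞`, so `⊤` means C^∞ and not analytic.
  have h1 := ODE.contDiffOn_enat_Icc_of_hasDerivWithinAt (n := ⊤) hsm (fun r hr => (hd' r hr).2.2)
    (fun r hr => (hd' r hr).2.1)
  have h2 : r ∈ Icc s t ∩ Icc (r - e') (r + e') := ⟨hr, by linarith, by linarith⟩
  rw [← Icc_inter_Icc] at h1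
  exact contMDiffWithinAt_of_extChartAt_comp (hδ.continuousOn r hr) (mem_extChartAt_source _)
    ((h1 r h2).mono_of_mem_nhdsWithin (Icc_inter_Icc_mem_nhdsWithin he'))

/-- Two solutions that agree at one time agree. -/
theorem IsODE.eqOn [FiniteDimensional ℝ E] [T2Space N] (h : IsODE D a b) (hst : s < t)
    (hs : Icc s t ⊆ Icc a b) {δ δ' : ℝ → N} (hδ : IsSol D (Icc s t) δ) (hδ' : IsSol D (Icc s t) δ')
    {t₁ : ℝ} (ht₁ : t₁ ∈ Icc s t) (h₁ : δ t₁ = δ' t₁) : EqOn δ δ' (Icc s t) := by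
  -- The coincidence set is closed because N is Hausdorff and open by local uniqueness in a chart;
  -- the interval is connected.
  have hclopen : IsClopen {r : Icc s t | δ r = δ' r} := by
    refine ⟨isClosed_eq hδ.continuousOn.domRestrict hδ'.continuousOn.domRestrict, ?_⟩
    rw [isOpen_iff_mem_nhds]
    rintro ⟨r, hr⟩ (hrr : δ r = δ' r)
    obtain ⟨U, ε, F, hF⟩ := h r (hs hr) _ (hδ r hr).2
    have hsm : ContDiffOn ℝ ∞ (Function.uncurry F) ((Icc s t ∩ Icc (r - ε) (r + ε)) ×ˢ U) :=
      hF.contDiffOn.mono (prod_mono_left (inter_subset_inter_left _ hs))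
    rw [Icc_inter_Icc] at hsm
    obtain ⟨ρ, hρ, hρU, K, hK⟩ := exists_lipschitzOnWith_closedBall
      (max_lt_min_of_mem hst hr hF.pos) hF.isOpen hsm hF.mem
    obtain ⟨e, he, hd⟩ :=
      hF.exists_hasDerivWithinAt (Metric.closedBall_mem_nhds _ hρ) hρU hs hr hδ rfl
    obtain ⟨e', he', hd'⟩ := hF.exists_hasDerivWithinAt (Metric.closedBall_mem_nhds _ hρ) hρU
      hs hr hδ' hrr.symm
    set m := min ε (min e e')
    have hm : 0 < m := lt_min hF.pos (lt_min he he')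
    have hd := hd m ((min_le_right _ _).trans (min_le_left _ _))
    have hd' := hd' m ((min_le_right _ _).trans (min_le_right _ _))
    rw [← Icc_inter_Icc] at hK
    have hsub : Icc s t ∩ Icc (r - m) (r + m) ⊆ Icc s t ∩ Icc (r - ε) (r + ε) :=
      inter_subset_inter_right _ (Icc_subset_Icc (by linarith [min_le_left ε (min e e')])
        (by linarith [min_le_left ε (min e e')]))
    have hK' := fun r hr => hK r (hsub hr)
    have hrm : r ∈ Icc s t ∩ Icc (r - m) (r + m) := ⟨hr, by linarith, by linarith⟩
    have hnhds := Icc_inter_Icc_mem_nhdsWithin (s := s) (t := t) (r := r) hm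
    rw [Icc_inter_Icc] at hd hd' hK' hrm
    have heq := eqOn_of_hasDerivWithinAt hrm hK' (fun r hr => (hd r hr).2.2)
      (fun r hr => (hd' r hr).2.2) (fun r hr => (hd r hr).2.1) (fun r hr => (hd' r hr).2.1)
      (by simp only [hrr])
    rw [mem_nhds_subtype_iff_nhdsWithin]
    refine Filter.mem_of_superset hnhds ?_
    intro q hq
    refine ⟨⟨q, hq.1⟩, ?_, rfl⟩
    rw [Icc_inter_Icc] at hq
    exact (extChartAt I _).injOn (hd q hq).1 (hd' q hq).1 (heq hq)
  have : PreconnectedSpace (Icc s t) := Subtype.preconnectedSpace isPreconnected_Icc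
  have huniv := hclopen.eq_univ ⟨⟨t₁, ht₁⟩, h₁⟩
  intro r hr
  have : (⟨r, hr⟩ : Icc s t) ∈ {r : Icc s t | δ r = δ' r} := by rw [huniv]; trivial
  exact this

/-- Solutions on two adjacent intervals can be glued. -/
theorem IsODE.glue (h : IsODE D a b) {u : ℝ} (hst : s < t) (htu : t < u)
    (hs : Icc s u ⊆ Icc a b) {δ δ' : ℝ → N} (hδ : IsSol D (Icc s t) δ)
    (hδ' : IsSol D (Icc t u) δ') (ht : δ t = δ' t) :
    ∃ δ'', IsSol D (Icc s u) δ'' ∧ EqOn δ'' δ (Icc s t) ∧ EqOn δ'' δ' (Icc t u) := by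
  classical
  set δ'' : ℝ → N := fun r => if r ≤ t then δ r else δ' r with hδ''
  have e1 : EqOn δ'' δ (Icc s t) := fun r hr => if_pos hr.2
  have e2 : EqOn δ'' δ' (Icc t u) := fun r hr => by
    rcases hr.1.eq_or_lt with rfl | h'
    · exact (if_pos le_rfl).trans ht
    · exact if_neg (not_le.2 h')
  refine ⟨δ'', isSol_of_hasDerivWithinAt (uniqueDiffOn_Icc (hst.trans htu)) fun r hr => ?_, e1, e2⟩
  have hleft : ∀ r (hr : r ∈ Icc s t) {x₀ : N}, δ r ∈ (extChartAt I x₀).source →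
      HasDerivWithinAt (fun r => extChartAt I x₀ (δ'' r))
        (coordVec I x₀ (velocity I δ (Icc s t) r)) (Icc s t) r := fun r hr x₀ hx =>
    (hδ.hasDerivWithinAt hr hx).congr (fun q hq => by rw [e1 hq]) (by rw [e1 hr])
  have hright : ∀ r (hr : r ∈ Icc t u) {x₀ : N}, δ' r ∈ (extChartAt I x₀).source →
      HasDerivWithinAt (fun r => extChartAt I x₀ (δ'' r))
        (coordVec I x₀ (velocity I δ' (Icc t u) r)) (Icc t u) r := fun r hr x₀ hx =>
    (hδ'.hasDerivWithinAt hr hx).congr (fun q hq => by rw [e2 hq]) (by rw [e2 hr])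
  have c1 : ContinuousOn δ'' (Icc s t) := hδ.continuousOn.congr e1
  have c2 : ContinuousOn δ'' (Icc t u) := hδ'.continuousOn.congr e2
  rcases lt_trichotomy r t with hrt | rfl | hrt
  · have hr' : r ∈ Icc s t := ⟨hr.1, hrt.le⟩
    have hn : Icc s t ∈ 𝓝[Icc s u] r :=
      Filter.mem_of_superset (Filter.inter_mem self_mem_nhdsWithin
        (mem_nhdsWithin_of_mem_nhds (Iic_mem_nhds hrt))) fun q hq => ⟨hq.1.1, hq.2⟩
    exact ⟨(c1 r hr').mono_of_mem_nhdsWithin hn, _, (hδ r hr').2, (e1 hr').symm, δ r,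
      by rw [e1 hr']; exact mem_extChartAt_source _,
      (hleft r hr' (mem_extChartAt_source _)).mono_of_mem_nhdsWithin hn⟩
  · have hr1 : r ∈ Icc s r := ⟨hst.le, le_rfl⟩
    have hr2 : r ∈ Icc r u := ⟨le_rfl, htu.le⟩
    obtain ⟨U, ε, F, hF⟩ := h r (hs hr) _ (hδ r hr1).2
    have hrI : r ∈ Icc a b ∩ Icc (r - ε) (r + ε) :=
      ⟨hs hr, by linarith [hF.pos], by linarith [hF.pos]⟩
    have hsrc : δ' r ∈ (extChartAt I (δ r)).source := by
      rw [← ht]; exact mem_extChartAt_source _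
    -- At the junction both one-sided velocities lie in D at the same time and point, where the
    -- vector field leaves only one possibility. So the glued curve is differentiable there.
    have f1 := hF.eq r hrI _ (hδ r hr1).2 (mem_extChartAt_source _) hF.mem
    have f2 := hF.eq r hrI _ (hδ' r hr2).2 hsrc (by
      change extChartAt I (δ r) (δ' r) ∈ U
      rw [← ht]; exact hF.mem)
    have f3 : coordVec I (δ r) (velocity I δ' (Icc r u) r) =
        coordVec I (δ r) (velocity I δ (Icc s r) r) := by
      refine f2.trans (Eq.trans ?_ f1.symm)
      change F r (extChartAt I (δ r) (δ' r)) = F r (extChartAt I (δ r) (δ r))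
      rw [ht]
    have hun : Icc s r ∪ Icc r u = Icc s u := Icc_union_Icc_eq_Icc hst.le htu.le
    refine ⟨by rw [← hun]; exact (c1 r hr1).union (c2 r hr2), _, (hδ r hr1).2, (e1 hr1).symm, δ r,
      by rw [e1 hr1]; exact mem_extChartAt_source _, ?_⟩
    rw [← hun]
    have g2 := hright r hr2 hsrc
    rw [f3] at g2
    exact (hleft r hr1 (mem_extChartAt_source _)).union g2
  · have hr' : r ∈ Icc t u := ⟨hrt.le, hr.2⟩
    have hn : Icc t u ∈ 𝓝[Icc s u] r :=
      Filter.mem_of_superset (Filter.inter_mem self_mem_nhdsWithin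
        (mem_nhdsWithin_of_mem_nhds (Ici_mem_nhds hrt))) fun q hq => ⟨hq.2, hq.1.2⟩
    exact ⟨(c2 r hr').mono_of_mem_nhdsWithin hn, _, (hδ' r hr').2, (e2 hr').symm, δ' r,
      by rw [e2 hr']; exact mem_extChartAt_source _,
      (hright r hr' (mem_extChartAt_source _)).mono_of_mem_nhdsWithin hn⟩

theorem FlowRel.unique [FiniteDimensional ℝ E] [T2Space N] (h : IsODE D a b) (hs : s ∈ Icc a b)
    (ht : t ∈ Icc a b) {n n' n'' : N} (h1 : FlowRel D s t n n') (h2 : FlowRel D s t n n'') :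
    n' = n'' := by
  rcases h1 with ⟨e, rfl⟩ | ⟨e, δ, hδ, h3, h4⟩
  · rcases h2 with ⟨-, rfl⟩ | ⟨e', -⟩
    exacts [rfl, absurd e e']
  · rcases h2 with ⟨e', -⟩ | ⟨-, δ', hδ', h3', h4'⟩
    · exact absurd e' e
    · have := h.eqOn (min_lt_max.2 e) (uIcc_subset_Icc hs ht) hδ hδ' left_mem_uIcc
        (h3.trans h3'.symm)
        right_mem_uIcc
      rw [← h4, ← h4', this]

/-- With t strictly between s and u this is gluing, after a reversal of time if u < s; the
degenerate cases are immediate. -/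
theorem FlowRel.trans (h : IsODE D a b) {u : ℝ} (hs : s ∈ Icc a b) (hu : u ∈ Icc a b)
    (ht : t ∈ uIcc s u) {n n' n'' : N} (h1 : FlowRel D s t n n') (h2 : FlowRel D t u n' n'') :
    FlowRel D s u n n'' := by
  have key : ∀ {s u : ℝ} {n n' n'' : N}, s ∈ Icc a b → u ∈ Icc a b → s < t → t < u →
      FlowRel D s t n n' → FlowRel D t u n' n'' → FlowRel D s u n n'' := by
    intro s u n n' n'' hs hu hst htu h1 h2
    rcases h1 with ⟨e, -⟩ | ⟨-, δ, hδ, h3, h4⟩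
    · exact absurd e hst.ne
    rcases h2 with ⟨e, -⟩ | ⟨-, δ', hδ', h3', h4'⟩
    · exact absurd e htu.ne
    rw [uIcc_of_le hst.le] at hδ
    rw [uIcc_of_le htu.le] at hδ'
    obtain ⟨δ'', g1, g2, g3⟩ := h.glue hst htu (Icc_subset_Icc hs.1 hu.2) hδ hδ' (h4.trans h3'.symm)
    refine Or.inr ⟨(hst.trans htu).ne, δ'', by rwa [uIcc_of_le (hst.trans htu).le], ?_, ?_⟩
    · rw [g2 (left_mem_Icc.2 hst.le), h3]
    · rw [g3 (right_mem_Icc.2 htu.le), h4']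
  by_cases hst : s = t
  · subst hst
    rcases h1 with ⟨-, rfl⟩ | ⟨e, -⟩
    exacts [h2, absurd rfl e]
  by_cases htu : t = u
  · subst htu
    rcases h2 with ⟨-, rfl⟩ | ⟨e, -⟩
    exacts [h1, absurd rfl e]
  rcases mem_uIcc.1 ht with ⟨h3, h4⟩ | ⟨h3, h4⟩
  · exact key hs hu (lt_of_le_of_ne h3 hst) (lt_of_le_of_ne h4 htu) h1 h2
  · exact (key hu hs (lt_of_le_of_ne h3 (Ne.symm htu)) (lt_of_le_of_ne h4 (Ne.symm hst))
      h2.symm h1.symm).symm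

theorem IsSol.flowRel {c d : ℝ} {δ : ℝ → N} (h : IsSol D (Icc c d) δ) (hs : s ∈ Icc c d)
    (ht : t ∈ Icc c d) : FlowRel D s t (δ s) (δ t) := by
  by_cases hst : s = t
  · exact Or.inl ⟨hst, by rw [hst]⟩
  · exact Or.inr ⟨hst, δ, h.mono (uniqueDiffOn_Icc (min_lt_max.2 hst)) (uIcc_subset_Icc hs ht),
      rfl, rfl⟩

end VelocityFields

/-! ### Fibre bundles with Hausdorff base and fibre are Hausdorff. -/

section Hausdorff

variable {B F : Type*} {E : B → Type*} [TopologicalSpace B] [TopologicalSpace F]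
  [TopologicalSpace (TotalSpace F E)] [∀ b, TopologicalSpace (E b)] [FiberBundle F E]

/-- Points over different base points are separated in the base, points over the same one in a
trivialization. It is needed for TM, where uniqueness of parallel sections takes place. -/
theorem t2Space_totalSpace [T2Space B] [T2Space F] : T2Space (TotalSpace F E) := by
  have hp : Continuous (TotalSpace.proj : TotalSpace F E → B) := FiberBundle.continuous_proj F E
  refine ⟨fun X Y hXY => ?_⟩
  by_cases h : X.proj = Y.proj
  · set e := trivializationAt F E X.proj
    have hX : X ∈ e.source := by
      rw [e.mem_source]; exact mem_baseSet_trivializationAt F E X.proj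
    have hY : Y ∈ e.source := by
      rw [e.mem_source, ← h]; exact mem_baseSet_trivializationAt F E X.proj
    have hne : e X ≠ e Y := fun h' => hXY (e.injOn hX hY h')
    obtain ⟨u, v, hu, hv, hXu, hYv, huv⟩ := t2_separation hne
    refine ⟨e.source ∩ e ⁻¹' u, e.source ∩ e ⁻¹' v,
      e.continuousOn_toFun.isOpen_inter_preimage e.open_source hu,
      e.continuousOn_toFun.isOpen_inter_preimage e.open_source hv, ⟨hX, hXu⟩, ⟨hY, hYv⟩, ?_⟩
    exact (huv.preimage e).mono inter_subset_right inter_subset_right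
  · obtain ⟨u, v, hu, hv, hXu, hYv, huv⟩ := t2_separation h
    exact ⟨_, _, hu.preimage hp, hv.preimage hp, hXu, hYv, huv.preimage _⟩

end Hausdorff

/-! ### Tangent vectors to the range of a field of projections. -/

section TangentToFixedPoints

variable {E : Type*} [NormedAddCommGroup E] [NormedSpace ℝ E]

/-- The tangent vectors to the range of a field of projections. -/
theorem exists_curve_fixed_iff {A : E → E →L[ℝ] E} {z : E} (hA : ContDiffAt ℝ ∞ A z)
    (hi : ∀ᶠ z' in 𝓝 z, ∀ w, A z' (A z' w) = A z' w) {y u v : E} :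
    (∃ c : ℝ → E × E, ContDiffAt ℝ ∞ c 0 ∧ (∀ᶠ r in 𝓝 (0 : ℝ), A (c r).1 (c r).2 = (c r).2) ∧
      c 0 = (z, y) ∧ HasDerivAt c (u, v) 0) ↔ A z y = y ∧ fderiv ℝ A z u y + A z v = v := by
  have hAd : HasFDerivAt A (fderiv ℝ A z) z := (hA.differentiableAt (by simp)).hasFDerivAt
  constructor
  · rintro ⟨c, -, hc, h0, hd⟩
    have h1 : HasDerivAt (fun r => (c r).1) u 0 :=
      (hasFDerivAt_fst (𝕜 := ℝ) (p := c 0)).comp_hasDerivAt (0 : ℝ) hd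
    have h2 : HasDerivAt (fun r => (c r).2) v 0 :=
      (hasFDerivAt_snd (𝕜 := ℝ) (p := c 0)).comp_hasDerivAt (0 : ℝ) hd
    have hAd' : HasFDerivAt A (fderiv ℝ A z) (c 0).1 := by rwa [h0]
    have h3 : HasDerivAt (fun r => A (c r).1) (fderiv ℝ A z u) 0 :=
      hAd'.comp_hasDerivAt (f := fun r => (c r).1) (0 : ℝ) h1
    have h4 := h3.clm_apply h2
    have h5 := (h2.congr_of_eventuallyEq hc).unique h4
    rw [h0] at h5
    refine ⟨?_, h5.symm⟩
    have := hc.self_of_nhds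
    rwa [h0] at this
  · rintro ⟨h1, h2⟩
    have hl : ∀ q w : E, HasDerivAt (fun r : ℝ => q + r • w) w 0 := fun q w => by
      simpa using ((hasDerivAt_id (0 : ℝ)).smul_const w).const_add q
    have hz : z + (0 : ℝ) • u = z := by simp
    have hAz : ContDiffAt ℝ ∞ A (z + (0 : ℝ) • u) := by rwa [hz]
    -- The straight line in the direction (u, v) is projected back by A. Its second component has
    -- derivative DA(u) y + A v, which is v by assumption.
    refine ⟨fun r => (z + r • u, A (z + r • u) (y + r • v)), ?_, ?_, by simp [h1], ?_⟩
    · have hlin : ∀ q w : E, ContDiffAt ℝ ∞ (fun r : ℝ => q + r • w) 0 := fun q w => by fun_prop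
      exact (hlin z u).prodMk ((hAz.comp (0 : ℝ) (hlin z u)).clm_apply (hlin y v))
    · have ht : Filter.Tendsto (fun r : ℝ => z + r • u) (𝓝 0) (𝓝 z) := by
        simpa using (hl z u).continuousAt.tendsto
      filter_upwards [ht.eventually hi] with r hr
      exact hr _
    · have hAd' : HasFDerivAt A (fderiv ℝ A z) (z + (0 : ℝ) • u) := by rwa [hz]
      have h3 : HasDerivAt (fun r : ℝ => A (z + r • u)) (fderiv ℝ A z u) 0 :=
        hAd'.comp_hasDerivAt (f := fun r : ℝ => z + r • u) (0 : ℝ) (hl z u)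
      have h4 := (hl z u).prodMk (h3.clm_apply (hl y v))
      simpa [h2] using h4

end TangentToFixedPoints

/-! ### The connection and the canonical horizontal spaces in charts. -/

section ConnectionCoordinates

variable {EB HB B : Type*} [NormedAddCommGroup EB] [NormedSpace ℝ EB] [TopologicalSpace HB]
  {IB : ModelWithCorners ℝ EB HB} [TopologicalSpace B] [ChartedSpace HB B]
  {EM HM M : Type*} [NormedAddCommGroup EM] [NormedSpace ℝ EM] [TopologicalSpace HM]
  {I : ModelWithCorners ℝ EM HM} [TopologicalSpace M] [ChartedSpace HM M]
  [IsManifold I ∞ M] {p : M → B}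

namespace Connection

variable (C : Connection IB I p)

/-- The vertical projection in the chart at `x₀`. -/
def coordV (x₀ : M) (z : EM) : EM →L[ℝ] EM :=
  (tangentCoordChange I ((extChartAt I x₀).symm z) x₀ ((extChartAt I x₀).symm z)).comp
    ((C.V ((extChartAt I x₀).symm z) : EM →L[ℝ] EM).comp
      (tangentCoordChange I x₀ ((extChartAt I x₀).symm z) ((extChartAt I x₀).symm z)))

theorem coordV_coordVec {x₀ : M} {X : TangentBundle I M}
    (hX : X.proj ∈ (extChartAt I x₀).source) :
    C.coordV x₀ (extChartAt I x₀ X.proj) (coordVec I x₀ X) =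
      coordVec I x₀ (⟨X.proj, C.V X.proj X.snd⟩ : TangentBundle I M) := by
  have h := tangentCoordChange_cancel hX X.snd
  unfold coordV
  rw [(extChartAt I x₀).left_inv hX]
  exact congrArg (fun w : EM => tangentCoordChange I X.proj x₀ X.proj (C.V X.proj w)) h

theorem coordVec_extChartAt_symm {x₀ : M} {z : EM} (hz : z ∈ (extChartAt I x₀).target) (w : EM) :
    coordVec I x₀ (⟨(extChartAt I x₀).symm z, tangentCoordChange I x₀ ((extChartAt I x₀).symm z)
      ((extChartAt I x₀).symm z) w⟩ : TangentBundle I M) = w :=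
  tangentCoordChange_cancel' ((extChartAt I x₀).map_target hz) w

/-- Every point of the target of a chart of `TM` comes from a tangent vector. -/
theorem exists_coordVec_eq {x₀ : M} {z : EM} (hz : z ∈ (extChartAt I x₀).target) (w : EM) :
    ∃ X : TangentBundle I M, X.proj ∈ (extChartAt I x₀).source ∧ extChartAt I x₀ X.proj = z ∧
      coordVec I x₀ X = w :=
  ⟨_, (extChartAt I x₀).map_target hz, (extChartAt I x₀).right_inv hz,
    coordVec_extChartAt_symm hz w⟩

theorem coordV_idem {x₀ : M} {z : EM} (hz : z ∈ (extChartAt I x₀).target) (w : EM) :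
    C.coordV x₀ z (C.coordV x₀ z w) = C.coordV x₀ z w := by
  obtain ⟨X, hX, rfl, rfl⟩ := exists_coordVec_eq hz w
  rw [C.coordV_coordVec hX]
  refine (C.coordV_coordVec (X := ⟨X.proj, C.V X.proj X.snd⟩) hX).trans ?_
  change coordVec I x₀ ⟨X.proj, C.V X.proj (C.V X.proj X.snd)⟩ = _
  rw [C.idem]

theorem V_eq_self_iff {e : M} {v : TangentSpace I e} : C.V e v = v ↔ v ∈ vert IB I p e := by
  rw [← C.range_eq]
  exact ⟨fun h => ⟨v, h⟩, by rintro ⟨w, rfl⟩; exact C.idem e w⟩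

theorem mem_vertSet_iff {x₀ : M} {X : TangentBundle I M}
    (hX : X.proj ∈ (extChartAt I x₀).source) :
    X ∈ C.vertSet ↔
      C.coordV x₀ (extChartAt I x₀ X.proj) (coordVec I x₀ X) = coordVec I x₀ X := by
  rw [C.coordV_coordVec hX]
  change X.snd ∈ vert IB I p X.proj ↔ _
  rw [← C.V_eq_self_iff]
  constructor
  · intro h; rw [h]
  · intro h
    have := eq_of_coordVec_eq (X := ⟨X.proj, C.V X.proj X.snd⟩) (Y := X) rfl hX h
    exact TotalSpace.mk_injective X.proj (a₂ := X.snd) this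

theorem coordVec_zero (x₀ x : M) : coordVec I x₀ (⟨x, 0⟩ : TangentBundle I M) = 0 :=
  map_zero (tangentCoordChange I x x₀ x)

theorem mem_horSet_iff {x₀ : M} {X : TangentBundle I M}
    (hX : X.proj ∈ (extChartAt I x₀).source) :
    X ∈ C.horSet ↔ C.coordV x₀ (extChartAt I x₀ X.proj) (coordVec I x₀ X) = 0 := by
  rw [C.coordV_coordVec hX]
  change C.V X.proj X.snd = 0 ↔ _
  constructor
  · intro h; rw [h, coordVec_zero]
  · intro h
    have := eq_of_coordVec_eq (X := ⟨X.proj, C.V X.proj X.snd⟩) (Y := ⟨X.proj, 0⟩) rfl hX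
      (h.trans (coordVec_zero x₀ X.proj).symm)
    exact TotalSpace.mk_injective X.proj this

/-- Smoothness of V is a property of a map TM → TM. Read in charts with a constant fibre coordinate
w it gives smoothness of z ↦ V(z) w, which in finite dimension suffices for the operator-valued map.
-/
theorem contDiffOn_coordV [FiniteDimensional ℝ EM] [I.Boundaryless] (x₀ : M) :
    ContDiffOn ℝ ∞ (C.coordV x₀) (extChartAt I x₀).target := by
  rw [contDiffOn_clm_apply]
  intro w
  set X₀ : TangentBundle I M := ⟨x₀, 0⟩ with hX₀
  have h1 : ContMDiffOn 𝓘(ℝ, EM) (𝓘(ℝ, EM × EM)) ∞ (fun z : EM => (z, w))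
      (extChartAt I x₀).target := by
    rw [contMDiffOn_iff_contDiffOn]; fun_prop
  have h2 : ContMDiffOn 𝓘(ℝ, EM × EM) I.tangent ∞ (extChartAt I.tangent X₀).symm
      (extChartAt I.tangent X₀).target := contMDiffOn_extChartAt_symm X₀
  have h3 := C.smooth.comp_contMDiffOn (h2.comp h1 fun z hz => by
    rw [mem_preimage, extChartAt_tangent_target]; exact ⟨hz, trivial⟩)
  have h4 : ContMDiffOn I.tangent 𝓘(ℝ, EM × EM) ∞ (extChartAt I.tangent X₀) _ :=
    contMDiffOn_extChartAt (x := X₀)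
  have h5 := h4.comp h3 fun z hz => by
    rw [mem_preimage, TangentBundle.mem_chart_source_iff, ← extChartAt_source I]
    exact (extChartAt I x₀).map_target hz
  rw [contMDiffOn_iff_contDiffOn] at h5
  refine (contDiff_snd.comp_contDiffOn h5).congr fun z hz => ?_
  have hz' : (extChartAt I x₀).symm z ∈ (extChartAt I x₀).source := (extChartAt I x₀).map_target hz
  have h6 := C.coordV_coordVec (X := (extChartAt I.tangent X₀).symm (z, w)) (x₀ := x₀) hz'
  have h7 : coordVec I x₀ ((extChartAt I.tangent X₀).symm (z, w)) = w :=
    coordVec_extChartAt_tangent_symm X₀ hz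
  rw [h7, extChartAt_tangent_symm_proj, (extChartAt I x₀).right_inv hz] at h6
  exact h6

variable [I.Boundaryless]

theorem coordV_idem_eventually {x₀ : M} {z : EM} (hz : z ∈ (extChartAt I x₀).target) :
    ∀ᶠ z' in 𝓝 z, ∀ w, C.coordV x₀ z' (C.coordV x₀ z' w) = C.coordV x₀ z' w :=
  Filter.mem_of_superset ((isOpen_extChartAt_target x₀).mem_nhds hz) fun _ hz' w =>
    C.coordV_idem hz' w

/-- Tangent vectors to a subset of `TM` that is given in coordinates by a field of projections. -/
theorem mem_tangentSet_iff_of_fixed {S : Set (TangentBundle I M)} {A : EM → EM →L[ℝ] EM}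
    {X₀ : TangentBundle I M} (hA : ContDiffOn ℝ ∞ A (extChartAt I X₀.proj).target)
    (hi : ∀ z ∈ (extChartAt I X₀.proj).target, ∀ w, A z (A z w) = A z w)
    (hS : ∀ X : TangentBundle I M, X.proj ∈ (extChartAt I X₀.proj).source →
      (X ∈ S ↔ A (extChartAt I X₀.proj X.proj) (coordVec I X₀.proj X) = coordVec I X₀.proj X))
    {W : TangentBundle I.tangent (TangentBundle I M)}
    (hW : W.proj.proj ∈ (extChartAt I X₀.proj).source) :
    W ∈ tangentSet I.tangent S ↔
      A (extChartAt I X₀.proj W.proj.proj) (coordVec I X₀.proj W.proj) = coordVec I X₀.proj W.proj ∧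
      fderiv ℝ A (extChartAt I X₀.proj W.proj.proj) (coordVec I.tangent X₀ W).1
          (coordVec I X₀.proj W.proj) +
        A (extChartAt I X₀.proj W.proj.proj) (coordVec I.tangent X₀ W).2 =
          (coordVec I.tangent X₀ W).2 := by
  have hz : extChartAt I X₀.proj W.proj.proj ∈ (extChartAt I X₀.proj).target :=
    (extChartAt I X₀.proj).map_source hW
  have ho := isOpen_extChartAt_target (I := I) X₀.proj
  rw [mem_tangentSet_iff (x₀ := X₀) (by rw [extChartAt_tangent_source]; exact hW),
    ← exists_curve_fixed_iff (hA.contDiffAt (ho.mem_nhds hz))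
      (Filter.mem_of_superset (ho.mem_nhds hz) hi)]
  refine exists_congr fun c => and_congr_right fun hc => ?_
  have e : extChartAt I.tangent X₀ W.proj =
      (extChartAt I X₀.proj W.proj.proj, coordVec I X₀.proj W.proj) := rfl
  rw [e]
  refine and_congr_left fun h0 => Filter.eventually_congr ?_
  have hc1 : ContinuousAt (fun r => (c r).1) 0 := continuousAt_fst.comp hc.continuousAt
  have h1 : ∀ᶠ r in 𝓝 (0 : ℝ), (c r).1 ∈ (extChartAt I X₀.proj).target :=
    hc1.preimage_mem_nhds (ho.mem_nhds (by rwa [h0.1]))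
  filter_upwards [h1] with r hr
  rw [hS _ (by rw [extChartAt_tangent_symm_proj]; exact (extChartAt I X₀.proj).map_target hr),
    coordVec_extChartAt_tangent_symm X₀ hr, extChartAt_tangent_symm_proj,
    (extChartAt I X₀.proj).right_inv hr]

variable [FiniteDimensional ℝ EM]

theorem contDiffAt_coordV {x₀ : M} {z : EM} (hz : z ∈ (extChartAt I x₀).target) :
    ContDiffAt ℝ ∞ (C.coordV x₀) z :=
  (C.contDiffOn_coordV x₀).contDiffAt ((isOpen_extChartAt_target x₀).mem_nhds hz)

/-- The horizontal subspaces of the canonical linear connection in coordinates. -/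
theorem mem_canonicalHor_iff (X₀ : TangentBundle I M)
    {W : TangentBundle I.tangent (TangentBundle I M)}
    (hW : W.proj.proj ∈ (extChartAt I X₀.proj).source) :
    W ∈ C.canonicalHor ↔
      C.coordV X₀.proj (extChartAt I X₀.proj W.proj.proj) (coordVec I X₀.proj W.proj) =
        coordVec I X₀.proj W.proj ∧
      C.coordV X₀.proj (extChartAt I X₀.proj W.proj.proj) (coordVec I.tangent X₀ W).1 = 0 ∧
      (coordVec I.tangent X₀ W).2 =
        fderiv ℝ (C.coordV X₀.proj) (extChartAt I X₀.proj W.proj.proj)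
          (coordVec I.tangent X₀ W).1 (coordVec I X₀.proj W.proj) -
        fderiv ℝ (C.coordV X₀.proj) (extChartAt I X₀.proj W.proj.proj)
          (coordVec I X₀.proj W.proj) (coordVec I.tangent X₀ W).1 := by
  have hz : extChartAt I X₀.proj W.proj.proj ∈ (extChartAt I X₀.proj).target :=
    (extChartAt I X₀.proj).map_source hW
  have hV := (C.contDiffAt_coordV hz).differentiableAt (by simp)
  rw [← tangent_vertical_and_flip_horizontal_iff hV (C.coordV_idem_eventually hz)]
  refine and_congr ?_ ?_
  · exact mem_tangentSet_iff_of_fixed (C.contDiffOn_coordV _) (fun z hz => C.coordV_idem hz)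
      (fun X hX => C.mem_vertSet_iff hX) hW
  · rw [mem_image_flip_iff]
    have hf := coordVec_flip X₀ W hW
    -- H is the fixed set of the complementary projection 1 − V, so its tangent vectors come from
    -- the same criterion as those of K.
    rw [mem_tangentSet_iff_of_fixed
      (A := fun z => ContinuousLinearMap.id ℝ EM - C.coordV X₀.proj z) (X₀ := X₀)
      (contDiffOn_const.sub (C.contDiffOn_coordV _))
      (fun z hz w => by simp [C.coordV_idem hz])
      (fun X hX => by simp [C.mem_horSet_iff hX]) (W := flip I W) hW, hf.1, hf.2,
      fderiv_const_sub]
    change _ ∧ -fderiv ℝ (C.coordV X₀.proj) (extChartAt I X₀.proj W.proj.proj) _ _ +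
      ((coordVec I.tangent X₀ W).2 -
        C.coordV X₀.proj (extChartAt I X₀.proj W.proj.proj) _) = _ ↔ _
    refine and_congr (by
      change _ - C.coordV X₀.proj (extChartAt I X₀.proj W.proj.proj) _ = _ ↔ _
      simp) ?_
    rw [← sub_eq_zero (b := (coordVec I.tangent X₀ W).2), ← neg_eq_zero]
    refine iff_of_eq (congrArg (· = 0) ?_)
    abel

end Connection

end ConnectionCoordinates

/-! ### Velocities of curves, including degenerate sets of times. -/

section Curves

variable {E H N : Type*} [NormedAddCommGroup E] [NormedSpace ℝ E] [TopologicalSpace H]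
  {I : ModelWithCorners ℝ E H} [TopologicalSpace N] [ChartedSpace H N]

theorem mk_snd_eq {X : TangentBundle I N} {x : N} (h : X.proj = x) :
    (⟨x, (X.snd : E)⟩ : TangentBundle I N) = X := by
  subst h
  rfl

/-- A single point has no accumulation point, so the derivative within it takes the default value 0.
This governs transport from a time to itself. -/
theorem velocity_singleton (c : ℝ → N) (t : ℝ) :
    velocity I c {t} t = (⟨c t, 0⟩ : TangentBundle I N) := by
  have h : mfderivWithin 𝓘(ℝ, ℝ) I c {t} t = 0 := by
    by_cases h : MDifferentiableWithinAt 𝓘(ℝ, ℝ) I c {t} t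
    · refine (MDifferentiableWithinAt.mfderivWithin h).trans
        (fderivWithin_zero_of_not_accPt fun hacc => ?_)
      have h1 : (extChartAt 𝓘(ℝ, ℝ) t).symm ⁻¹' {t} ∩ range 𝓘(ℝ, ℝ) = {t} := by
        rw [extChartAt_model_space_eq_id, modelWithCornersSelf_coe, range_id, inter_univ]
        rfl
      rw [h1] at hacc
      obtain ⟨y, hy1, hy2⟩ := (accPt_iff_frequently.1 hacc).exists
      exact hy1 hy2
    · exact mfderivWithin_zero_of_not_mdifferentiableWithinAt h
  unfold velocity
  rw [h]
  rfl

variable [IsManifold I ∞ N]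

/-- The velocity of a smooth curve is smooth in coordinates. -/
theorem exists_contDiffOn_coordVec_velocity {a b r₀ : ℝ} (hab : a < b) {β : ℝ → N}
    (hβ : ContMDiffOn 𝓘(ℝ, ℝ) I ∞ β (Icc a b)) (hr₀ : r₀ ∈ Icc a b) {x₀ : N}
    (hx₀ : β r₀ ∈ (extChartAt I x₀).source) :
    ∃ ε > 0, ∃ u : ℝ → E, ContDiffOn ℝ ∞ u (Icc a b ∩ Icc (r₀ - ε) (r₀ + ε)) ∧
      ∀ r ∈ Icc a b ∩ Icc (r₀ - ε) (r₀ + ε), β r ∈ (extChartAt I x₀).source ∧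
        coordVec I x₀ (velocity I β (Icc a b) r) = u r := by
  obtain ⟨e, he, hsub⟩ := Metric.mem_nhdsWithin_iff.1
    ((hβ.continuousOn r₀ hr₀).preimage_mem_nhdsWithin
      ((isOpen_extChartAt_source (I := I) x₀).mem_nhds hx₀))
  have hmem : ∀ r ∈ Icc a b ∩ Icc (r₀ - e / 2) (r₀ + e / 2),
      β r ∈ (extChartAt I x₀).source := fun r hr => hsub ⟨by
    rw [Metric.mem_ball, Real.dist_eq, abs_lt]
    constructor <;> linarith [hr.2.1, hr.2.2], hr.1⟩
  have he2 : 0 < e / 2 := by positivity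
  have hJ : UniqueDiffOn ℝ (Icc a b ∩ Icc (r₀ - e / 2) (r₀ + e / 2)) := by
    rw [Icc_inter_Icc]; exact uniqueDiffOn_Icc (max_lt_min_of_mem hab hr₀ he2)
  have hsm : ContDiffOn ℝ ∞ (fun r => extChartAt I x₀ (β r))
      (Icc a b ∩ Icc (r₀ - e / 2) (r₀ + e / 2)) := fun r hr =>
    contDiffWithinAt_extChartAt_comp ((hβ r hr.1).mono inter_subset_left) (hmem r hr)
  refine ⟨e / 2, he2, _, hsm.derivWithin hJ (m := ∞) (by simp), fun r hr => ⟨hmem r hr, ?_⟩⟩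
  have h := hasDerivWithinAt_extChartAt_comp ((hβ r hr.1).mdifferentiableWithinAt (by simp))
    (hmem r hr)
  exact ((h.mono inter_subset_left).derivWithin (hJ r hr)).symm

/-- The velocity at `t` of a curve that agrees near `t` with another one, possibly considered on a
larger set of times. -/
theorem velocity_eq_of_eqOn {c c' : ℝ → N} {J J' : Set ℝ} {t : ℝ} (hJ : UniqueDiffWithinAt ℝ J t)
    (hs : J ⊆ J') (ht : t ∈ J) (hc' : MDifferentiableWithinAt 𝓘(ℝ, ℝ) I c' J' t) (h : EqOn c c' J) :
    velocity I c J t = velocity I c' J' t := by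
  have e : c t = c' t := h ht
  refine velocity_eq_of_hasDerivWithinAt (x₀ := c' t) hJ
    ((hc'.continuousWithinAt.mono hs).congr h e) (by rw [e]; exact mem_extChartAt_source _)
    e.symm ?_
  exact ((hasDerivWithinAt_extChartAt_comp hc' (mem_extChartAt_source _)).mono hs).congr
    (fun q hq => by rw [h hq]) (by rw [e])

theorem contMDiffOn_singleton_curve (c : ℝ → N) (t : ℝ) : ContMDiffOn 𝓘(ℝ, ℝ) I ∞ c {t} := by
  rintro r rfl
  exact contMDiffWithinAt_of_extChartAt_comp continuousWithinAt_singleton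
    (mem_extChartAt_source _) contDiffWithinAt_singleton

/-- In (x, y; u, v) the involution moves u into the base slot, and u is the velocity of the
underlying curve x. -/
theorem flip_velocity_proj [I.Boundaryless] {δ : ℝ → TangentBundle I N} {J : Set ℝ} {t : ℝ}
    (hJ : UniqueDiffWithinAt ℝ J t) (hδ : MDifferentiableWithinAt 𝓘(ℝ, ℝ) I.tangent δ J t) :
    (flip I (velocity I.tangent δ J t)).proj = velocity I (fun r => (δ r).proj) J t := by
  have hx : (δ t).proj ∈ (extChartAt I (δ t).proj).source := mem_extChartAt_source _
  have h := hasDerivWithinAt_extChartAt_comp (x₀ := δ t) hδ (mem_extChartAt_source _)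
  have h1 : HasDerivWithinAt (fun r => extChartAt I (δ t).proj (δ r).proj)
      (coordVec I.tangent (δ t) (velocity I.tangent δ J t)).1 J t :=
    HasFDerivAt.comp_hasDerivWithinAt (l := (Prod.fst : E × E → E)) t hasFDerivAt_fst h
  have hc : ContinuousWithinAt (fun r => (δ r).proj) J t :=
    (FiberBundle.continuous_proj E (TangentSpace I)).continuousAt.comp_continuousWithinAt
      hδ.continuousWithinAt
  refine (velocity_eq_of_hasDerivWithinAt (x₀ := (δ t).proj)
    (W := (flip I (velocity I.tangent δ J t)).proj) hJ hc hx rfl ?_).symm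
  rw [(coordVec_flip (δ t) (velocity I.tangent δ J t) hx).1]
  exact h1

end Curves

/-! ### The projection in charts. -/

section Submersion

variable {EB HB B : Type*} [NormedAddCommGroup EB] [NormedSpace ℝ EB] [TopologicalSpace HB]
  {IB : ModelWithCorners ℝ EB HB} [TopologicalSpace B] [ChartedSpace HB B]
  {EM HM M : Type*} [NormedAddCommGroup EM] [NormedSpace ℝ EM] [TopologicalSpace HM]
  {I : ModelWithCorners ℝ EM HM} [TopologicalSpace M] [ChartedSpace HM M]
  {p : M → B}

theorem tangentMap_velocity {δ : ℝ → M} {J : Set ℝ} {t : ℝ}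
    (hJ : UniqueDiffWithinAt ℝ J t) (hδ : MDifferentiableWithinAt 𝓘(ℝ, ℝ) I δ J t)
    (hp : MDifferentiableAt I IB p (δ t)) :
    tangentMap I IB p (velocity I δ J t) = velocity IB (fun r => p (δ r)) J t := by
  have h : mfderivWithin 𝓘(ℝ, ℝ) IB (p ∘ δ) J t =
      (mfderiv I IB p (δ t)).comp (mfderivWithin 𝓘(ℝ, ℝ) I δ J t) :=
    mfderiv_comp_mfderivWithin t hp hδ hJ.uniqueMDiffWithinAt
  change (⟨p (δ t), mfderiv I IB p (δ t) (mfderivWithin 𝓘(ℝ, ℝ) I δ J t 1)⟩ : TangentBundle IB B) =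
    ⟨p (δ t), mfderivWithin 𝓘(ℝ, ℝ) IB (p ∘ δ) J t 1⟩
  rw [h]
  rfl

variable (IB I p) in
/-- The domain, in the chart at `x₀`, of the expression of `p` in coordinates. -/
def coordDomain (x₀ : M) : Set EM :=
  (extChartAt I x₀).target ∩ (extChartAt I x₀).symm ⁻¹' (p ⁻¹' (extChartAt IB (p x₀)).source)

theorem mem_coordDomain {x₀ x : M} (hx : x ∈ (extChartAt I x₀).source)
    (hpx : p x ∈ (extChartAt IB (p x₀)).source) :
    extChartAt I x₀ x ∈ coordDomain IB I p x₀ :=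
  ⟨(extChartAt I x₀).map_source hx, by
    rwa [mem_preimage, mem_preimage, (extChartAt I x₀).left_inv hx]⟩

theorem isOpen_coordDomain [I.Boundaryless] (hp : Continuous p) (x₀ : M) :
    IsOpen (coordDomain IB I p x₀) :=
  (continuousOn_extChartAt_symm x₀).isOpen_inter_preimage (isOpen_extChartAt_target x₀)
    ((isOpen_extChartAt_source (p x₀)).preimage hp)

variable [IsManifold IB ∞ B] [IsManifold I ∞ M]

theorem contDiffOn_writtenInExtChartAt (hp : ContMDiff I IB ∞ p) (x₀ : M) :
    ContDiffOn ℝ ∞ (writtenInExtChartAt I IB x₀ p) (coordDomain IB I p x₀) := by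
  rw [← contMDiffOn_iff_contDiffOn]
  have h1 := hp.comp_contMDiffOn (contMDiffOn_extChartAt_symm (I := I) (n := ∞) x₀)
  exact (contMDiffOn_extChartAt (x := p x₀)).comp (h1.mono inter_subset_left) fun z hz => by
    rw [mem_preimage, ← extChartAt_source IB]; exact hz.2

variable [I.Boundaryless]

/-- The tangent map in coordinates. -/
theorem fderiv_writtenInExtChartAt_coordVec (hp : ContMDiff I IB ∞ p) {x₀ : M}
    {X : TangentBundle I M} (hX : X.proj ∈ (extChartAt I x₀).source)
    (hpX : p X.proj ∈ (extChartAt IB (p x₀)).source) :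
    fderiv ℝ (writtenInExtChartAt I IB x₀ p) (extChartAt I x₀ X.proj) (coordVec I x₀ X) =
      coordVec IB (p x₀) (tangentMap I IB p X) := by
  have hd : HasFDerivAt (writtenInExtChartAt I IB x₀ p)
      (fderiv ℝ (writtenInExtChartAt I IB x₀ p) (extChartAt I x₀ X.proj))
      (extChartAt I x₀ X.proj) :=
    (((contDiffOn_writtenInExtChartAt hp x₀).differentiableOn (by simp)).differentiableAt
      ((isOpen_coordDomain hp.continuous x₀).mem_nhds (mem_coordDomain hX hpX))).hasFDerivAt
  have h1 := hd.hasMFDerivAt.comp X.proj (hasMFDerivAt_extChartAt_tangentCoordChange hX)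
  have h2 := (hasMFDerivAt_extChartAt_tangentCoordChange hpX).comp X.proj
    ((hp X.proj).mdifferentiableAt (by simp)).hasMFDerivAt
  have h3 : writtenInExtChartAt I IB x₀ p ∘ extChartAt I x₀ =ᶠ[𝓝 X.proj]
      extChartAt IB (p x₀) ∘ p := by
    filter_upwards [(isOpen_extChartAt_source x₀).mem_nhds hX] with x hx
    simp only [writtenInExtChartAt, Function.comp_apply, (extChartAt I x₀).left_inv hx]
  have h4 := hasMFDerivAt_unique (h1.congr_of_eventuallyEq h3.symm) h2
  exact congrArg (fun L : EM →L[ℝ] EB => L X.snd) h4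

variable (C : Connection IB I p)

/-- K is both the kernel of Tp and the range of V. This form, at every point of the domain, is what
the differentiation of Dp (V η) = 0 requires. -/
theorem Connection.fderiv_eq_zero_iff (hp : ContMDiff I IB ∞ p) {x₀ : M} {z : EM}
    (hz : z ∈ coordDomain IB I p x₀) (w : EM) :
    fderiv ℝ (writtenInExtChartAt I IB x₀ p) z w = 0 ↔ C.coordV x₀ z w = w := by
  obtain ⟨X, hX, rfl, rfl⟩ := Connection.exists_coordVec_eq hz.1 w
  have hpX : p X.proj ∈ (extChartAt IB (p x₀)).source := by
    have := hz.2
    rwa [mem_preimage, mem_preimage, (extChartAt I x₀).left_inv hX] at this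
  rw [fderiv_writtenInExtChartAt_coordVec hp hX hpX, ← C.mem_vertSet_iff hX]
  change _ ↔ mfderiv I IB p X.proj X.snd = 0
  constructor
  · intro h
    have := eq_of_coordVec_eq (X := tangentMap I IB p X) (Y := ⟨p X.proj, 0⟩) rfl hpX
      (h.trans (map_zero (tangentCoordChange IB (p X.proj) (p x₀) (p X.proj))).symm)
    exact TotalSpace.mk_injective (p X.proj) this
  · intro h
    have : tangentMap I IB p X = ⟨p X.proj, 0⟩ := congrArg (TotalSpace.mk (p X.proj)) h
    rw [this]
    exact map_zero (tangentCoordChange IB (p X.proj) (p x₀) (p X.proj))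

theorem fderiv_writtenInExtChartAt_surjective (hp : ContMDiff I IB ∞ p) {x₀ x : M}
    (hx : x ∈ (extChartAt I x₀).source) (hpx : p x ∈ (extChartAt IB (p x₀)).source)
    (hs : Function.Surjective (mfderiv I IB p x)) :
    Function.Surjective (fderiv ℝ (writtenInExtChartAt I IB x₀ p) (extChartAt I x₀ x)) := by
  intro w
  obtain ⟨v, hv⟩ := hs (tangentCoordChange IB (p x₀) (p x) (p x) w : EB)
  refine ⟨coordVec I x₀ ⟨x, v⟩, ?_⟩
  refine (fderiv_writtenInExtChartAt_coordVec hp (X := ⟨x, v⟩) hx hpx).trans ?_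
  have : tangentMap I IB p ⟨x, v⟩ = ⟨p x, (tangentCoordChange IB (p x₀) (p x) (p x) w : EB)⟩ :=
    congrArg (TotalSpace.mk (p x)) hv
  rw [this]
  exact tangentCoordChange_cancel' hpx w

end Submersion

/-! ### Both transports as flows of smooth differential equations. -/

section Transport

variable {EB HB B : Type*} [NormedAddCommGroup EB] [NormedSpace ℝ EB] [TopologicalSpace HB]
  {IB : ModelWithCorners ℝ EB HB} [TopologicalSpace B] [ChartedSpace HB B]
  {EM HM M : Type*} [NormedAddCommGroup EM] [NormedSpace ℝ EM] [TopologicalSpace HM]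
  {I : ModelWithCorners ℝ EM HM} [TopologicalSpace M] [ChartedSpace HM M]
  [IsManifold I ∞ M] {p : M → B}

namespace Connection

variable (C : Connection IB I p)

/-- The velocities at the time `r` of the horizontal lifts of a path `γ` of the base. -/
def liftVel (γ : ℝ → B) (J : Set ℝ) (r : ℝ) : Set (TangentBundle I M) :=
  {W | W ∈ C.horSet ∧ tangentMap I IB p W = velocity IB γ J r}

/-- The velocities at the time `r` of the parallel sections of `β*K`. -/
def parallelVel (β : ℝ → M) (J : Set ℝ) (r : ℝ) :
    Set (TangentBundle I.tangent (TangentBundle I M)) :=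
  {W | W ∈ C.canonicalHor ∧ (flip I W).proj = velocity I β J r}

theorem proj_mem_vertSet_of_mem_canonicalHor
    {W : TangentBundle I.tangent (TangentBundle I M)} (hW : W ∈ C.canonicalHor) :
    W.proj ∈ C.vertSet := by
  obtain ⟨⟨c, -, hc, rfl⟩, -⟩ := hW
  exact hc.self_of_nhds

variable [I.Boundaryless] [FiniteDimensional ℝ EM]

/-- The condition on `flip` fixes the first component u as the velocity of β, and
`mem_canonicalHor_iff` then fixes the second as DV(u) y − DV(y) u, a smooth function of time and of
(z, y). -/
theorem isODE_parallelVel {a b : ℝ} (hab : a < b) {β : ℝ → M}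
    (hβ : ContMDiffOn 𝓘(ℝ, ℝ) I ∞ β (Icc a b)) : IsODE (C.parallelVel β (Icc a b)) a b := by
  rintro r₀ hr₀ W₀ ⟨-, hW₀⟩
  set X₀ := W₀.proj with hX₀
  have hproj : ∀ (r : ℝ) (W : TangentBundle I.tangent (TangentBundle I M)),
      (flip I W).proj = velocity I β (Icc a b) r → W.proj.proj = β r := fun r W h =>
    congrArg (fun X : TangentBundle I M => X.proj) h
  have hb := hproj r₀ W₀ hW₀
  obtain ⟨ε, hε, u, hu, huε⟩ := exists_contDiffOn_coordVec_velocity hab hβ hr₀ (x₀ := X₀.proj)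
    (by rw [← hb]; exact mem_extChartAt_source _)
  have ho := isOpen_extChartAt_target (I := I) X₀.proj
  have hD : ContDiffOn ℝ ∞ (fderiv ℝ (C.coordV X₀.proj)) (extChartAt I X₀.proj).target :=
    (C.contDiffOn_coordV X₀.proj).fderiv_of_isOpen ho (by simp)
  refine ⟨(extChartAt I X₀.proj).target ×ˢ univ, ε, fun r q =>
    (u r, fderiv ℝ (C.coordV X₀.proj) q.1 (u r) q.2 - fderiv ℝ (C.coordV X₀.proj) q.1 q.2 (u r)),
    hε, ho.prod isOpen_univ, ⟨mem_extChartAt_target _, trivial⟩, ?_, ?_⟩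
  · have h1 : ContDiffOn ℝ ∞ (fun w : ℝ × EM × EM => u w.1)
        ((Icc a b ∩ Icc (r₀ - ε) (r₀ + ε)) ×ˢ ((extChartAt I X₀.proj).target ×ˢ univ)) :=
      hu.comp contDiff_fst.contDiffOn fun w hw => hw.1
    have h2 : ContDiffOn ℝ ∞ (fun w : ℝ × EM × EM => fderiv ℝ (C.coordV X₀.proj) w.2.1)
        ((Icc a b ∩ Icc (r₀ - ε) (r₀ + ε)) ×ˢ ((extChartAt I X₀.proj).target ×ˢ univ)) :=
      hD.comp (contDiff_fst.comp contDiff_snd).contDiffOn fun w hw => hw.2.1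
    have h3 : ContDiffOn ℝ ∞ (fun w : ℝ × EM × EM => w.2.2)
        ((Icc a b ∩ Icc (r₀ - ε) (r₀ + ε)) ×ˢ ((extChartAt I X₀.proj).target ×ˢ univ)) :=
      (contDiff_snd.comp contDiff_snd).contDiffOn
    exact h1.prodMk (((h2.clm_apply h1).clm_apply h3).sub ((h2.clm_apply h3).clm_apply h1))
  · rintro r hr W ⟨hW, hWv⟩ hWs -
    rw [extChartAt_tangent_source] at hWs
    have h1 := (coordVec_flip X₀ W hWs).1
    rw [hWv, (huε r hr).2] at h1
    have h2 := ((C.mem_canonicalHor_iff X₀ hWs).1 hW).2.2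
    rw [← h1] at h2
    exact Prod.ext h1.symm h2

theorem zero_mem_canonicalHor {X : TangentBundle I M} (hX : X ∈ C.vertSet) :
    (⟨X, 0⟩ : TangentBundle I.tangent (TangentBundle I M)) ∈ C.canonicalHor := by
  have h : X.proj ∈ (extChartAt I X.proj).source := mem_extChartAt_source _
  have h0 : coordVec I.tangent X (⟨X, 0⟩ : TangentBundle I.tangent (TangentBundle I M)) = 0 :=
    coordVec_zero X X
  rw [C.mem_canonicalHor_iff X h, h0]
  refine ⟨(C.mem_vertSet_iff h).1 hX, map_zero _, ?_⟩
  simp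

/-- For s ≠ t smoothness of solutions and verticality are automatic. For s = t the velocity is 0 by
default, which is canonically horizontal but does not project to the velocity of β in general; hence
the separate case in `FlowRel`. -/
theorem linTransports_iff {a b s t : ℝ} (hab : a < b) {β : ℝ → M}
    (hβ : ContMDiffOn 𝓘(ℝ, ℝ) I ∞ β (Icc a b)) (hs : s ∈ Icc a b) (ht : t ∈ Icc a b)
    (w : vert IB I p (β s)) (z : vert IB I p (β t)) :
    C.LinTransports β s t w z ↔ FlowRel (C.parallelVel β (Icc a b)) s t
      (⟨β s, w⟩ : TangentBundle I M) (⟨β t, z⟩ : TangentBundle I M) := by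
  have hJ : uIcc s t ⊆ Icc a b := uIcc_subset_Icc hs ht
  by_cases hst : s = t
  · subst hst
    constructor
    · rintro ⟨σ, -, h1, h2⟩
      exact Or.inl ⟨rfl, by rw [← h1, ← h2]⟩
    · rintro (⟨-, h⟩ | ⟨h, -⟩)
      · have hwz : (w : TangentSpace I (β s)) = z := TotalSpace.mk_injective (β s) h
        refine ⟨fun r => ((w : TangentSpace I (β s)) : EM), ⟨⟨?_, ?_⟩, ?_⟩, rfl, hwz⟩
        · rw [uIcc_self]; exact contMDiffOn_singleton_curve _ _
        · rw [uIcc_self]; rintro r rfl; exact w.2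
        · rw [uIcc_self]
          rintro r rfl
          rw [velocity_singleton]
          exact C.zero_mem_canonicalHor w.2
      · exact absurd rfl h
  have hu : UniqueDiffOn ℝ (uIcc s t) := uniqueDiffOn_Icc (min_lt_max.2 hst)
  constructor
  · rintro ⟨σ, ⟨⟨h1, -⟩, h2⟩, h3, h4⟩
    refine Or.inr ⟨hst, fun r => ⟨β r, σ r⟩, fun r hr => ?_, congrArg (TotalSpace.mk (β s)) h3,
      congrArg (TotalSpace.mk (β t)) h4⟩
    have hm := (h1 r hr).mdifferentiableWithinAt (by simp)
    refine ⟨hm, h2 r hr, ?_⟩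
    rw [flip_velocity_proj (hu r hr) hm]
    exact velocity_eq_of_eqOn (hu r hr) hJ hr
      ((hβ r (hJ hr)).mdifferentiableWithinAt (by simp)) fun _ _ => rfl
  · rintro (⟨h, -⟩ | ⟨-, δ, hδ, h1, h2⟩)
    · exact absurd h hst
    have hp : ∀ r ∈ uIcc s t, (δ r).proj = β r := fun r hr =>
      congrArg (fun X : TangentBundle I M => X.proj) (hδ r hr).2.2
    have he : EqOn (fun r => (⟨β r, ((δ r).snd : EM)⟩ : TangentBundle I M)) δ (uIcc s t) :=
      fun r hr => mk_snd_eq (hp r hr)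
    refine ⟨fun r => ((δ r).snd : EM), ⟨⟨?_, fun r hr => ?_⟩, fun r hr => ?_⟩, ?_, ?_⟩
    · exact ((C.isODE_parallelVel hab hβ).contMDiffOn hJ hδ).congr he
    · have : δ r ∈ C.vertSet := C.proj_mem_vertSet_of_mem_canonicalHor (hδ r hr).2.1
      rw [← he hr] at this
      exact this
    · rw [velocity_eq_of_eqOn (hu r hr) subset_rfl hr (hδ r hr).1 he]
      exact (hδ r hr).2.1
    · exact TotalSpace.mk_injective (β s) ((he left_mem_uIcc).trans h1)
    · exact TotalSpace.mk_injective (β t) ((he right_mem_uIcc).trans h2)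

variable [IsManifold IB ∞ B] [FiniteDimensional ℝ EB]

/-- Near a point the only horizontal vector over the velocity u of γ is G(z) u, with G the smooth
field of horizontal lifts. -/
theorem isODE_liftVel (hp : ContMDiff I IB ∞ p)
    (hsurj : ∀ e, Function.Surjective (mfderiv I IB p e)) {a b : ℝ} (hab : a < b) {γ : ℝ → B}
    (hγ : ContMDiffOn 𝓘(ℝ, ℝ) IB ∞ γ (Icc a b)) : IsODE (C.liftVel γ (Icc a b)) a b := by
  rintro r₀ hr₀ W₀ ⟨-, hW₀⟩
  set x₀ := W₀.proj with hx₀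
  have hproj : ∀ (r : ℝ) (W : TangentBundle I M),
      tangentMap I IB p W = velocity IB γ (Icc a b) r → p W.proj = γ r := fun r W h =>
    congrArg (fun X : TangentBundle IB B => X.proj) h
  obtain ⟨ε, hε, u, hu, huε⟩ := exists_contDiffOn_coordVec_velocity hab hγ hr₀ (x₀ := p x₀)
    (by rw [← hproj r₀ W₀ hW₀]; exact mem_extChartAt_source _)
  have hx₀s : x₀ ∈ (extChartAt I x₀).source := mem_extChartAt_source _
  have hpx₀s : p x₀ ∈ (extChartAt IB (p x₀)).source := mem_extChartAt_source _
  obtain ⟨U, hU, hUo, hxU, G, hG, hGiff⟩ := exists_horizontal_lift_field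
    (isOpen_coordDomain (IB := IB) (I := I) hp.continuous x₀)
    ((C.contDiffOn_coordV x₀).mono inter_subset_left) (fun z hz => C.coordV_idem hz.1)
    (contDiffOn_writtenInExtChartAt hp x₀) (fun z hz => C.fderiv_eq_zero_iff hp hz)
    (mem_coordDomain hx₀s hpx₀s)
    (fderiv_writtenInExtChartAt_surjective hp hx₀s hpx₀s (hsurj x₀))
  refine ⟨U, ε, fun r z => G z (u r), hε, hUo, hxU,
    (hG.comp contDiff_snd.contDiffOn fun q hq => hq.2).clm_apply
      (hu.comp contDiff_fst.contDiffOn fun q hq => hq.1), ?_⟩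
  rintro r hr W ⟨hW, hWv⟩ hWs hWU
  have hpW : p W.proj ∈ (extChartAt IB (p x₀)).source := by
    rw [hproj r W hWv]; exact (huε r hr).1
  refine (hGiff _ hWU _ _).1 ⟨(C.mem_horSet_iff hWs).1 hW, ?_⟩
  rw [fderiv_writtenInExtChartAt_coordVec hp hWs hpW, hWv, (huε r hr).2]

theorem transports_iff (hp : ContMDiff I IB ∞ p)
    (hsurj : ∀ e, Function.Surjective (mfderiv I IB p e)) {a b s t : ℝ} (hab : a < b) {γ : ℝ → B}
    (hγ : ContMDiffOn 𝓘(ℝ, ℝ) IB ∞ γ (Icc a b)) (hs : s ∈ Icc a b) (ht : t ∈ Icc a b) {e f : M} :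
    C.Transports γ s t e f ↔ p e = γ s ∧ FlowRel (C.liftVel γ (Icc a b)) s t e f := by
  have hJ : uIcc s t ⊆ Icc a b := uIcc_subset_Icc hs ht
  by_cases hst : s = t
  · subst hst
    constructor
    · rintro ⟨δ, -, h1, rfl, rfl⟩
      exact ⟨h1 s left_mem_uIcc, Or.inl ⟨rfl, rfl⟩⟩
    · rintro ⟨h1, (⟨-, rfl⟩ | ⟨h, -⟩)⟩
      · refine ⟨fun _ => e, ⟨?_, ?_⟩, ?_, rfl, rfl⟩
        · rw [uIcc_self]; exact contMDiffOn_singleton_curve _ _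
        · rw [uIcc_self]
          rintro r rfl
          rw [velocity_singleton]
          exact map_zero (C.V e)
        · rw [uIcc_self]; rintro r rfl; exact h1
      · exact absurd rfl h
  have hu : UniqueDiffOn ℝ (uIcc s t) := uniqueDiffOn_Icc (min_lt_max.2 hst)
  constructor
  · rintro ⟨δ, ⟨h1, h2⟩, h3, rfl, rfl⟩
    refine ⟨h3 s left_mem_uIcc, Or.inr ⟨hst, δ, fun r hr => ?_, rfl, rfl⟩⟩
    have hm := (h1 r hr).mdifferentiableWithinAt (by simp)
    refine ⟨hm, h2 r hr, ?_⟩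
    rw [tangentMap_velocity (hu r hr) hm ((hp _).mdifferentiableAt (by simp))]
    exact velocity_eq_of_eqOn (hu r hr) hJ hr
      ((hγ r (hJ hr)).mdifferentiableWithinAt (by simp)) h3
  · rintro ⟨h0, (⟨h, -⟩ | ⟨-, δ, hδ, rfl, rfl⟩)⟩
    · exact absurd h hst
    · exact ⟨δ, ⟨(C.isODE_liftVel hp hsurj hab hγ).contMDiffOn hJ hδ, fun r hr => (hδ r hr).2.1⟩,
        fun r hr => congrArg (fun X : TangentBundle IB B => X.proj) (hδ r hr).2.2, rfl, rfl⟩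

end Connection

end Transport

/-! ### The tangent map of the nonlinear transport, first locally and then along the whole path. -/

section TransportAlongPath

variable {EB HB B : Type*} [NormedAddCommGroup EB] [NormedSpace ℝ EB] [TopologicalSpace HB]
  {IB : ModelWithCorners ℝ EB HB} [TopologicalSpace B] [ChartedSpace HB B]
  {EM HM M : Type*} [NormedAddCommGroup EM] [NormedSpace ℝ EM] [TopologicalSpace HM]
  {I : ModelWithCorners ℝ EM HM} [TopologicalSpace M] [ChartedSpace HM M]
  [IsManifold I ∞ M] {p : M → B}

theorem hasMFDerivAt_extChartAt_symm_tangentCoordChange [I.Boundaryless] {x₀ y : M}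
    (hy : y ∈ (extChartAt I x₀).source) :
    HasMFDerivAt 𝓘(ℝ, EM) I (extChartAt I x₀).symm (extChartAt I x₀ y)
      (tangentCoordChange I x₀ y y : EM →L[ℝ] EM) := by
  have hz : extChartAt I x₀ y ∈ (extChartAt I x₀).target := (extChartAt I x₀).map_source hy
  have hd : MDifferentiableAt 𝓘(ℝ, EM) I (extChartAt I x₀).symm (extChartAt I x₀ y) :=
    ((contMDiffOn_extChartAt_symm (I := I) (n := ∞) x₀).contMDiffAt
      ((isOpen_extChartAt_target x₀).mem_nhds hz)).mdifferentiableAt (by simp)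
  have hl : (extChartAt I x₀).symm (extChartAt I x₀ y) = y := (extChartAt I x₀).left_inv hy
  set D : EM →L[ℝ] EM := mfderiv 𝓘(ℝ, EM) I (extChartAt I x₀).symm (extChartAt I x₀ y) with hD
  have h0 : HasMFDerivAt I 𝓘(ℝ, EM) (extChartAt I x₀) ((extChartAt I x₀).symm (extChartAt I x₀ y))
      (tangentCoordChange I y x₀ y : EM →L[ℝ] EM) := by
    rw [hl]; exact hasMFDerivAt_extChartAt_tangentCoordChange hy
  have h1 := h0.comp (extChartAt I x₀ y) hd.hasMFDerivAt
  have h2 : HasMFDerivAt 𝓘(ℝ, EM) 𝓘(ℝ, EM) (extChartAt I x₀ ∘ (extChartAt I x₀).symm)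
      (extChartAt I x₀ y) (ContinuousLinearMap.id ℝ EM) := by
    refine (hasMFDerivAt_id _).congr_of_eventuallyEq ?_
    filter_upwards [(isOpen_extChartAt_target x₀).mem_nhds hz] with z hz
    exact (extChartAt I x₀).right_inv hz
  have h3 := hasMFDerivAt_unique h1 h2
  have h4 : (tangentCoordChange I x₀ y y : EM →L[ℝ] EM) = D := by
    ext w
    have h5 : tangentCoordChange I y x₀ y (D w) = w := congrArg (fun L : EM →L[ℝ] EM => L w) h3
    have h6 := tangentCoordChange_cancel hy (D w)
    rw [h5] at h6
    exact h6
  rw [h4]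
  exact hd.hasMFDerivAt

namespace Connection

variable (C : Connection IB I p)

/-- Parallel transport along `p ∘ β` from `s` to `t` is defined near `β s` by a map that is
differentiable at `β s`, and whose tangent map there is the linear parallel transport. -/
def HasTransport (β : ℝ → M) (J : Set ℝ) (s t : ℝ) : Prop :=
  ∃ (g : M → M) (L : EM →L[ℝ] EM), g (β s) = β t ∧ HasMFDerivAt I I g (β s) L ∧
    (∀ᶠ e in 𝓝[p ⁻¹' {p (β s)}] (β s), p (g e) = p (β t) ∧
      FlowRel (C.liftVel (p ∘ β) J) s t e (g e)) ∧
    ∀ w ∈ vert IB I p (β s), L w ∈ vert IB I p (β t) ∧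
      FlowRel (C.parallelVel β J) s t (⟨β s, w⟩ : TangentBundle I M)
        (⟨β t, L w⟩ : TangentBundle I M)

variable [I.Boundaryless] [FiniteDimensional ℝ EM] [IsManifold IB ∞ B] [FiniteDimensional ℝ EB]

theorem HasTransport.trans {C : Connection IB I p} (hp : ContMDiff I IB ∞ p)
    (hsurj : ∀ e, Function.Surjective (mfderiv I IB p e)) {a b : ℝ} (hab : a < b) {β : ℝ → M}
    (hβ : ContMDiffOn 𝓘(ℝ, ℝ) I ∞ β (Icc a b)) {s t u : ℝ} (hs : s ∈ Icc a b) (hu : u ∈ Icc a b)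
    (ht : t ∈ uIcc s u) (h1 : C.HasTransport β (Icc a b) s t)
    (h2 : C.HasTransport β (Icc a b) t u) : C.HasTransport β (Icc a b) s u := by
  obtain ⟨g, L, hg, hL, hF, hl⟩ := h1
  obtain ⟨g', L', hg', hL', hF', hl'⟩ := h2
  have hODE := C.isODE_liftVel hp hsurj hab (hp.comp_contMDiffOn hβ)
  have hODE' := C.isODE_parallelVel hab hβ
  refine ⟨g' ∘ g, L'.comp L, by rw [Function.comp_apply, hg, hg'], ?_, ?_, fun w hw => ?_⟩
  · have hL'' : HasMFDerivAt I I g' (g (β s)) (L' : EM →L[ℝ] EM) := by rw [hg]; exact hL'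
    exact hL''.comp (β s) hL
  · have htend : Filter.Tendsto g (𝓝[p ⁻¹' {p (β s)}] (β s)) (𝓝[p ⁻¹' {p (β t)}] (β t)) := by
      refine tendsto_nhdsWithin_iff.2 ⟨?_, hF.mono fun e he => he.1⟩
      have := hL.continuousAt.tendsto
      rw [hg] at this
      exact this.mono_left nhdsWithin_le_nhds
    filter_upwards [hF, htend.eventually hF'] with e he he'
    exact ⟨he'.1, FlowRel.trans hODE hs hu ht he.2 he'.2⟩
  · obtain ⟨hw1, hw2⟩ := hl w hw
    obtain ⟨hw3, hw4⟩ := hl' _ hw1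
    exact ⟨hw3, FlowRel.trans hODE' hs hu ht hw2 hw4⟩

/-- `exists_local_transport` in the charts at β t₀ and its projection, carried back to the manifold.
One window serves all pairs s, t, as the Lebesgue number argument requires. -/
theorem exists_hasTransport_near (hp : ContMDiff I IB ∞ p)
    (hsurj : ∀ e, Function.Surjective (mfderiv I IB p e)) {a b : ℝ} (hab : a < b) {β : ℝ → M}
    (hβ : C.IsHorizontalOn (Icc a b) β) {t₀ : ℝ} (ht₀ : t₀ ∈ Icc a b) :
    ∃ ε > 0, ∀ s ∈ Icc a b ∩ Icc (t₀ - ε) (t₀ + ε), ∀ t ∈ Icc a b ∩ Icc (t₀ - ε) (t₀ + ε),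
      C.HasTransport β (Icc a b) s t := by
  set x₀ := β t₀ with hx₀
  have hopen : IsOpen ((extChartAt I x₀).source ∩ p ⁻¹' (extChartAt IB (p x₀)).source) :=
    (isOpen_extChartAt_source x₀).inter ((isOpen_extChartAt_source (p x₀)).preimage hp.continuous)
  obtain ⟨e, he, hsub⟩ := Metric.mem_nhdsWithin_iff.1
    ((hβ.1.continuousOn t₀ ht₀).preimage_mem_nhdsWithin
      (hopen.mem_nhds ⟨mem_extChartAt_source _, mem_extChartAt_source _⟩))
  have he2 : 0 < e / 2 := by positivity
  set c := max a (t₀ - e / 2)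
  set d := min b (t₀ + e / 2)
  have hcd : c < d := max_lt_min_of_mem hab ht₀ he2
  have hcI : Icc c d = Icc a b ∩ Icc (t₀ - e / 2) (t₀ + e / 2) := Icc_inter_Icc.symm
  have hcab : Icc c d ⊆ Icc a b := hcI ▸ inter_subset_left
  have htc : t₀ ∈ Icc c d := hcI ▸ ⟨ht₀, by linarith, by linarith⟩
  have hmem : ∀ r ∈ Icc c d, β r ∈ (extChartAt I x₀).source ∧
      p (β r) ∈ (extChartAt IB (p x₀)).source := fun r hr => by
    rw [hcI] at hr
    exact hsub ⟨by
      rw [Metric.mem_ball, Real.dist_eq, abs_lt]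
      constructor <;> linarith [hr.2.1, hr.2.2], hr.1⟩
  set x : ℝ → EM := fun r => extChartAt I x₀ (β r) with hx
  have hβm : ∀ r ∈ Icc a b, MDifferentiableWithinAt 𝓘(ℝ, ℝ) I β (Icc a b) r := fun r hr =>
    (hβ.1 r hr).mdifferentiableWithinAt (by simp)
  have hxd : ∀ r ∈ Icc c d, derivWithin x (Icc c d) r =
      coordVec I x₀ (velocity I β (Icc a b) r) := fun r hr =>
    ((hasDerivWithinAt_extChartAt_comp (hβm r (hcab hr)) (hmem r hr).1).mono hcab).derivWithin
      (uniqueDiffOn_Icc hcd r hr)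
  have hxs : ContDiffOn ℝ ∞ x (Icc c d) := fun r hr =>
    contDiffWithinAt_extChartAt_comp ((hβ.1 r (hcab hr)).mono hcab) (hmem r hr).1
  have hxV : ∀ r ∈ Icc c d, C.coordV x₀ (x r) (derivWithin x (Icc c d) r) = 0 := fun r hr => by
    rw [hxd r hr]
    exact (C.mem_horSet_iff (X := velocity I β (Icc a b) r) (hmem r hr).1).1 (hβ.2 r (hcab hr))
  have hxU : MapsTo x (Icc c d) (coordDomain IB I p x₀) := fun r hr =>
    mem_coordDomain (hmem r hr).1 (hmem r hr).2
  obtain ⟨ε, hε, hloc⟩ := exists_local_transport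
    (isOpen_coordDomain (IB := IB) (I := I) hp.continuous x₀)
    ((C.contDiffOn_coordV x₀).mono inter_subset_left) (fun z hz => C.coordV_idem hz.1)
    (contDiffOn_writtenInExtChartAt hp x₀) (fun z hz => C.fderiv_eq_zero_iff hp hz)
    hcd htc hxs hxV hxU
    (fderiv_writtenInExtChartAt_surjective hp (mem_extChartAt_source _) (mem_extChartAt_source _)
      (hsurj x₀))
  set ε' := min (e / 2) (ε / 2)
  have hε' : 0 < ε' := lt_min he2 (by positivity)
  have hεe : ε' ≤ e / 2 := min_le_left _ _
  have hεε : ε' ≤ ε / 2 := min_le_right _ _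
  refine ⟨ε', hε', fun s hs t ht => ?_⟩
  have htJ : t₀ ∈ Icc a b ∩ Icc (t₀ - ε') (t₀ + ε') := ⟨ht₀, by linarith, by linarith⟩
  rw [Icc_inter_Icc] at hs ht htJ
  set J := Icc (max a (t₀ - ε')) (min b (t₀ + ε')) with hJ
  have hJu : UniqueDiffOn ℝ J := uniqueDiffOn_Icc (max_lt_min_of_mem hab ht₀ hε')
  have hJc : J ⊆ Icc c d := Icc_subset_Icc (max_le_max le_rfl (by linarith))
    (min_le_min le_rfl (by linarith))
  have hJa : J ⊆ Icc a b := hJc.trans hcab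
  obtain ⟨φ, Y, hφ, hφx, hYs, hφY, hY⟩ := hloc _ _ (max_le_max le_rfl (by linarith))
    (min_le_min le_rfl (by linarith)) htJ
    (by linarith [min_le_right b (t₀ + ε'), le_max_right a (t₀ - ε')]) s hs
  have hsm := hmem s (hJc hs)
  have htm := hmem t (hJc ht)
  have hJleft : ∀ r ∈ J, (extChartAt I x₀).symm (x r) = β r := fun r hr =>
    (extChartAt I x₀).left_inv (hmem r (hJc hr)).1
  -- Tangent spaces are identified with the model space through the preferred chart of each point,
  -- so Y t must be conjugated with the changes from and to the chart at x₀.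
  set L : EM →L[ℝ] EM := (tangentCoordChange I x₀ (β t) (β t)).comp
    ((Y t).comp (tangentCoordChange I (β s) x₀ (β s))) with hL
  refine ⟨fun e => (extChartAt I x₀).symm (φ (extChartAt I x₀ e) t), L, ?_, ?_, ?_, ?_⟩
  · change (extChartAt I x₀).symm (φ (x s) t) = β t
    rw [hφx ht, hJleft t ht]
  · have h1 := hasMFDerivAt_extChartAt_tangentCoordChange (I := I) hsm.1
    have h2 : HasMFDerivAt 𝓘(ℝ, EM) 𝓘(ℝ, EM) (fun y => φ y t) (extChartAt I x₀ (β s)) (Y t) :=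
      (hφY t ht).hasMFDerivAt
    have h3 : HasMFDerivAt 𝓘(ℝ, EM) I (extChartAt I x₀).symm (φ (extChartAt I x₀ (β s)) t)
        (tangentCoordChange I x₀ (β t) (β t) : EM →L[ℝ] EM) := by
      have : φ (extChartAt I x₀ (β s)) t = extChartAt I x₀ (β t) := hφx ht
      rw [this]
      exact hasMFDerivAt_extChartAt_symm_tangentCoordChange htm.1
    exact h3.comp (β s) (h2.comp (β s) h1)
  · have hev : ∀ᶠ y in 𝓝 (β s), y ∈ (extChartAt I x₀).source ∧
        p y ∈ (extChartAt IB (p x₀)).source := hopen.mem_nhds hsm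
    have hev' := (continuousAt_extChartAt' (I := I) hsm.1).tendsto.eventually hφ
    filter_upwards [nhdsWithin_le_nhds hev, nhdsWithin_le_nhds hev', self_mem_nhdsWithin]
      with y hy hyφ hyp
    have hyx : writtenInExtChartAt I IB x₀ p (extChartAt I x₀ y) =
        writtenInExtChartAt I IB x₀ p (x s) := by
      simp only [writtenInExtChartAt, Function.comp_apply, (extChartAt I x₀).left_inv hy.1,
        hJleft s hs]
      rw [show p y = p (β s) from hyp]
    set δ : ℝ → M := fun r => (extChartAt I x₀).symm (φ (extChartAt I x₀ y) r) with hδ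
    have hpδ : EqOn (fun r => p (δ r)) (p ∘ β) J := fun r hr => by
      have h1 := (hyφ.2 r hr).2.2 hyx
      simp only [writtenInExtChartAt, Function.comp_apply, hJleft r hr] at h1
      exact (extChartAt IB (p x₀)).injOn (hyφ.2 r hr).1.2 (hmem r (hJc hr)).2 h1
    have hδs : δ s = y := by
      simp only [hδ, hyφ.1, (extChartAt I x₀).left_inv hy.1]
    have hsol : IsSol (C.liftVel (p ∘ β) (Icc a b)) J δ := fun r hr => by
      obtain ⟨hU, ⟨v, hv, hvV⟩, -⟩ := hyφ.2 r hr
      have hsrc : δ r ∈ (extChartAt I x₀).source := (extChartAt I x₀).map_target hU.1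
      have hco : ContinuousWithinAt δ J r :=
        ((continuousOn_extChartAt_symm x₀).continuousAt
          ((isOpen_extChartAt_target x₀).mem_nhds hU.1)).comp_continuousWithinAt
          hv.continuousWithinAt
      have hd : HasDerivWithinAt (fun r => extChartAt I x₀ (δ r)) v J r :=
        hv.congr (fun q hq => (extChartAt I x₀).right_inv (hyφ.2 q hq).1.1)
          ((extChartAt I x₀).right_inv hU.1)
      have hm := mdifferentiableWithinAt_of_extChartAt_comp hco hsrc hd.differentiableWithinAt
      refine ⟨hm, ?_, ?_⟩
      · rw [C.mem_horSet_iff (X := velocity I δ J r) hsrc,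
          (hJu r hr).eq_deriv _ (hasDerivWithinAt_extChartAt_comp hm hsrc) hd]
        change C.coordV x₀ (extChartAt I x₀ (δ r)) v = 0
        rw [(extChartAt I x₀).right_inv hU.1, hvV]
      · rw [tangentMap_velocity (hJu r hr) hm ((hp _).mdifferentiableAt (by simp))]
        exact velocity_eq_of_eqOn (hJu r hr) hJa hr
          ((hp.comp_contMDiffOn hβ.1 r (hJa hr)).mdifferentiableWithinAt (by simp)) hpδ
    refine ⟨hpδ ht, ?_⟩
    have := hsol.flowRel hs ht
    rwa [hδs] at this
  · intro w hw
    set X₀ : TangentBundle I M := ⟨x₀, 0⟩ with hX₀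
    set η : EM := coordVec I x₀ (⟨β s, w⟩ : TangentBundle I M) with hη
    have hηV : C.coordV x₀ (x s) η = η :=
      (C.mem_vertSet_iff (X := ⟨β s, w⟩) hsm.1).1 hw
    have hYη := hY η hηV
    have hLw : coordVec I x₀ (⟨β t, L w⟩ : TangentBundle I M) = Y t η :=
      tangentCoordChange_cancel' htm.1 _
    refine ⟨(C.mem_vertSet_iff (X := ⟨β t, L w⟩) htm.1).2 (by rw [hLw]; exact (hYη t ht).1), ?_⟩
    have hxt : ∀ r ∈ J, x r ∈ (extChartAt I x₀).target := fun r hr => (hxU (hJc hr)).1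
    -- The derivative of the flow applied to η is itself the parallel section. The zero vector X₀
    -- only selects a chart of TM.
    set δ : ℝ → TangentBundle I M := fun r => (extChartAt I.tangent X₀).symm (x r, Y r η) with hδ
    have hδp : ∀ r ∈ J, (δ r).proj = β r := fun r hr => hJleft r hr
    have hδv : ∀ r ∈ J, coordVec I x₀ (δ r) = Y r η := fun r hr =>
      coordVec_extChartAt_tangent_symm X₀ (hxt r hr)
    have hsol : IsSol (C.parallelVel β (Icc a b)) J δ := fun r hr => by
      have htgt : (x r, Y r η) ∈ (extChartAt I.tangent X₀).target := by
        rw [extChartAt_tangent_target]; exact ⟨hxt r hr, trivial⟩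
      have hsrc : δ r ∈ (extChartAt I.tangent X₀).source :=
        (extChartAt I.tangent X₀).map_target htgt
      have hsrc' : (δ r).proj ∈ (extChartAt I X₀.proj).source := by
        rw [hδp r hr]; exact (hmem r (hJc hr)).1
      have hxr : HasDerivWithinAt x (derivWithin x (Icc c d) r) J r :=
        ((hxs.differentiableOn (by simp)) r (hJc hr)).hasDerivWithinAt.mono hJc
      have hpair := hxr.prodMk (hYη r hr).2
      have hcs : ContinuousAt (extChartAt I.tangent X₀).symm (x r, Y r η) :=
        (continuousOn_extChartAt_symm X₀).continuousAt
          ((isOpen_extChartAt_target X₀).mem_nhds htgt)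
      have hco : ContinuousWithinAt δ J r :=
        ContinuousAt.comp_continuousWithinAt (f := fun r => (x r, Y r η))
          (g := (extChartAt I.tangent X₀).symm) hcs hpair.continuousWithinAt
      have hd : HasDerivWithinAt (fun r => extChartAt I.tangent X₀ (δ r)) _ J r :=
        hpair.congr (fun q hq => (extChartAt I.tangent X₀).right_inv (by
          rw [extChartAt_tangent_target]; exact ⟨hxt q hq, trivial⟩))
          ((extChartAt I.tangent X₀).right_inv htgt)
      have hm := mdifferentiableWithinAt_of_extChartAt_comp hco hsrc hd.differentiableWithinAt
      have hvel := (hJu r hr).eq_deriv _ (hasDerivWithinAt_extChartAt_comp hm hsrc) hd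
      refine ⟨hm, ?_, ?_⟩
      · rw [C.mem_canonicalHor_iff X₀ (W := velocity I.tangent δ J r) hsrc', hvel]
        change C.coordV x₀ (extChartAt I x₀ (δ r).proj) (coordVec I x₀ (δ r)) =
            coordVec I x₀ (δ r) ∧ C.coordV x₀ (extChartAt I x₀ (δ r).proj) _ = 0 ∧
          _ = fderiv ℝ (C.coordV x₀) (extChartAt I x₀ (δ r).proj) _ (coordVec I x₀ (δ r)) -
            fderiv ℝ (C.coordV x₀) (extChartAt I x₀ (δ r).proj) (coordVec I x₀ (δ r)) _
        rw [hδv r hr, hδp r hr]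
        exact ⟨(hYη r hr).1, hxV r (hJc hr), rfl⟩
      · rw [flip_velocity_proj (hJu r hr) hm]
        exact velocity_eq_of_eqOn (hJu r hr) hJa hr (hβm r (hJa hr)) hδp
    have hfl := hsol.flowRel hs ht
    have e1 : δ s = ⟨β s, w⟩ := by
      refine eq_of_coordVec_eq (x₀ := x₀) (hδp s hs) (by rw [hδp s hs]; exact hsm.1) ?_
      rw [hδv s hs, hYs, ← hη]
      rfl
    have e2 : δ t = ⟨β t, L w⟩ := by
      refine eq_of_coordVec_eq (x₀ := x₀) (hδp t ht) (by rw [hδp t ht]; exact htm.1) ?_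
      rw [hδv t ht, hLw]
    rw [e1, e2] at hfl
    exact hfl

/-- A Lebesgue number δ for the windows of `exists_hasTransport_near` settles all pairs at distance
below δ; induction on the number of steps of length δ/2 settles the rest. -/
theorem hasTransport (hp : ContMDiff I IB ∞ p)
    (hsurj : ∀ e, Function.Surjective (mfderiv I IB p e)) {a b : ℝ} (hab : a < b) {β : ℝ → M}
    (hβ : C.IsHorizontalOn (Icc a b) β) {s t : ℝ} (hs : s ∈ Icc a b) (ht : t ∈ Icc a b) :
    C.HasTransport β (Icc a b) s t := by
  have hloc : ∀ t₀ : Icc a b, ∃ ε > 0, ∀ s ∈ Icc a b ∩ Icc ((t₀ : ℝ) - ε) (t₀ + ε),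
      ∀ t ∈ Icc a b ∩ Icc ((t₀ : ℝ) - ε) (t₀ + ε), C.HasTransport β (Icc a b) s t := fun t₀ =>
    C.exists_hasTransport_near hp hsurj hab hβ t₀.2
  choose ε hε hεt using hloc
  obtain ⟨δ, hδ, hleb⟩ := lebesgue_number_lemma_of_metric (s := Icc a b)
    (c := fun t₀ : Icc a b => Ioo ((t₀ : ℝ) - ε t₀) (t₀ + ε t₀)) isCompact_Icc
    (fun _ => isOpen_Ioo) (fun r hr => mem_iUnion.2 ⟨⟨r, hr⟩, by
      have := hε ⟨r, hr⟩
      constructor <;> simp only <;> linarith⟩)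
  have hnear : ∀ s ∈ Icc a b, ∀ t ∈ Icc a b, |t - s| < δ → C.HasTransport β (Icc a b) s t := by
    intro s hs t ht hst
    obtain ⟨t₀, h0⟩ := hleb s hs
    exact hεt t₀ s ⟨hs, Ioo_subset_Icc_self (h0 (Metric.mem_ball_self hδ))⟩ t
      ⟨ht, Ioo_subset_Icc_self (h0 hst)⟩
  have hall : ∀ n : ℕ, ∀ s ∈ Icc a b, ∀ t ∈ Icc a b, |t - s| ≤ n * (δ / 2) →
      C.HasTransport β (Icc a b) s t := by
    intro n
    induction n with
    | zero =>
      intro s hs t ht h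
      exact hnear s hs t ht (h.trans_lt (by simpa using hδ))
    | succ n ih =>
      intro s hs t ht h
      -- Cutting at the fraction n/(n+1) leaves pieces of length at most n δ/2 and δ/2, whichever of
      -- s and t comes first.
      set l : ℝ := n / (n + 1) with hl
      have hl0 : 0 ≤ l := by positivity
      have hl1 : 1 - l = 1 / (n + 1) := by rw [hl]; field_simp; ring
      have hl2 : 0 ≤ 1 - l := by rw [hl1]; positivity
      set m := s + l * (t - s) with hm
      have hmu : m ∈ uIcc s t := by
        rw [← segment_eq_uIcc]
        exact ⟨1 - l, l, hl2, hl0, by ring, by simp only [smul_eq_mul]; ring⟩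
      have hmab : m ∈ Icc a b := uIcc_subset_Icc hs ht hmu
      push_cast at h
      refine HasTransport.trans hp hsurj hab hβ.1 hs ht hmu (ih s hs m hmab ?_)
        (hnear m hmab t ht ?_)
      · rw [hm, add_sub_cancel_left, abs_mul, abs_of_nonneg hl0]
        calc l * |t - s| ≤ l * ((n + 1) * (δ / 2)) := by gcongr
          _ = n * (δ / 2) := by rw [hl]; field_simp
      · have : t - m = (1 - l) * (t - s) := by rw [hm]; ring
        rw [this, abs_mul, abs_of_nonneg hl2, hl1]
        calc 1 / ((n : ℝ) + 1) * |t - s| ≤ 1 / ((n : ℝ) + 1) * ((n + 1) * (δ / 2)) := by gcongr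
          _ = δ / 2 := by field_simp
          _ < δ := by linarith
  obtain ⟨n, hn⟩ := exists_nat_ge (|t - s| / (δ / 2))
  exact hall n s hs t ht (by rwa [div_le_iff₀ (by positivity)] at hn)

/-- The linear parallel transport along a horizontal path is the tangent map of the parallel
transport along the projected path. -/
theorem exists_linTransports_eq_tangent_transport [T2Space M] (hp : ContMDiff I IB ∞ p)
    (hsurj : ∀ e, Function.Surjective (mfderiv I IB p e)) {a b : ℝ} (hab : a < b) {β : ℝ → M}
    (hβ : C.IsHorizontalOn (Icc a b) β) {s t : ℝ} (hs : s ∈ Icc a b) (ht : t ∈ Icc a b) :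
    ∃ τ : vert IB I p (β s) →ₗ[ℝ] vert IB I p (β t),
      (∀ w z, C.LinTransports β s t w z ↔ z = τ w) ∧
      ∃ (Gs Gt : Set M) (g : M → M),
        Gs ⊆ p ⁻¹' {p (β s)} ∧ Gs ∈ 𝓝[p ⁻¹' {p (β s)}] (β s) ∧
        Gt ⊆ p ⁻¹' {p (β t)} ∧ Gt ∈ 𝓝[p ⁻¹' {p (β t)}] (β t) ∧
        BijOn g Gs Gt ∧ (∀ e ∈ Gs, ∀ f, C.Transports (p ∘ β) s t e f ↔ f = g e) ∧
        HasFibreTangentMap (IB := IB) (I := I) (p := p) g (β s) (β t) τ := by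
  have : T2Space (TangentBundle I M) := t2Space_totalSpace
  have hγ : ContMDiffOn 𝓘(ℝ, ℝ) IB ∞ (p ∘ β) (Icc a b) := hp.comp_contMDiffOn hβ.1
  have hODE := C.isODE_liftVel hp hsurj hab hγ
  have hODE' := C.isODE_parallelVel hab hβ.1
  have hproj : ∀ {s t : ℝ} {e f : M}, C.Transports (p ∘ β) s t e f →
      p e = p (β s) ∧ p f = p (β t) := by
    rintro s t _ _ ⟨δ, -, h, rfl, rfl⟩
    exact ⟨h s left_mem_uIcc, h t right_mem_uIcc⟩
  have hsymm : ∀ {s t : ℝ} {e f : M}, C.Transports (p ∘ β) s t e f →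
      C.Transports (p ∘ β) t s f e := by
    rintro s t e f ⟨δ, h1, h2, h3, h4⟩
    exact ⟨δ, by rwa [uIcc_comm], by rwa [uIcc_comm], h4, h3⟩
  have huniq : ∀ {s t : ℝ}, s ∈ Icc a b → t ∈ Icc a b → ∀ {e f f' : M},
      C.Transports (p ∘ β) s t e f → C.Transports (p ∘ β) s t e f' → f = f' := by
    intro s t hs ht e f f' h1 h2
    rw [C.transports_iff hp hsurj hab hγ hs ht] at h1 h2
    exact FlowRel.unique hODE hs ht h1.2 h2.2
  have hnhds : ∀ {s t : ℝ}, s ∈ Icc a b → t ∈ Icc a b →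
      {e | ∃ f, C.Transports (p ∘ β) s t e f} ∈ 𝓝[p ⁻¹' {p (β s)}] (β s) := by
    intro s t hs ht
    obtain ⟨g, -, -, -, hg, -⟩ := C.hasTransport hp hsurj hab hβ hs ht
    filter_upwards [hg, self_mem_nhdsWithin] with e he hes
    exact ⟨g e, (C.transports_iff hp hsurj hab hγ hs ht).2 ⟨hes, he.2⟩⟩
  obtain ⟨g, L, hgs, hgL, hg, hlin⟩ := C.hasTransport hp hsurj hab hβ hs ht
  classical
  -- The local map g represents the transport only near β s. The map g' does so on its whole domain
  -- and agrees with g near β s in the fibre, so it inherits the derivative. Its default value e is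
  -- irrelevant.
  set g' : M → M := fun e => if h : ∃ f, C.Transports (p ∘ β) s t e f then h.choose else e
    with hg'
  have hg'spec : ∀ {e f : M}, C.Transports (p ∘ β) s t e f → g' e = f := by
    intro e f h
    have hex : ∃ f, C.Transports (p ∘ β) s t e f := ⟨f, h⟩
    have : g' e = hex.choose := dif_pos hex
    rw [this]
    exact huniq hs ht hex.choose_spec h
  have hgg' : g' =ᶠ[𝓝[p ⁻¹' {p (β s)}] (β s)] g := by
    filter_upwards [hg, self_mem_nhdsWithin] with e he hes
    exact hg'spec ((C.transports_iff hp hsurj hab hγ hs ht).2 ⟨hes, he.2⟩)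
  have hg's : g' (β s) = g (β s) := hgg'.self_of_nhdsWithin rfl
  set Lt : TangentSpace I (β s) →ₗ[ℝ] TangentSpace I (β t) := (L : EM →ₗ[ℝ] EM)
  set τ : vert IB I p (β s) →ₗ[ℝ] vert IB I p (β t) :=
    Lt.restrict fun w hw => (hlin w hw).1 with hτ
  -- The neighbourhoods are the full domains of the forward and backward transports, which makes
  -- bijectivity a consequence of reversal and uniqueness.
  refine ⟨τ, fun w z => ?_, {e | ∃ f, C.Transports (p ∘ β) s t e f},
    {f | ∃ e, C.Transports (p ∘ β) t s f e}, g', ?_, hnhds hs ht, ?_, hnhds ht hs, ?_, ?_, ?_⟩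
  · rw [C.linTransports_iff hab hβ.1 hs ht]
    constructor
    · intro h
      have h1 := FlowRel.unique hODE' hs ht h (hlin w w.2).2
      exact Subtype.ext (TotalSpace.mk_injective (β t) h1)
    · rintro rfl
      exact (hlin w w.2).2
  · rintro e ⟨f, h⟩
    exact (hproj h).1
  · rintro f ⟨e, h⟩
    exact (hproj h).1
  · refine ⟨?_, ?_, ?_⟩
    · rintro e ⟨f, h⟩
      rw [hg'spec h]
      exact ⟨e, hsymm h⟩
    · rintro e ⟨f, h⟩ e' ⟨f', h'⟩ hee
      rw [hg'spec h, hg'spec h'] at hee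
      subst hee
      exact huniq ht hs (hsymm h) (hsymm h')
    · rintro f ⟨e, h⟩
      exact ⟨e, ⟨f, hsymm h⟩, hg'spec (hsymm h)⟩
  · rintro e ⟨f, h⟩ f'
    constructor
    · intro h'
      exact (hg'spec h').symm
    · rintro rfl
      rw [hg'spec h]
      exact h
  · refine ⟨(L : EM →L[ℝ] EM), ?_, fun w => ?_⟩
    · exact hgL.hasMFDerivWithinAt.congr_of_eventuallyEq hgg' hg's
    · have h1 : g' (β s) = β t := hg's.trans hgs
      rw [h1]
      rfl

end Connection

end TransportAlongPath

/-! ### Charts of the total space of a fibre bundle. -/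

section TotalSpace

variable {EB HB B : Type*} [NormedAddCommGroup EB] [NormedSpace ℝ EB] [TopologicalSpace HB]
  {IB : ModelWithCorners ℝ EB HB} [TopologicalSpace B] [ChartedSpace HB B]
  {F : Type*} [NormedAddCommGroup F] [NormedSpace ℝ F]
  {E : B → Type*} [TopologicalSpace (TotalSpace F E)] [∀ b, TopologicalSpace (E b)]
  [FiberBundle F E]

theorem extChartAt_totalSpace_apply {e₀ e : TotalSpace F E}
    (he : e.proj ∈ (trivializationAt F E e₀.proj).baseSet) :
    extChartAt (IB.prod 𝓘(ℝ, F)) e₀ e =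
      (extChartAt IB e₀.proj e.proj, (trivializationAt F E e₀.proj e).2) := by
  rw [FiberBundle.extChartAt]
  refine Prod.ext ?_ rfl
  exact congrArg (extChartAt IB e₀.proj) ((trivializationAt F E e₀.proj).coe_fst' he)

/-- The preferred chart depends only on the base point, so all points of a fibre share it and their
tangent vectors can be compared directly. -/
theorem extChartAt_totalSpace_congr {e₀ e : TotalSpace F E} (h : e.proj = e₀.proj) :
    extChartAt (IB.prod 𝓘(ℝ, F)) e = extChartAt (IB.prod 𝓘(ℝ, F)) e₀ := by
  rw [FiberBundle.extChartAt, FiberBundle.extChartAt, h]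

theorem mem_extChartAt_totalSpace_source_iff {e₀ e : TotalSpace F E} :
    e ∈ (extChartAt (IB.prod 𝓘(ℝ, F)) e₀).source ↔
      e.proj ∈ (trivializationAt F E e₀.proj).baseSet ∧
        e.proj ∈ (extChartAt IB e₀.proj).source := by
  rw [FiberBundle.extChartAt, PartialEquiv.trans_source, mem_inter_iff]
  have h : e ∈ (trivializationAt F E e₀.proj).toPartialEquiv.source ↔
      e.proj ∈ (trivializationAt F E e₀.proj).baseSet :=
    (trivializationAt F E e₀.proj).mem_source
  rw [h]
  refine and_congr_right fun he => ?_
  have h1 : ((trivializationAt F E e₀.proj) e).1 = e.proj :=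
    (trivializationAt F E e₀.proj).coe_fst' he
  rw [PartialEquiv.prod_source, mem_preimage, mem_prod]
  change ((trivializationAt F E e₀.proj) e).1 ∈ _ ∧ _ ∈ univ ↔ _
  rw [h1]
  simp

/-- The derivative of a map of bundles over the identity that is linear in local trivializations. -/
theorem hasMFDerivAt_of_trivializationAt {F₁ : Type*} [NormedAddCommGroup F₁] [NormedSpace ℝ F₁]
    {E₁ : B → Type*} [TopologicalSpace (TotalSpace F₁ E₁)] [∀ b, TopologicalSpace (E₁ b)]
    [FiberBundle F₁ E₁] [IB.Boundaryless] {f : TotalSpace F₁ E₁ → TotalSpace F E}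
    (hf : ∀ y, (f y).proj = y.proj) (x : TotalSpace F₁ E₁) (L : F₁ →L[ℝ] F)
    (hL : ∀ y : TotalSpace F₁ E₁, y.proj ∈ (trivializationAt F₁ E₁ x.proj).baseSet →
      y.proj ∈ (trivializationAt F E x.proj).baseSet →
      (trivializationAt F E x.proj (f y)).2 = L (trivializationAt F₁ E₁ x.proj y).2) :
    HasMFDerivAt (IB.prod 𝓘(ℝ, F₁)) (IB.prod 𝓘(ℝ, F)) f x
      ((ContinuousLinearMap.id ℝ EB).prodMap L : EB × F₁ →L[ℝ] EB × F) := by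
  have hb : ∀ᶠ y : TotalSpace F₁ E₁ in 𝓝 x, y ∈ (extChartAt (IB.prod 𝓘(ℝ, F₁)) x).source ∧
      y.proj ∈ (trivializationAt F E x.proj).baseSet :=
    Filter.Eventually.and (extChartAt_source_mem_nhds x)
      ((FiberBundle.continuous_proj F₁ E₁).continuousAt.preimage_mem_nhds
        ((trivializationAt F E x.proj).open_baseSet.mem_nhds
          (mem_baseSet_trivializationAt F E x.proj)))
  have hc : ContinuousAt f x := by
    rw [FiberBundle.continuousAt_totalSpace, hf x]
    refine ⟨((FiberBundle.continuous_proj F₁ E₁).continuousAt).congr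
      (Filter.Eventually.of_forall fun y => (hf y).symm), ?_⟩
    have h1 : ContinuousAt (fun y => (trivializationAt F₁ E₁ x.proj y).2) x :=
      (FiberBundle.continuousAt_totalSpace (f := fun y : TotalSpace F₁ E₁ => y)).1
        continuousAt_id |>.2
    refine (L.continuous.continuousAt.comp h1).congr ?_
    filter_upwards [hb] with y hy
    exact (hL y (mem_extChartAt_totalSpace_source_iff.1 hy.1).1 hy.2).symm
  refine ⟨hc, ?_⟩
  refine ((((ContinuousLinearMap.id ℝ EB).prodMap L).hasFDerivAt).congr_of_eventuallyEq
    ?_).hasFDerivWithinAt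
  have hs : ∀ᶠ q in 𝓝 (extChartAt (IB.prod 𝓘(ℝ, F₁)) x x),
      q ∈ (extChartAt (IB.prod 𝓘(ℝ, F₁)) x).target ∧
      ((extChartAt (IB.prod 𝓘(ℝ, F₁)) x).symm q).proj ∈
        (trivializationAt F E x.proj).baseSet := by
    refine Filter.Eventually.and (extChartAt_target_mem_nhds x) ?_
    have := continuousAt_extChartAt_symm (I := IB.prod 𝓘(ℝ, F₁)) x
    rw [ContinuousAt, extChartAt_to_inv] at this
    exact this.eventually (hb.mono fun y hy => hy.2)
  filter_upwards [hs] with q hq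
  set y := (extChartAt (IB.prod 𝓘(ℝ, F₁)) x).symm q with hy
  have hyq : extChartAt (IB.prod 𝓘(ℝ, F₁)) x y = q := (extChartAt _ x).right_inv hq.1
  have hys := mem_extChartAt_totalSpace_source_iff.1 ((extChartAt _ x).map_target hq.1)
  change extChartAt (IB.prod 𝓘(ℝ, F)) (f x) (f y) = (q.1, L q.2)
  rw [extChartAt_totalSpace_apply (by rw [hf x, hf y]; exact hq.2), hf x, hf y, hL y hys.1 hq.2,
    ← hyq, extChartAt_totalSpace_apply hys.1]

/-- The derivative of the projection of a bundle. -/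
theorem hasMFDerivAt_proj_totalSpace [IB.Boundaryless] (e : TotalSpace F E) :
    HasMFDerivAt (IB.prod 𝓘(ℝ, F)) IB (TotalSpace.proj : TotalSpace F E → B) e
      (ContinuousLinearMap.fst ℝ EB F : EB × F →L[ℝ] EB) := by
  refine ⟨(FiberBundle.continuous_proj F E).continuousAt, ?_⟩
  refine ((ContinuousLinearMap.fst ℝ EB F).hasFDerivAt.congr_of_eventuallyEq
    ?_).hasFDerivWithinAt
  filter_upwards [extChartAt_target_mem_nhds (I := IB.prod 𝓘(ℝ, F)) e] with q hq
  set y := (extChartAt (IB.prod 𝓘(ℝ, F)) e).symm q with hy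
  have hyq : extChartAt (IB.prod 𝓘(ℝ, F)) e y = q := (extChartAt _ e).right_inv hq
  have hys := mem_extChartAt_totalSpace_source_iff.1 ((extChartAt _ e).map_target hq)
  change extChartAt IB e.proj y.proj = q.1
  rw [← hyq, extChartAt_totalSpace_apply hys.1]

theorem mem_vert_proj_iff [IB.Boundaryless] {e : TotalSpace F E}
    {w : TangentSpace (IB.prod 𝓘(ℝ, F)) e} :
    w ∈ vert IB (IB.prod 𝓘(ℝ, F)) (TotalSpace.proj : TotalSpace F E → B) e ↔
      (w : EB × F).1 = 0 := by
  change mfderiv (IB.prod 𝓘(ℝ, F)) IB (TotalSpace.proj : TotalSpace F E → B) e w = 0 ↔ _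
  rw [(hasMFDerivAt_proj_totalSpace e).mfderiv]
  rfl

end TotalSpace

/-! ### Linear connections in bundle charts. -/

section VectorBundle

variable {EB HB B : Type*} [NormedAddCommGroup EB] [NormedSpace ℝ EB] [TopologicalSpace HB]
  {IB : ModelWithCorners ℝ EB HB} [TopologicalSpace B] [ChartedSpace HB B]
  {F : Type*} [NormedAddCommGroup F] [NormedSpace ℝ F]
  {E : B → Type*} [TopologicalSpace (TotalSpace F E)] [∀ b, AddCommGroup (E b)]
  [∀ b, Module ℝ (E b)] [∀ b, TopologicalSpace (E b)] [FiberBundle F E] [VectorBundle ℝ F E]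

theorem trivialization_add {b₀ b : B} (hb : b ∈ (trivializationAt F E b₀).baseSet) (u v : E b) :
    (trivializationAt F E b₀ ⟨b, u + v⟩).2 =
      (trivializationAt F E b₀ ⟨b, u⟩).2 + (trivializationAt F E b₀ ⟨b, v⟩).2 :=
  ((trivializationAt F E b₀).linear ℝ hb).1 u v

theorem trivialization_smul {b₀ b : B} (hb : b ∈ (trivializationAt F E b₀).baseSet) (r : ℝ)
    (u : E b) : (trivializationAt F E b₀ ⟨b, r • u⟩).2 = r • (trivializationAt F E b₀ ⟨b, u⟩).2 :=
  ((trivializationAt F E b₀).linear ℝ hb).2 r u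

variable [IsManifold IB ∞ B] [ContMDiffVectorBundle ∞ F E IB]

/-- The vertical lift in coordinates. -/
theorem coordVec_vertLift {e₀ e : TotalSpace F E}
    (he : e ∈ (extChartAt (IB.prod 𝓘(ℝ, F)) e₀).source) (u : E e.proj) :
    coordVec (IB.prod 𝓘(ℝ, F)) e₀
      (⟨e, vertLift IB F E e u⟩ : TangentBundle (IB.prod 𝓘(ℝ, F)) (TotalSpace F E)) =
      ((0, (trivializationAt F E e₀.proj ⟨e.proj, u⟩).2) : EB × F) := by
  obtain ⟨b, e⟩ := e
  set c : ℝ → TotalSpace F E := fun r => ⟨b, e + r • u⟩ with hc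
  have hc0 : c 0 = ⟨b, e⟩ := by simp [hc]
  have hb : ∀ b₀, b ∈ (trivializationAt F E b₀).baseSet → ∀ r,
      (trivializationAt F E b₀ (c r)).2 = (trivializationAt F E b₀ ⟨b, e⟩).2 +
        r • (trivializationAt F E b₀ ⟨b, u⟩).2 := fun b₀ h r => by
    rw [← trivialization_smul h, ← trivialization_add h]
  have hm : ContMDiff 𝓘(ℝ, ℝ) (IB.prod 𝓘(ℝ, F)) ∞ c := fun r => by
    rw [Bundle.contMDiffAt_totalSpace]
    refine ⟨contMDiffAt_const, ?_⟩
    have h := hb b (mem_baseSet_trivializationAt F E b)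
    have h2 : ContDiffAt ℝ ∞ (fun r : ℝ => (trivializationAt F E b ⟨b, e⟩).2 +
        r • (trivializationAt F E b ⟨b, u⟩).2) r := by fun_prop
    exact h2.contMDiffAt.congr_of_eventuallyEq (Filter.Eventually.of_forall h)
  have he' : (⟨b, e⟩ : TotalSpace F E).proj ∈ (trivializationAt F E e₀.proj).baseSet :=
    (mem_extChartAt_totalSpace_source_iff.1 he).1
  have h1 := hasDerivWithinAt_univ.1 (hasDerivWithinAt_extChartAt_comp (x₀ := e₀) (t := 0)
    ((hm 0).mdifferentiableAt (by simp)).mdifferentiableWithinAt (J := univ) (by rwa [hc0]))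
  have h2 : HasDerivAt (fun r => extChartAt (IB.prod 𝓘(ℝ, F)) e₀ (c r))
      ((0, (trivializationAt F E e₀.proj ⟨b, u⟩).2) : EB × F) 0 := by
    have : (fun r => extChartAt (IB.prod 𝓘(ℝ, F)) e₀ (c r)) = fun r =>
        (extChartAt IB e₀.proj b, (trivializationAt F E e₀.proj ⟨b, e⟩).2 +
        r • (trivializationAt F E e₀.proj ⟨b, u⟩).2) := by
      funext r
      rw [extChartAt_totalSpace_apply (e := c r) he', hb _ he' r]
    rw [this]
    refine (hasDerivAt_const _ _).prodMk ?_
    simpa using ((hasDerivAt_id (0 : ℝ)).smul_const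
      (trivializationAt F E e₀.proj ⟨b, u⟩).2).const_add (trivializationAt F E e₀.proj ⟨b, e⟩).2
  refine Eq.trans ?_ (h1.unique h2)
  have hv : (⟨⟨b, e⟩, vertLift IB F E ⟨b, e⟩ u⟩ :
      TangentBundle (IB.prod 𝓘(ℝ, F)) (TotalSpace F E)) =
      velocity (IB.prod 𝓘(ℝ, F)) c univ 0 := by
    unfold velocity
    rw [mfderivWithin_univ]
    exact mk_snd_eq (X := ⟨c 0, mfderiv 𝓘(ℝ, ℝ) (IB.prod 𝓘(ℝ, F)) c 0 (1 : ℝ)⟩) hc0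
  rw [hv]

theorem coordVec_of_proj_eq {e₀ : TotalSpace F E}
    {X : TangentBundle (IB.prod 𝓘(ℝ, F)) (TotalSpace F E)} (h : X.proj.proj = e₀.proj) :
    coordVec (IB.prod 𝓘(ℝ, F)) e₀ X = X.snd := by
  have h1 : (tangentCoordChange (IB.prod 𝓘(ℝ, F)) X.proj e₀ X.proj : EB × F →L[ℝ] EB × F) =
      tangentCoordChange (IB.prod 𝓘(ℝ, F)) X.proj X.proj X.proj := by
    rw [tangentCoordChange_def, tangentCoordChange_def, extChartAt_totalSpace_congr h]
  exact (congrArg (fun L : EB × F →L[ℝ] EB × F => L X.snd) h1).trans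
    (tangentCoordChange_self (mem_extChartAt_source X.proj))

theorem vertLift_eq (e : TotalSpace F E) (u : E e.proj) :
    vertLift IB F E e u = ((0, (trivializationAt F E e.proj ⟨e.proj, u⟩).2) : EB × F) :=
  (coordVec_self (I := IB.prod 𝓘(ℝ, F))
    (⟨e, vertLift IB F E e u⟩ : TangentBundle (IB.prod 𝓘(ℝ, F)) (TotalSpace F E))).symm.trans
    (coordVec_vertLift (mem_extChartAt_source e) u)

variable (IB) in
theorem vertLift_injective (e : TotalSpace F E) {u v : E e.proj}
    (h : vertLift IB F E e u = vertLift IB F E e v) : u = v := by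
  rw [vertLift_eq, vertLift_eq] at h
  have h2 : (trivializationAt F E e.proj ⟨e.proj, u⟩).2 =
      (trivializationAt F E e.proj ⟨e.proj, v⟩).2 := congrArg (fun q : EB × F => q.2) h
  have hb := mem_baseSet_trivializationAt F E e.proj
  exact (((trivializationAt F E e.proj).continuousLinearEquivAt ℝ e.proj hb).injective h2)

variable (IB) in
theorem exists_vertLift_eq (e : TotalSpace F E) (f : F) :
    ∃ u : E e.proj, vertLift IB F E e u = ((0, f) : EB × F) := by
  have hb := mem_baseSet_trivializationAt F E e.proj
  refine ⟨(trivializationAt F E e.proj).symm e.proj f, ?_⟩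
  rw [vertLift_eq, (trivializationAt F E e.proj).apply_mk_symm hb]

namespace Connection

variable (C : Connection IB (IB.prod 𝓘(ℝ, F)) (TotalSpace.proj : TotalSpace F E → B))

/-- The vertical projection in the preferred chart. -/
def chartV (e : TotalSpace F E) : EB × F →L[ℝ] EB × F := C.V e

/-- Along a fibre no change of chart occurs, so the coordinate field is V itself. Algebraic
linearity in the fibre thus becomes information on derivatives of the field. -/
theorem coordV_totalSpace {e₀ e : TotalSpace F E} (h : e.proj = e₀.proj) (w : EB × F) :
    C.coordV e₀ (extChartAt (IB.prod 𝓘(ℝ, F)) e₀ e) w = C.chartV e w := by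
  have hs : e ∈ (extChartAt (IB.prod 𝓘(ℝ, F)) e₀).source := by
    rw [← extChartAt_totalSpace_congr h]
    exact mem_extChartAt_source e
  have h1 := C.coordV_coordVec (x₀ := e₀)
    (X := (⟨e, w⟩ : TangentBundle (IB.prod 𝓘(ℝ, F)) (TotalSpace F E))) hs
  rw [coordVec_of_proj_eq h, coordVec_of_proj_eq h] at h1
  exact h1

variable [IB.Boundaryless]

theorem chartV_fst (e : TotalSpace F E) (w : EB × F) : (C.chartV e w).1 = 0 := by
  have : C.V e w ∈ vert IB (IB.prod 𝓘(ℝ, F)) (TotalSpace.proj : TotalSpace F E → B) e := by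
    rw [← C.range_eq]
    exact ⟨w, rfl⟩
  exact mem_vert_proj_iff.1 this

theorem chartV_vertical (e : TotalSpace F E) (f : F) : C.chartV e (0, f) = (0, f) :=
  C.V_eq_self_iff.2 (mem_vert_proj_iff.2 rfl)

theorem chartV_eq (e : TotalSpace F E) (u : EB) (f : F) :
    C.chartV e (u, f) = C.chartV e (u, 0) + (0, f) := by
  rw [← C.chartV_vertical e f, ← map_add]
  simp

/-- Vectors (0, f) are vertical at every point of the chart, not only over the base point of e₀;
this can be differentiated in z. -/
theorem coordV_vertical {e₀ : TotalSpace F E} {z : EB × F}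
    (hz : z ∈ (extChartAt (IB.prod 𝓘(ℝ, F)) e₀).target) (f : F) :
    C.coordV e₀ z (0, f) = (0, f) := by
  set e := (extChartAt (IB.prod 𝓘(ℝ, F)) e₀).symm z with he
  have hs : e ∈ (extChartAt (IB.prod 𝓘(ℝ, F)) e₀).source := (extChartAt _ e₀).map_target hz
  have hb := (mem_extChartAt_totalSpace_source_iff.1 hs).1
  have h1 := coordVec_vertLift hs ((trivializationAt F E e₀.proj).symm e.proj f)
  rw [(trivializationAt F E e₀.proj).apply_mk_symm hb] at h1
  set X : TangentBundle (IB.prod 𝓘(ℝ, F)) (TotalSpace F E) :=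
    ⟨e, vertLift IB F E e ((trivializationAt F E e₀.proj).symm e.proj f)⟩ with hX
  have h2 : X ∈ C.vertSet := by
    refine mem_vert_proj_iff.2 ?_
    rw [hX, vertLift_eq]
  have h3 := (C.mem_vertSet_iff (X := X) hs).1 h2
  rw [h1] at h3
  have h4 : extChartAt (IB.prod 𝓘(ℝ, F)) e₀ X.proj = z := (extChartAt _ e₀).right_inv hz
  rwa [h4] at h3

/-- Linearity is applied to the vector (u, 0, 0) of T(E ×_B E) at (e₁, e₂): both projections and the
sum have the identity as their base part, so they all send it to (u, 0). -/
theorem IsLinear.chartV_add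
    {C : Connection IB (IB.prod 𝓘(ℝ, F)) (TotalSpace.proj : TotalSpace F E → B)}
    (hC : C.IsLinear) (b : B) (e₁ e₂ : E b) (u : EB) :
    C.chartV ⟨b, e₁ + e₂⟩ (u, 0) = C.chartV ⟨b, e₁⟩ (u, 0) + C.chartV ⟨b, e₂⟩ (u, 0) := by
  set x : TotalSpace (F × F) (E ×ᵇ E) := ⟨b, (e₁, e₂)⟩ with hx
  have h1 := (hasMFDerivAt_of_trivializationAt (IB := IB) (f := fibreFst (F := F) (E := E))
    (fun _ => rfl) x (ContinuousLinearMap.fst ℝ F F) fun y _ _ => rfl).mfderiv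
  have h2 := (hasMFDerivAt_of_trivializationAt (IB := IB) (f := fibreSnd (F := F) (E := E))
    (fun _ => rfl) x (ContinuousLinearMap.snd ℝ F F) fun y _ _ => rfl).mfderiv
  have h3 := (hasMFDerivAt_of_trivializationAt (IB := IB) (f := fibreAdd (F := F) (E := E))
    (fun _ => rfl) x (ContinuousLinearMap.fst ℝ F F + ContinuousLinearMap.snd ℝ F F)
    fun y _ h => trivialization_add h y.snd.1 y.snd.2).mfderiv
  have h := hC.1 x ((u, 0) : EB × F × F)
    ((0, (C.chartV ⟨b, e₁⟩ (u, 0)).2, (C.chartV ⟨b, e₂⟩ (u, 0)).2) : EB × F × F)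
  rw [h1, h2, h3] at h
  have h4 := h (Prod.ext (C.chartV_fst ⟨b, e₁⟩ (u, 0)).symm rfl)
    (Prod.ext (C.chartV_fst ⟨b, e₂⟩ (u, 0)).symm rfl)
  have h5 : ((0, (C.chartV ⟨b, e₁⟩ (u, 0)).2 + (C.chartV ⟨b, e₂⟩ (u, 0)).2) : EB × F) =
    C.chartV ⟨b, e₁ + e₂⟩ (u, 0 + 0) := h4
  rw [add_zero] at h5
  rw [← h5]
  refine Prod.ext ?_ rfl
  rw [Prod.fst_add, chartV_fst, chartV_fst, add_zero]

theorem IsLinear.chartV_smul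
    {C : Connection IB (IB.prod 𝓘(ℝ, F)) (TotalSpace.proj : TotalSpace F E → B)}
    (hC : C.IsLinear) (b : B) (r : ℝ) (e : E b) (u : EB) :
    C.chartV ⟨b, r • e⟩ (u, 0) = r • C.chartV ⟨b, e⟩ (u, 0) := by
  have h1 := (hasMFDerivAt_of_trivializationAt (IB := IB) (f := fibreSMul (F := F) (E := E) r)
    (fun _ => rfl) ⟨b, e⟩ (r • ContinuousLinearMap.id ℝ F)
    fun y _ h => trivialization_smul h r y.snd).mfderiv
  have h := hC.2 r ⟨b, e⟩ ((u, 0) : EB × F)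
  rw [h1] at h
  have h2 : C.chartV ⟨b, r • e⟩ (u, r • (0 : F)) =
    ((C.chartV ⟨b, e⟩ (u, 0)).1, r • (C.chartV ⟨b, e⟩ (u, 0)).2) := h
  rw [smul_zero] at h2
  rw [h2]
  refine Prod.ext ?_ rfl
  rw [Prod.smul_fst, chartV_fst, smul_zero]

section CovariantDerivative

variable [FiniteDimensional ℝ EB] [FiniteDimensional ℝ F]

/-- The map z ↦ V(z)(0, f) is constant near e. -/
theorem fderiv_coordV_vertical (e : TotalSpace F E) (w : EB × F) (f : F) :
    fderiv ℝ (C.coordV e) (extChartAt (IB.prod 𝓘(ℝ, F)) e e) w ((0, f) : EB × F) = 0 := by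
  have hz := mem_extChartAt_target (I := IB.prod 𝓘(ℝ, F)) e
  have hd := ((C.contDiffAt_coordV hz).differentiableAt (by simp)).hasFDerivAt
  have h1 := hd.clm_apply (hasFDerivAt_const (𝕜 := ℝ) ((0, f) : EB × F) _)
  have h2 := (hasFDerivAt_const (𝕜 := ℝ) ((0, f) : EB × F)
    (extChartAt (IB.prod 𝓘(ℝ, F)) e e)).congr_of_eventuallyEq
    (Filter.eventuallyEq_of_mem (extChartAt_target_mem_nhds (I := IB.prod 𝓘(ℝ, F)) e)
      fun z hz => C.coordV_vertical hz f)
  have h3 := congrArg (fun L : EB × F →L[ℝ] EB × F => L w) (h1.unique h2)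
  simpa using h3

/-- Along the line e + r α the value V(u, f) is V_e(u, 0) + (0, f) + r V_α(u, 0), which is affine in
r. -/
theorem IsLinear.fderiv_coordV
    {C : Connection IB (IB.prod 𝓘(ℝ, F)) (TotalSpace.proj : TotalSpace F E → B)}
    (hC : C.IsLinear) (e : TotalSpace F E) (α : E e.proj) (u : EB) (f : F) :
    fderiv ℝ (C.coordV e) (extChartAt (IB.prod 𝓘(ℝ, F)) e e)
      ((0, (trivializationAt F E e.proj ⟨e.proj, α⟩).2) : EB × F) ((u, f) : EB × F) =
      C.chartV ⟨e.proj, α⟩ (u, 0) := by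
  have hz := mem_extChartAt_target (I := IB.prod 𝓘(ℝ, F)) e
  have hd := ((C.contDiffAt_coordV hz).differentiableAt (by simp)).hasFDerivAt
  have hb := mem_baseSet_trivializationAt F E e.proj
  set a : EB × F := (0, (trivializationAt F E e.proj ⟨e.proj, α⟩).2) with ha
  have hl : ∀ r : ℝ, extChartAt (IB.prod 𝓘(ℝ, F)) e e + r • a =
      extChartAt (IB.prod 𝓘(ℝ, F)) e ⟨e.proj, e.snd + r • α⟩ := fun r => by
    rw [extChartAt_totalSpace_apply (e₀ := e) (e := e) hb,
      extChartAt_totalSpace_apply (e₀ := e) (e := ⟨e.proj, e.snd + r • α⟩) hb,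
      trivialization_add hb, trivialization_smul hb, ha]
    simp
  have h1 : HasDerivAt (fun r : ℝ => extChartAt (IB.prod 𝓘(ℝ, F)) e e + r • a) a 0 := by
    simpa using ((hasDerivAt_id (0 : ℝ)).smul_const a).const_add
      (extChartAt (IB.prod 𝓘(ℝ, F)) e e)
  have h0 : extChartAt (IB.prod 𝓘(ℝ, F)) e e + (0 : ℝ) • a = extChartAt (IB.prod 𝓘(ℝ, F)) e e := by
    rw [zero_smul, add_zero]
  have hd' : HasFDerivAt (C.coordV e) (fderiv ℝ (C.coordV e) (extChartAt (IB.prod 𝓘(ℝ, F)) e e))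
      (extChartAt (IB.prod 𝓘(ℝ, F)) e e + (0 : ℝ) • a) := by
    rw [h0]; exact hd
  have h2 : HasDerivAt (fun r : ℝ => C.coordV e (extChartAt (IB.prod 𝓘(ℝ, F)) e e + r • a))
      (fderiv ℝ (C.coordV e) (extChartAt (IB.prod 𝓘(ℝ, F)) e e) a) 0 :=
    hd'.comp_hasDerivAt (f := fun r : ℝ => extChartAt (IB.prod 𝓘(ℝ, F)) e e + r • a) (0 : ℝ) h1
  have h5 : HasDerivAt
      (fun r : ℝ => C.coordV e (extChartAt (IB.prod 𝓘(ℝ, F)) e e + r • a) ((u, f) : EB × F))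
      (fderiv ℝ (C.coordV e) (extChartAt (IB.prod 𝓘(ℝ, F)) e e) a ((u, f) : EB × F)) 0 :=
    ((ContinuousLinearMap.apply ℝ (EB × F) ((u, f) : EB × F)).hasFDerivAt).comp_hasDerivAt
      (0 : ℝ) h2
  have h3 : ∀ r : ℝ, C.coordV e (extChartAt (IB.prod 𝓘(ℝ, F)) e e + r • a) ((u, f) : EB × F) =
      (C.chartV e (u, 0) + (0, f)) + r • C.chartV ⟨e.proj, α⟩ (u, 0) := by
    intro r
    rw [hl, C.coordV_totalSpace (e₀ := e) (e := ⟨e.proj, e.snd + r • α⟩) rfl, C.chartV_eq,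
      hC.chartV_add, hC.chartV_smul]
    exact add_right_comm _ _ _
  have h4 : HasDerivAt (fun r : ℝ => (C.chartV e (u, 0) + (0, f)) +
      r • C.chartV ⟨e.proj, α⟩ (u, 0)) (C.chartV ⟨e.proj, α⟩ (u, 0)) 0 := by
    simpa using ((hasDerivAt_id (0 : ℝ)).smul_const (C.chartV ⟨e.proj, α⟩ (u, 0))).const_add
      (C.chartV e (u, 0) + (0, f))
  exact h5.unique (h4.congr_of_eventuallyEq (Filter.Eventually.of_forall h3))

end CovariantDerivative

end Connection

end VectorBundle

/-! ### Comparison of the covariant derivatives. -/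

section CovariantDerivative

variable {EB HB B : Type*} [NormedAddCommGroup EB] [NormedSpace ℝ EB] [TopologicalSpace HB]
  {IB : ModelWithCorners ℝ EB HB} [TopologicalSpace B] [ChartedSpace HB B]
  {F : Type*} [NormedAddCommGroup F] [NormedSpace ℝ F]
  {E : B → Type*} [TopologicalSpace (TotalSpace F E)] [∀ b, AddCommGroup (E b)]
  [∀ b, Module ℝ (E b)] [∀ b, TopologicalSpace (E b)] [FiberBundle F E] [VectorBundle ℝ F E]
  [IsManifold IB ∞ B] [ContMDiffVectorBundle ∞ F E IB]

/-- The vertical lift of a section along a path is smooth. -/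
theorem contMDiffOn_vertLift {J : Set ℝ} {β : ℝ → TotalSpace F E}
    (hβ : ContMDiffOn 𝓘(ℝ, ℝ) (IB.prod 𝓘(ℝ, F)) ∞ β J) {α : ∀ x : B, E x}
    (hα : ContMDiff IB (IB.prod 𝓘(ℝ, F)) ∞ (fun x : B => (⟨x, α x⟩ : TotalSpace F E))) :
    ContMDiffOn 𝓘(ℝ, ℝ) (IB.prod 𝓘(ℝ, F)).tangent ∞
      (fun t : ℝ => (⟨β t, vertLift IB F E (β t) (α (β t).proj)⟩ :
        TangentBundle (IB.prod 𝓘(ℝ, F)) (TotalSpace F E))) J := by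
  intro t ht
  have h1 : ContMDiffWithinAt 𝓘(ℝ, ℝ) IB ∞ (fun r => (β r).proj) J t :=
    (Bundle.contMDiffWithinAt_totalSpace.1 (hβ t ht)).1
  have h2 : ContMDiffWithinAt 𝓘(ℝ, ℝ) (IB.prod 𝓘(ℝ, F)) ∞
      (fun r => (⟨(β r).proj, α (β r).proj⟩ : TotalSpace F E)) J t :=
    (hα (β t).proj).comp_contMDiffWithinAt t h1
  have h3 := (Bundle.contMDiffWithinAt_totalSpace.1 h2).2
  refine Bundle.contMDiffWithinAt_totalSpace.2 ⟨hβ t ht, ?_⟩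
  have hs : ∀ᶠ r in 𝓝[J] t, β r ∈ (extChartAt (IB.prod 𝓘(ℝ, F)) (β t)).source :=
    (hβ t ht).continuousWithinAt.preimage_mem_nhdsWithin (extChartAt_source_mem_nhds (β t))
  have h4 : ContMDiffWithinAt 𝓘(ℝ, ℝ) 𝓘(ℝ, EB × F) ∞ (fun r => ((0, (trivializationAt F E
      (β t).proj ⟨(β r).proj, α (β r).proj⟩).2) : EB × F)) J t := by
    refine ContDiffWithinAt.contMDiffWithinAt ?_
    exact contDiffWithinAt_const.prodMk h3.contDiffWithinAt
  have h5 : ∀ r, β r ∈ (extChartAt (IB.prod 𝓘(ℝ, F)) (β t)).source → _ :=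
    fun r hr => coordVec_vertLift hr (α (β r).proj)
  exact h4.congr_of_eventuallyEq (hs.mono h5) (h5 t (mem_extChartAt_source _))

namespace Connection

variable [IB.Boundaryless]
  {C : Connection IB (IB.prod 𝓘(ℝ, F)) (TotalSpace.proj : TotalSpace F E → B)}

theorem isSectionOn_vertLift {J : Set ℝ} {β : ℝ → TotalSpace F E}
    (hβ : ContMDiffOn 𝓘(ℝ, ℝ) (IB.prod 𝓘(ℝ, F)) ∞ β J) {α : ∀ x : B, E x}
    (hα : ContMDiff IB (IB.prod 𝓘(ℝ, F)) ∞ (fun x : B => (⟨x, α x⟩ : TotalSpace F E))) :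
    C.IsSectionOn β J (fun r => vertLift IB F E (β r) (α (β r).proj)) :=
  ⟨contMDiffOn_vertLift hβ hα, fun t _ => mem_vert_proj_iff.2
    (congrArg Prod.fst (vertLift_eq (β t) (α (β t).proj)))⟩

variable [FiniteDimensional ℝ EB] [FiniteDimensional ℝ F]

/-- The covariant derivatives of a section of a vector bundle with a linear connection and of the
corresponding section of `β*K`, in coordinates. -/
theorem IsLinear.isCovDerivAt_iff (hC : C.IsLinear) {J : Set ℝ} {t : ℝ}
    (hJ : UniqueDiffWithinAt ℝ J t) (ht : t ∈ J) {β : ℝ → TotalSpace F E}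
    (hβ : C.IsHorizontalOn J β) {α : ∀ x : B, E x}
    (hα : ContMDiff IB (IB.prod 𝓘(ℝ, F)) ∞ (fun x : B => (⟨x, α x⟩ : TotalSpace F E)))
    (z : EB × F) :
    C.IsCovDerivAt β J (fun r => vertLift IB F E (β r) (α (β r).proj)) t z ↔
      z = C.chartV ⟨(β t).proj, α (β t).proj⟩
        (mfderiv IB (IB.prod 𝓘(ℝ, F)) (fun b => (⟨b, α b⟩ : TotalSpace F E)) (β t).proj
          (velocity IB (fun r => (β r).proj) J t).snd) := by
  set e := β t with he
  have hb := mem_baseSet_trivializationAt F E e.proj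
  have hγ : ContMDiffWithinAt 𝓘(ℝ, ℝ) IB ∞ (fun r => (β r).proj) J t :=
    (Bundle.contMDiffWithinAt_totalSpace.1 (hβ.1 t ht)).1
  have hδ : ContMDiffWithinAt 𝓘(ℝ, ℝ) (IB.prod 𝓘(ℝ, F)) ∞
      (fun r => (⟨(β r).proj, α (β r).proj⟩ : TotalSpace F E)) J t :=
    (hα (β t).proj).comp_contMDiffWithinAt t hγ
  have hδ2 : DifferentiableWithinAt ℝ
      (fun r => (trivializationAt F E e.proj ⟨(β r).proj, α (β r).proj⟩).2) J t :=
    ((Bundle.contMDiffWithinAt_totalSpace.1 hδ).2.contDiffWithinAt).differentiableWithinAt (by simp)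
  set d : F := derivWithin
    (fun r => (trivializationAt F E e.proj ⟨(β r).proj, α (β r).proj⟩).2) J t with hd
  have hdd := hδ2.hasDerivWithinAt
  set X : TangentBundle (IB.prod 𝓘(ℝ, F)) (TotalSpace F E) :=
    ⟨e, vertLift IB F E e (α e.proj)⟩ with hX
  set w : EB × F := (velocity (IB.prod 𝓘(ℝ, F)) β J t).snd with hw
  have hs : ∀ᶠ r in 𝓝[J] t, β r ∈ (extChartAt (IB.prod 𝓘(ℝ, F)) e).source :=
    (hβ.1 t ht).continuousWithinAt.preimage_mem_nhdsWithin (extChartAt_source_mem_nhds (β t))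
  -- the derivative of the path in coordinates
  have hβd : HasDerivWithinAt (fun r => extChartAt (IB.prod 𝓘(ℝ, F)) e (β r)) w J t := by
    have h := hasDerivWithinAt_extChartAt_comp (x₀ := e)
      ((hβ.1 t ht).mdifferentiableWithinAt (by simp)) (mem_extChartAt_source _)
    have h2 := coordVec_self (velocity (IB.prod 𝓘(ℝ, F)) β J t)
    exact (congrArg (fun v : EB × F => HasDerivWithinAt
      (fun r => extChartAt (IB.prod 𝓘(ℝ, F)) e (β r)) v J t) h2).mp h
  have hφd : HasDerivWithinAt (fun r => extChartAt IB e.proj (β r).proj) w.1 J t := by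
    refine (hasFDerivAt_fst.comp_hasDerivWithinAt t hβd).congr_of_eventuallyEq ?_ ?_
    · refine hs.mono fun r hr => ?_
      exact (congrArg Prod.fst (extChartAt_totalSpace_apply
        (mem_extChartAt_totalSpace_source_iff.1 hr).1)).symm
    · exact (congrArg Prod.fst (extChartAt_totalSpace_apply hb)).symm
  -- the derivative of the vertical lift in coordinates
  have hσv : coordVec (IB.prod 𝓘(ℝ, F)).tangent X
      (velocity (IB.prod 𝓘(ℝ, F)).tangent (fun r => (⟨β r, vertLift IB F E (β r) (α (β r).proj)⟩ :
        TangentBundle (IB.prod 𝓘(ℝ, F)) (TotalSpace F E))) J t) =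
      ((w, (0, d)) : (EB × F) × (EB × F)) := by
    have h1 := hasDerivWithinAt_extChartAt_comp (x₀ := X)
      ((contMDiffOn_vertLift hβ.1 hα t ht).mdifferentiableWithinAt (by simp))
      (mem_extChartAt_source _)
    refine hJ.eq_deriv _ h1 ?_
    have h2 := hβd.prodMk ((hasDerivWithinAt_const t J (0 : EB)).prodMk hdd)
    have h5 : ∀ r, β r ∈ (extChartAt (IB.prod 𝓘(ℝ, F)) e).source → _ :=
      fun r hr => coordVec_vertLift hr (α (β r).proj)
    refine h2.congr_of_eventuallyEq (hs.mono fun r hr => ?_) ?_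
    · exact Prod.ext rfl (h5 r hr)
    · exact Prod.ext rfl (h5 t (mem_extChartAt_source _))
  -- the derivative of the section in coordinates
  have hαv : (mfderiv IB (IB.prod 𝓘(ℝ, F)) (fun b => (⟨b, α b⟩ : TotalSpace F E)) e.proj
      (velocity IB (fun r => (β r).proj) J t).snd : EB × F) = (w.1, d) := by
    set e' : TotalSpace F E := ⟨e.proj, α e.proj⟩ with he'
    have h0 := congrArg (coordVec (IB.prod 𝓘(ℝ, F)) e')
      (tangentMap_velocity hJ (hγ.mdifferentiableWithinAt (by simp))
        ((hα e.proj).mdifferentiableAt (by simp)))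
    have h1 := hasDerivWithinAt_extChartAt_comp (x₀ := e') (hδ.mdifferentiableWithinAt (by simp))
      (mem_extChartAt_source e')
    have hs' : ∀ᶠ r in 𝓝[J] t, (β r).proj ∈ (trivializationAt F E e.proj).baseSet :=
      hs.mono fun r hr => (mem_extChartAt_totalSpace_source_iff.1 hr).1
    have h2 : HasDerivWithinAt (fun r => extChartAt (IB.prod 𝓘(ℝ, F)) e'
        (⟨(β r).proj, α (β r).proj⟩ : TotalSpace F E)) ((w.1, d) : EB × F) J t :=
      (hφd.prodMk hdd).congr_of_eventuallyEq
        (hs'.mono fun r hr => extChartAt_totalSpace_apply (e₀ := e')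
          (e := ⟨(β r).proj, α (β r).proj⟩) hr)
        (extChartAt_totalSpace_apply (e₀ := e') (e := e') hb)
    exact (coordVec_self (tangentMap IB (IB.prod 𝓘(ℝ, F)) (fun b => (⟨b, α b⟩ : TotalSpace F E))
      (velocity IB (fun r => (β r).proj) J t))).symm.trans (h0.trans (hJ.eq_deriv _ h1 h2))
  have hwV : C.chartV e w = 0 := hβ.2 t ht
  -- Here the vertical lift is that of the vector bundle TE over E; in the preferred trivialization
  -- at e the vector z is its own coordinate.
  have hψ : (vertLift (IB.prod 𝓘(ℝ, F)) (EB × F)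
      (TangentSpace (IB.prod 𝓘(ℝ, F)) : TotalSpace F E → Type _) X z :
      (EB × F) × (EB × F)) = (0, z) :=
    (vertLift_eq (IB := IB.prod 𝓘(ℝ, F)) X z).trans (Prod.ext rfl
      (coordVec_self (⟨e, z⟩ : TangentBundle (IB.prod 𝓘(ℝ, F)) (TotalSpace F E))))
  have hv : ((velocity (IB.prod 𝓘(ℝ, F)).tangent
      (fun r => (⟨β r, vertLift IB F E (β r) (α (β r).proj)⟩ :
        TangentBundle (IB.prod 𝓘(ℝ, F)) (TotalSpace F E))) J t).snd : (EB × F) × (EB × F)) =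
      (w, (0, d)) :=
    (coordVec_self (velocity (IB.prod 𝓘(ℝ, F)).tangent
      (fun r => (⟨β r, vertLift IB F E (β r) (α (β r).proj)⟩ :
        TangentBundle (IB.prod 𝓘(ℝ, F)) (TotalSpace F E))) J t)).symm.trans hσv
  let v : (EB × F) × (EB × F) := (velocity (IB.prod 𝓘(ℝ, F)).tangent
    (fun r => (⟨β r, vertLift IB F E (β r) (α (β r).proj)⟩ :
      TangentBundle (IB.prod 𝓘(ℝ, F)) (TotalSpace F E))) J t).snd
  let ψ : (EB × F) × (EB × F) := vertLift (IB.prod 𝓘(ℝ, F)) (EB × F)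
    (TangentSpace (IB.prod 𝓘(ℝ, F)) : TotalSpace F E → Type _) X z
  set W : TangentBundle (IB.prod 𝓘(ℝ, F)).tangent
    (TangentBundle (IB.prod 𝓘(ℝ, F)) (TotalSpace F E)) := ⟨X, v - ψ⟩ with hW
  have hWc : coordVec (IB.prod 𝓘(ℝ, F)).tangent X W =
      ((w, (0, d) - z) : (EB × F) × (EB × F)) := by
    refine (coordVec_self W).trans ?_
    refine (congrArg₂ (fun p q : (EB × F) × (EB × F) => p - q) hv hψ).trans ?_
    exact Prod.ext (sub_zero w) rfl
  have hXc : coordVec (IB.prod 𝓘(ℝ, F)) e X =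
      ((0, (trivializationAt F E e.proj ⟨e.proj, α e.proj⟩).2) : EB × F) :=
    coordVec_vertLift (mem_extChartAt_source _) _
  -- Two of the three conditions hold automatically: the lifted section is vertical and w is
  -- horizontal. In the third, DV(w)(0, α) vanishes and DV(0, α) w is V_α(w.1, 0).
  have hmem : W ∈ C.canonicalHor ↔ (0, d) - z =
      - C.chartV ⟨e.proj, α e.proj⟩ (w.1, 0) := by
    rw [C.mem_canonicalHor_iff X (W := W) (mem_extChartAt_source e), hWc]
    have h1 : C.coordV e (extChartAt (IB.prod 𝓘(ℝ, F)) e e) (coordVec (IB.prod 𝓘(ℝ, F)) e X) =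
        coordVec (IB.prod 𝓘(ℝ, F)) e X := by
      rw [hXc]; exact C.coordV_vertical (mem_extChartAt_target e) _
    have h2 : C.coordV e (extChartAt (IB.prod 𝓘(ℝ, F)) e e) w = 0 :=
      (C.coordV_totalSpace rfl w).trans hwV
    have h3 : fderiv ℝ (C.coordV e) (extChartAt (IB.prod 𝓘(ℝ, F)) e e) w
        (coordVec (IB.prod 𝓘(ℝ, F)) e X) = 0 := by
      rw [hXc]; exact C.fderiv_coordV_vertical e w _
    have h4 : fderiv ℝ (C.coordV e) (extChartAt (IB.prod 𝓘(ℝ, F)) e e)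
        (coordVec (IB.prod 𝓘(ℝ, F)) e X) w = C.chartV ⟨e.proj, α e.proj⟩ (w.1, 0) := by
      rw [hXc]; exact hC.fderiv_coordV e (α e.proj) w.1 w.2
    change C.coordV e (extChartAt (IB.prod 𝓘(ℝ, F)) e e) (coordVec (IB.prod 𝓘(ℝ, F)) e X) = _ ∧
      C.coordV e (extChartAt (IB.prod 𝓘(ℝ, F)) e e) w = 0 ∧
      (0, d) - z = fderiv ℝ (C.coordV e) (extChartAt (IB.prod 𝓘(ℝ, F)) e e) w
        (coordVec (IB.prod 𝓘(ℝ, F)) e X) - fderiv ℝ (C.coordV e)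
        (extChartAt (IB.prod 𝓘(ℝ, F)) e e) (coordVec (IB.prod 𝓘(ℝ, F)) e X) w ↔ _
    rw [h3, h4, zero_sub]
    exact ⟨fun h => h.2.2, fun h => ⟨h1, h2, h⟩⟩
  have hrhs : C.chartV ⟨e.proj, α e.proj⟩ (w.1, d) =
      C.chartV ⟨e.proj, α e.proj⟩ (w.1, 0) + (0, d) := C.chartV_eq _ _ _
  have hgoal : (z.1 = 0 ∧ W ∈ C.canonicalHor) ↔
      z = C.chartV ⟨e.proj, α e.proj⟩ (w.1, d) := by
    rw [hmem, hrhs]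
    constructor
    · rintro ⟨-, h⟩
      rw [sub_eq_iff_eq_add] at h
      rw [h]
      exact (add_neg_cancel_left _ _).symm
    · intro h
      have h1 : z.1 = 0 := by
        rw [h, ← hrhs]; exact C.chartV_fst _ _
      refine ⟨h1, ?_⟩
      rw [h]
      abel
  exact (and_congr_left' mem_vert_proj_iff).trans (hgoal.trans (iff_of_eq (congrArg
    (fun q : EB × F =>
    z = C.chartV ⟨e.proj, α e.proj⟩ q) hαv.symm)))

/-- The covariant derivative of a section of a vector bundle with a linear connection exists, and
its vertical lift is the covariant derivative, along any horizontal path, of the vertical lift of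
the section. -/
theorem IsLinear.exists_isNabla_iff_isCovDerivAt_iff (hC : C.IsLinear) {J : Set ℝ} {t : ℝ}
    (hJ : UniqueDiffWithinAt ℝ J t) (ht : t ∈ J) {β : ℝ → TotalSpace F E}
    (hβ : C.IsHorizontalOn J β) {α : ∀ x : B, E x}
    (hα : ContMDiff IB (IB.prod 𝓘(ℝ, F)) ∞ (fun x : B => (⟨x, α x⟩ : TotalSpace F E))) :
    ∃ n : E (β t).proj,
      (∀ n', C.IsNabla α (β t).proj (velocity IB (fun r => (β r).proj) J t).snd n' ↔ n' = n) ∧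
      ∀ z, C.IsCovDerivAt β J (fun r => vertLift IB F E (β r) (α (β r).proj)) t z ↔
        z = vertLift IB F E (β t) n := by
  set q : EB × F := C.chartV ⟨(β t).proj, α (β t).proj⟩
    (mfderiv IB (IB.prod 𝓘(ℝ, F)) (fun b => (⟨b, α b⟩ : TotalSpace F E)) (β t).proj
      (velocity IB (fun r => (β r).proj) J t).snd) with hq
  obtain ⟨n, hn⟩ := exists_vertLift_eq IB (β t) q.2
  have hq1 : q = (0, q.2) := Prod.ext (C.chartV_fst _ _) rfl
  have hn' : (vertLift IB F E (β t) n : EB × F) = q := hn.trans hq1.symm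
  -- The lifts of n at β t and at α have the same coordinates, since the trivialization depends only
  -- on the base point. One vector n therefore serves both definitions.
  have hn2 : (vertLift IB F E ⟨(β t).proj, α (β t).proj⟩ n : EB × F) = q :=
    ((vertLift_eq ⟨(β t).proj, α (β t).proj⟩ n).trans (vertLift_eq (β t) n).symm).trans hn'
  refine ⟨n, fun n' => ⟨fun h => ?_, fun h => ?_⟩, fun z => ?_⟩
  · exact vertLift_injective IB ⟨(β t).proj, α (β t).proj⟩ (h.trans hn2.symm)
  · rw [h]; exact hn2
  · exact (hC.isCovDerivAt_iff hJ ht hβ hα z).trans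
      ⟨fun h => h.trans hn'.symm, fun h => h.trans hn'⟩

end Connection

end CovariantDerivative

end Ehresmann

end

theorem theorem8
    {EB HB B : Type*} [NormedAddCommGroup EB] [NormedSpace ℝ EB] [FiniteDimensional ℝ EB]
    [TopologicalSpace HB] (IB : ModelWithCorners ℝ EB HB) [IB.Boundaryless]
    [TopologicalSpace B] [T2Space B] [ChartedSpace HB B] [IsManifold IB ∞ B]
    {EM HM M : Type*} [NormedAddCommGroup EM] [NormedSpace ℝ EM] [FiniteDimensional ℝ EM]
    [TopologicalSpace HM] (I : ModelWithCorners ℝ EM HM) [I.Boundaryless]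
    [TopologicalSpace M] [T2Space M] [ChartedSpace HM M] [IsManifold I ∞ M]
    (F : Type*) [NormedAddCommGroup F] [NormedSpace ℝ F] [FiniteDimensional ℝ F]
    (E : B → Type*) [TopologicalSpace (TotalSpace F E)] [∀ b, AddCommGroup (E b)]
    [∀ b, Module ℝ (E b)] [∀ b, TopologicalSpace (E b)] [FiberBundle F E] [VectorBundle ℝ F E]
    [ContMDiffVectorBundle ∞ F E IB] (a b : ℝ) (hab : a < b) :
    (∀ (p : M → B), ContMDiff I IB ∞ p → (∀ e : M, Function.Surjective (mfderiv I IB p e)) →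
      ∀ (C : Ehresmann.Connection IB I p) (β₀ : ℝ → M), C.IsHorizontalOn (Icc a b) β₀ →
      ∀ s ∈ Icc a b, ∀ t ∈ Icc a b,
        ∃ τ : Ehresmann.vert IB I p (β₀ s) →ₗ[ℝ] Ehresmann.vert IB I p (β₀ t),
          (∀ w z, C.LinTransports β₀ s t w z ↔ z = τ w) ∧
          ∃ (Gs Gt : Set M) (g : M → M),
            Gs ⊆ p ⁻¹' {p (β₀ s)} ∧ Gs ∈ 𝓝[p ⁻¹' {p (β₀ s)}] (β₀ s) ∧
            Gt ⊆ p ⁻¹' {p (β₀ t)} ∧ Gt ∈ 𝓝[p ⁻¹' {p (β₀ t)}] (β₀ t) ∧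
            BijOn g Gs Gt ∧
            (∀ e ∈ Gs, ∀ f, C.Transports (p ∘ β₀) s t e f ↔ f = g e) ∧
            Ehresmann.HasFibreTangentMap g (β₀ s) (β₀ t) τ) ∧
    (∀ (C : Ehresmann.Connection IB (IB.prod 𝓘(ℝ, F)) (TotalSpace.proj : TotalSpace F E → B)),
      C.IsLinear →
      ∀ (β₀ : ℝ → TotalSpace F E), C.IsHorizontalOn (Icc a b) β₀ →
      ∀ α : ∀ x : B, E x,
        ContMDiff IB (IB.prod 𝓘(ℝ, F)) ∞ (fun x : B => (⟨x, α x⟩ : TotalSpace F E)) →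
        C.IsSectionOn β₀ (Icc a b) (fun r => Ehresmann.vertLift IB F E (β₀ r) (α (β₀ r).proj)) ∧
        ∀ t ∈ Icc a b, ∃ n : E (β₀ t).proj,
          (∀ n', C.IsNabla α (β₀ t).proj
            (Ehresmann.velocity IB (fun r => (β₀ r).proj) (Icc a b) t).snd n' ↔ n' = n) ∧
          ∀ z, C.IsCovDerivAt β₀ (Icc a b)
              (fun r => Ehresmann.vertLift IB F E (β₀ r) (α (β₀ r).proj)) t z ↔
            z = Ehresmann.vertLift IB F E (β₀ t) n) := by
  refine ⟨fun p hp hsurj C β₀ hβ s hs t ht =>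
    C.exists_linTransports_eq_tangent_transport hp hsurj hab hβ hs ht, ?_⟩
  intro C hC β₀ hβ α hα
  exact ⟨Ehresmann.Connection.isSectionOn_vertLift hβ.1 hα, fun t ht =>
    hC.exists_isNabla_iff_isCovDerivAt_iff (uniqueDiffOn_Icc hab t ht) ht hβ hα⟩
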